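/- **Setting.** Let $L>0$, let $n\ge 1$, let $N$ be even, and let $v_1,\dots,v_n:\mathbb R\to\mathbb R$ be locally integrable. Put $K=\{2\pi(m+\tfrac12)/L: m\in\mathbb Z\}$ and $K_\otimes=\{(2\pi n m/L,b): m\in\mathbb Z,\ 1\le b\le n\}$. For $\bar a=(a,b)\in K_\otimes$ write $b(\bar a)=b$; box $b$ is the interval $((b-1)L/n,\,bL/n)$. *States.* The state $\int\chi(x_1,\dots,x_N)\,\phi^\dagger(x_1)\cdots\phi^\dagger(x_N)|0\rangle\,dx$ of a Bose field $\phi$ on $[0,L]$ is identified with its normalized symmetric wave function $\frac1{\sqrt{N!}}\sum_{\sigma\in\mathfrak S_N}\chi(x_{\sigma 1},\dots,x_{\sigma N})$; states with different particle numbers are orthogonal. The hardcore boson Hamiltonian $H_0$ is diagonal in the states $|\lambda\rangle$, $\lambda_1<\dots<\lambda_N$ in $K$, with $$\chi=\frac1{N!L^{N/2}}\sum_{\sigma\in\mathfrak S_N}(-1)^\sigma e^{i\sum_jx_j\lambda_{\sigma j}}\prod_{i<j}\mathrm{sgn}(x_i-x_j),$$ and eigenvalues $E(\lambda)=\sum_j\lambda_j^2$.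 For distinct $\bar a_1,\dots,\bar a_N\in K_\otimes$, of which $N_b$ lie in box $b$, the wavelet state $|\bar a_1,\dots,\bar a_N\rangle$ has $$\chi=\frac{(n/L)^{N/2}}{\prod_bN_b!}\sum_{\sigma}(-1)^\sigma e^{i\sum_jx_ja_{\sigma j}}\prod_{i<j,\ b(\bar a_i)=b(\bar a_j)}\mathrm{sgn}(x_i-x_j)\prod_j\mathbf 1_{x_j\in\text{box }b(\bar a_j)},$$ the sum being over the permutations $\sigma\in\mathfrak S_N$ with $b(\bar a_{\sigma j})=b(\bar a_j)$ for all $j$. (This state depends on the order of the labels through a sign.) *Evolution.* Let $\bar\alpha_1,\dots,\bar\alpha_N\in K_\otimes$ be distinct, and let $|\Psi(t)\rangle=\mathcal T\exp\big(-i\int_0^t(H_0+V(s))\,ds\big)|\bar\alpha_1,\dots,\bar\alpha_N\rangle$, where $V(s)=\sum_bv_b(s)\int_{\text{box }b}\phi^\dagger(x)\phi(x)\,dx$; that is, $\Psi$ is the continuous solution, with values in the symmetric square integrable functions on $(0,L)^N$, of $\Psi(t)=e^{-itH_0}\Psi(0)-i\int_0^te^{-i(t-s)H_0}V(s)\Psi(s)\,ds$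 with $\Psi(0)=|\bar\alpha_1,\dots,\bar\alpha_N\rangle$. *The function $\psi_t$.* For $\lambda\in K$ and $\bar a,\bar c\in K_\otimes$ let $$\varphi(\lambda,\bar a)=\frac{i\sqrt n}{L}\,\frac{1-e^{iL\lambda/n}}{\lambda-a}\,e^{-iLb(\bar a)\lambda/n},\qquad G_t(\bar a,\bar c)=\sum_{\lambda\in K}\varphi(\lambda,\bar a)^*\varphi(\lambda,\bar c)e^{-it\lambda^2},$$ $$U_t(\bar a,\bar c)=\sum_{\bar\gamma\in K_\otimes}G_{-t}(\bar a,\bar\gamma)v_{b(\bar\gamma)}(t)G_t(\bar\gamma,\bar c),\qquad \psi_t(\bar a,\bar c)=\sum_{\bar\gamma\in K_\otimes}G_t(\bar a,\bar\gamma)\tilde\psi_t(\bar\gamma,\bar c),$$ where $\tilde\psi$ is the solution, with columns $t\mapsto\tilde\psi_t(\cdot,\bar c)$ continuous in $\ell^2(K_\otimes)$, of $\partial_t\tilde\psi_t(\bar a,\bar c)=-i\sum_{\bar\nu\in K_\otimes}U_t(\bar a,\bar\nu)\tilde\psi_t(\bar\nu,\bar c)$, $\tilde\psi_0(\bar a,\bar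 c)=\delta_{\bar a,\bar c}$ (in integrated form). *The cumulative reduced density matrix.* For a box $b$ and $t\in\mathbb R$ let $$\rho_b^{\rm cumul}=\sum_{X,Y}|X\rangle\langle Y|\sum_{\beta,\gamma}\langle\beta|\Psi(t)\rangle\langle\Psi(t)|\gamma\rangle .$$ Here $X,Y$ run over the finite subsets of $K_\otimes$ localized in box $b$, and $\beta,\gamma$ over the finite subsets of $K_\otimes$ with $X\subset\beta$, $Y\subset\gamma$, $\beta\setminus X=\gamma\setminus Y$. In $|\beta\rangle$ the labels in $X$ are listed first, in the same order as in $|X\rangle$; in $|\gamma\rangle$ those in $Y$, in the same order as in $\langle Y|$; the common rest follows in the same order in both. **Theorem.** The solutions $\Psi$ and $\tilde\psi$ exist and are unique, and the inner sum over $\beta,\gamma$ converges absolutely for all $X,Y$ localized in box $b$. For all $M\ge 0$, all distinct $\bar x_1,\dots,\bar x_M\in K_\otimes$ and all distinct $\bar y_1,\dots,\bar y_M\in K_\otimes$, all localized in box $b$, $$\langle\bar x_1,\dots,\bar x_M|\rho_b^{\rm cumul}|\bar y_1,\dots,\bar y_M\rangle=\sum_{q_1,\dots,q_M=1}^N\det_{i,j=1,\dots,M}\big[\psi_t(\bar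 x_i,\bar\alpha_{q_i})\,\psi_t(\bar y_i,\bar\alpha_{q_j})^*\big].$$ If two families of distinct elements of $K_\otimes$ localized in box $b$ have different numbers of elements $M\ne M'$, then $\langle\bar x_1,\dots,\bar x_M|\rho_b^{\rm cumul}|\bar y_1,\dots,\bar y_{M'}\rangle=0$. -/

import Mathlib

open MeasureTheory
open scoped ENNReal ComplexConjugate Nat

noncomputable section

namespace HardcoreWavelet

/-! ### Momenta, boxes and wavelet labels

The system is `[0, L]`, cut into `n` boxes. Boxes are numbered from `0` here: the element `b` of
`Fin n` is the box number `b + 1`, that is, the interval `(b L / n, (b + 1) L / n)`. -/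

/-- A wavelet label: a box together with the integer `m` of the momentum `2 π n m / L`. The
(lexicographic) linear order is only used to enumerate finite sets of labels. -/
abbrev Wavelet (n : ℕ) : Type := Fin n ×ₗ ℤ

/-- The box index of a wavelet. -/
def Wavelet.box {n : ℕ} (a : Wavelet n) : Fin n := (ofLex a).1

/-- The momentum of a wavelet, an element of `{2 π n m / L : m ∈ ℤ}`. -/
def Wavelet.momentum (L : ℝ) {n : ℕ} (a : Wavelet n) : ℝ :=
  2 * Real.pi * n * (((ofLex a).2 : ℤ) : ℝ) / L

/-- The momenta of the whole ring (even particle number), `2 π (m + 1/2) / L`. -/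
def ringMomentum (L : ℝ) (m : ℤ) : ℝ := 2 * Real.pi * ((m : ℝ) + 1 / 2) / L

/-- The interior of box `b`. -/
def boxSet (L : ℝ) {n : ℕ} (b : Fin n) : Set ℝ :=
  Set.Ioo ((b : ℝ) * L / n) (((b : ℝ) + 1) * L / n)

/-! ### States of `N` bosons -/

/-- Lebesgue measure on `(0, L) ^ N`. -/
abbrev cubeMeasure (L : ℝ) (N : ℕ) : Measure (Fin N → ℝ) :=
  volume.restrict (Set.univ.pi fun _ => Set.Ioo (0 : ℝ) L)

/-- Square integrable wave functions of `N` particles on `(0, L)`. Bosonic states are the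
symmetric ones, see `IsBosonic`. -/
abbrev NSpace (L : ℝ) (N : ℕ) : Type := Lp ℂ 2 (cubeMeasure L N)

/-- The Hilbert sum over all particle numbers. -/
abbrev Fock (L : ℝ) : Type := lp (fun N : ℕ => NSpace L N) 2

/-- Symmetry under permutations of the particles. -/
def IsBosonic {L : ℝ} {N : ℕ} (f : NSpace L N) : Prop :=
  ∀ σ : Equiv.Perm (Fin N), ∀ᵐ x ∂(cubeMeasure L N), f (x ∘ σ) = f x

/-- The normalized symmetric wave function `√(N!) · Sym χ` of the state
`∫ χ(x₁, …, x_N) φ†(x₁) ⋯ φ†(x_N) |0⟩ dx` of a Bose field `φ`. -/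
def bosonize {N : ℕ} (χ : (Fin N → ℝ) → ℂ) (x : Fin N → ℝ) : ℂ :=
  ((Real.sqrt (N ! : ℝ) : ℝ) : ℂ)⁻¹ * ∑ σ : Equiv.Perm (Fin N), χ (x ∘ σ)

/-- The function `χ` of the eigenstate of the hardcore boson Hamiltonian `H₀` with ring momenta
`λ_j = 2 π (k j + 1/2) / L`. -/
def eigenChi (L : ℝ) {N : ℕ} (k : Fin N → ℤ) (x : Fin N → ℝ) : ℂ :=
  ((N ! : ℂ) * ((Real.sqrt L : ℝ) : ℂ) ^ N)⁻¹ *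
    (∑ σ : Equiv.Perm (Fin N), ((Equiv.Perm.sign σ : ℤ) : ℂ) *
      Complex.exp (Complex.I * ∑ j, (x j : ℂ) * (ringMomentum L (k (σ j)) : ℂ))) *
    ∏ i, ∏ j, if i < j then ((Real.sign (x i - x j) : ℝ) : ℂ) else 1

/-- The energy `∑ λ_j²`. -/
def energy (L : ℝ) {N : ℕ} (k : Fin N → ℤ) : ℝ := ∑ j, ringMomentum L (k j) ^ 2

open Classical in
/-- The function `χ` of the wavelet state with labels `a₁, …, a_N`: the product over the boxes of
the eigenfunctions of the boxes. The permutations that preserve the box labels are the elements of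
`∏_b 𝔖_{N_b}`. -/
def waveletChi (L : ℝ) {n N : ℕ} (a : Fin N → Wavelet n) (x : Fin N → ℝ) : ℂ :=
  ((Real.sqrt ((n : ℝ) / L) : ℝ) : ℂ) ^ N *
    (∏ b : Fin n, ((Finset.univ.filter fun j => (a j).box = b).card ! : ℂ))⁻¹ *
    (∑ σ ∈ Finset.univ.filter
        (fun σ : Equiv.Perm (Fin N) => ∀ j, (a (σ j)).box = (a j).box),
      ((Equiv.Perm.sign σ : ℤ) : ℂ) *
        Complex.exp (Complex.I * ∑ j, (x j : ℂ) * ((a (σ j)).momentum L : ℂ))) *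
    (∏ i, ∏ j, if i < j ∧ (a i).box = (a j).box
      then ((Real.sign (x i - x j) : ℝ) : ℂ) else 1) *
    ∏ j, (boxSet L (a j).box).indicator (fun _ => (1 : ℂ)) (x j)

theorem measurable_sign_sub {N : ℕ} (i j : Fin N) :
    Measurable fun x : Fin N → ℝ => ((Real.sign (x i - x j) : ℝ) : ℂ) := by
  have h : Measurable Real.sign := by
    unfold Real.sign
    refine Measurable.ite measurableSet_Iio measurable_const ?_
    exact Measurable.ite measurableSet_Ioi measurable_const measurable_const
  exact Complex.measurable_ofReal.comp
    (h.comp ((measurable_pi_apply i).sub (measurable_pi_apply j)))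

theorem norm_sign_le (r : ℝ) : ‖((Real.sign r : ℝ) : ℂ)‖ ≤ 1 := by
  rcases Real.sign_apply_eq r with h | h | h <;> simp [h]

theorem norm_phase_le {N : ℕ} (σ : Equiv.Perm (Fin N)) (x p : Fin N → ℝ) :
    ‖((Equiv.Perm.sign σ : ℤ) : ℂ) *
      Complex.exp (Complex.I * ∑ j, (x j : ℂ) * (p j : ℂ))‖ ≤ 1 := by
  have h : (Complex.I * ∑ j, (x j : ℂ) * (p j : ℂ))
      = ((∑ j, x j * p j : ℝ) : ℂ) * Complex.I := by
    push_cast; ring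
  rw [norm_mul, h, Complex.norm_exp_ofReal_mul_I, mul_one]
  rcases Int.units_eq_one_or (Equiv.Perm.sign σ) with h | h <;> simp [h]

theorem memLp_bosonize (L : ℝ) {N : ℕ} {χ : (Fin N → ℝ) → ℂ} (hm : Measurable χ)
    (C : ℝ) (hC : ∀ x, ‖χ x‖ ≤ C) : MemLp (bosonize χ) 2 (cubeMeasure L N) := by
  have : IsFiniteMeasure (cubeMeasure L N) := by
    refine ⟨?_⟩
    rw [Measure.restrict_apply_univ, volume_pi_pi]
    exact ENNReal.prod_lt_top fun _ _ => by simp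
  refine MemLp.of_bound (C := ‖((Real.sqrt (N ! : ℝ) : ℝ) : ℂ)⁻¹‖ *
    ∑ _σ : Equiv.Perm (Fin N), C) ?_ (Filter.Eventually.of_forall fun x => ?_)
  · refine Measurable.aestronglyMeasurable (measurable_const.mul ?_)
    refine Finset.measurable_sum _ fun σ _ => hm.comp ?_
    exact measurable_pi_lambda _ fun j => measurable_pi_apply _
  · unfold bosonize
    rw [norm_mul]
    gcongr
    exact (norm_sum_le _ _).trans (Finset.sum_le_sum fun σ _ => hC _)

theorem memLp_eigen (L : ℝ) {N : ℕ} (k : Fin N → ℤ) :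
    MemLp (bosonize (eigenChi L k)) 2 (cubeMeasure L N) := by
  refine memLp_bosonize L ?_ (‖((N ! : ℂ) * ((Real.sqrt L : ℝ) : ℂ) ^ N)⁻¹‖ *
    (∑ _σ : Equiv.Perm (Fin N), (1 : ℝ)) * 1) fun x => ?_
  · unfold eigenChi
    refine (measurable_const.mul (Finset.measurable_sum _ fun σ _ => ?_)).mul
      (Finset.measurable_prod _ fun i _ => Finset.measurable_prod _ fun j _ => ?_)
    · fun_prop
    · split_ifs
      · exact measurable_sign_sub i j
      · exact measurable_const
  · unfold eigenChi
    rw [norm_mul, norm_mul]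
    gcongr
    · exact (norm_sum_le _ _).trans (Finset.sum_le_sum fun σ _ => norm_phase_le σ x _)
    · rw [norm_prod]
      refine Finset.prod_le_one (fun _ _ => norm_nonneg _) fun i _ => ?_
      rw [norm_prod]
      refine Finset.prod_le_one (fun _ _ => norm_nonneg _) fun j _ => ?_
      split_ifs
      · exact norm_sign_le _
      · simp

open Classical in
theorem memLp_wavelet (L : ℝ) {n N : ℕ} (a : Fin N → Wavelet n) :
    MemLp (bosonize (waveletChi L a)) 2 (cubeMeasure L N) := by
  refine memLp_bosonize L ?_ (‖((Real.sqrt ((n : ℝ) / L) : ℝ) : ℂ) ^ N‖ *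
    ‖(∏ b : Fin n, ((Finset.univ.filter fun j => (a j).box = b).card ! : ℂ))⁻¹‖ *
    (∑ _σ ∈ Finset.univ.filter
        (fun σ : Equiv.Perm (Fin N) => ∀ j, (a (σ j)).box = (a j).box), (1 : ℝ)) * 1 * 1)
      fun x => ?_
  · unfold waveletChi
    refine ((measurable_const.mul (Finset.measurable_sum _ fun σ _ => ?_)).mul
      (Finset.measurable_prod _ fun i _ => Finset.measurable_prod _ fun j _ => ?_)).mul
      (Finset.measurable_prod _ fun j _ => ?_)
    · fun_prop
    · split_ifs
      · exact measurable_sign_sub i j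
      · exact measurable_const
    · exact (measurable_const.indicator measurableSet_Ioo).comp (measurable_pi_apply j)
  · unfold waveletChi
    rw [norm_mul, norm_mul, norm_mul, norm_mul]
    gcongr
    · exact (norm_sum_le _ _).trans (Finset.sum_le_sum fun σ _ => norm_phase_le σ x _)
    · rw [norm_prod]
      refine Finset.prod_le_one (fun _ _ => norm_nonneg _) fun i _ => ?_
      rw [norm_prod]
      refine Finset.prod_le_one (fun _ _ => norm_nonneg _) fun j _ => ?_
      split_ifs
      · exact norm_sign_le _
      · simp
    · rw [norm_prod]
      refine Finset.prod_le_one (fun _ _ => norm_nonneg _) fun j _ => ?_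
      by_cases h : x j ∈ boxSet L (a j).box <;> simp [h]

/-- The eigenstate `|λ⟩` of `H₀`. -/
def eigenState (L : ℝ) {N : ℕ} (k : Fin N → ℤ) : NSpace L N := (memLp_eigen L k).toLp _

/-- The wavelet state `|a⟩`. It is antisymmetric in the labels of each box. -/
def waveletState (L : ℝ) {n N : ℕ} (a : Fin N → Wavelet n) : NSpace L N :=
  (memLp_wavelet L a).toLp _

/-- The wavelet state as a vector of the sum over all particle numbers. -/
def ket (L : ℝ) {n N : ℕ} (a : Fin N → Wavelet n) : Fock L := lp.single 2 N (waveletState L a)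

/-! ### Time evolution -/

open Classical in
/-- The potential `V = ∑_b v_b ∫_{box b} φ†(x) φ(x) dx` at time `s`, as a multiplication operator:
`∑_j v_{box of x_j}(s)`. -/
def potential (L : ℝ) {n N : ℕ} (v : Fin n → ℝ → ℝ) (s : ℝ) (x : Fin N → ℝ) : ℝ :=
  ∑ j, ∑ b : Fin n, if x j ∈ boxSet L b then v b s else 0

/-- The matrix element `⟨λ|V(s)|f⟩`. -/
def potentialElement (L : ℝ) {n N : ℕ} (v : Fin n → ℝ → ℝ) (s : ℝ) (k : Fin N → ℤ)
    (f : NSpace L N) : ℂ :=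
  ∫ x, conj (bosonize (eigenChi L k) x) * (potential L v s x : ℂ) * f x ∂(cubeMeasure L N)

/-- `Ψ(t) = U(t)|α⟩` with `U(t) = 𝒯 exp(-i ∫₀ᵗ (H₀ + V(s)) ds)`. The operator `H₀` is diagonal in
the basis `|λ⟩`, with eigenvalues `E(λ)`, and `|α⟩` is in general not in its domain; so, as usual,
the evolution `i ∂ₜΨ = (H₀ + V(t))Ψ` is understood through Duhamel's formula
`Ψ(t) = e^{-itH₀}Ψ(0) - i ∫₀ᵗ e^{-i(t-s)H₀} V(s)Ψ(s) ds`, written in the basis `|λ⟩`. -/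
structure IsEvolution (L : ℝ) {n N : ℕ} (v : Fin n → ℝ → ℝ) (α : Fin N → Wavelet n)
    (Ψ : ℝ → NSpace L N) : Prop where
  continuous : Continuous Ψ
  bosonic : ∀ t, IsBosonic (Ψ t)
  initial : Ψ 0 = waveletState L α
  integrable : ∀ k : Fin N → ℤ, StrictMono k → ∀ t : ℝ,
    IntervalIntegrable (fun s => potentialElement L v s k (Ψ s)) volume 0 t
  duhamel : ∀ k : Fin N → ℤ, StrictMono k → ∀ t : ℝ,
    inner ℂ (eigenState L k) (Ψ t) =
      Complex.exp (-Complex.I * t * energy L k) * inner ℂ (eigenState L k) (Ψ 0) -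
      Complex.I * ∫ s in (0 : ℝ)..t,
        Complex.exp (-Complex.I * (t - s) * energy L k) * potentialElement L v s k (Ψ s)

/-! ### The function `ψ_t` -/

/-- `φ(λ, a) = (i √n / L) (1 - e^{iLλ/n}) / (λ - a) e^{-iL b(a) λ/n}`, where `b(a)` is numbered
from `1`. -/
def overlap (L : ℝ) {n : ℕ} (lam : ℝ) (a : Wavelet n) : ℂ :=
  Complex.I * ((Real.sqrt n : ℝ) : ℂ) / (L : ℂ) *
    ((1 - Complex.exp (Complex.I * L * lam / n)) / ((lam : ℂ) - (a.momentum L : ℂ))) *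
    Complex.exp (-Complex.I * L * (((a.box : ℕ) : ℂ) + 1) / n * lam)

/-- `G_t(a, c) = ∑_λ φ(λ, a)^* φ(λ, c) e^{-itλ²}`. -/
def green (L : ℝ) {n : ℕ} (t : ℝ) (a c : Wavelet n) : ℂ :=
  ∑' m : ℤ, conj (overlap L (ringMomentum L m) a) * overlap L (ringMomentum L m) c *
    Complex.exp (-Complex.I * t * (ringMomentum L m : ℂ) ^ 2)

/-- `U_t(a, c) = ∑_γ G_{-t}(a, γ) v_{b(γ)}(t) G_t(γ, c)`. -/
def interaction (L : ℝ) {n : ℕ} (v : Fin n → ℝ → ℝ) (t : ℝ) (a c : Wavelet n) : ℂ :=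
  ∑' g : Wavelet n, green L (-t) a g * (v g.box t : ℂ) * green L t g c

/-- `ψ̃` solves `∂ₜψ̃_t(a, c) = -i ∑_ν U_t(a, ν) ψ̃_t(ν, c)`, `ψ̃_0(a, c) = δ_{a,c}`. As the
potentials are only locally integrable in time, the equation is written in integrated form. For
fixed `c`, the column `ψ̃_t(·, c)` is a continuous function of `t` with values in `ℓ²`. -/
structure IsPsiTilde (L : ℝ) {n : ℕ} (v : Fin n → ℝ → ℝ)
    (ψt : ℝ → Wavelet n → Wavelet n → ℂ) : Prop where
  column : ∀ c : Wavelet n, ∃ u : ℝ → lp (fun _ : Wavelet n => ℂ) 2,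
    Continuous u ∧ ∀ t a, u t a = ψt t a c
  integrable : ∀ (a c : Wavelet n) (t : ℝ),
    IntervalIntegrable (fun s => ∑' g : Wavelet n, interaction L v s a g * ψt s g c) volume 0 t
  equation : ∀ (a c : Wavelet n) (t : ℝ),
    ψt t a c = (if a = c then 1 else 0) -
      Complex.I * ∫ s in (0 : ℝ)..t, ∑' g : Wavelet n, interaction L v s a g * ψt s g c

/-- `ψ_t(a, c) = ∑_γ G_t(a, γ) ψ̃_t(γ, c)`. -/
def psi (L : ℝ) {n : ℕ} (ψt : ℝ → Wavelet n → Wavelet n → ℂ) (t : ℝ) (a c : Wavelet n) : ℂ :=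
  ∑' g : Wavelet n, green L t a g * ψt t g c

/-! ### The cumulative reduced density matrix -/

/-- The increasing enumeration of a finite set of wavelets. -/
def enum {n : ℕ} (X : Finset (Wavelet n)) : Fin X.card → Wavelet n := X.orderEmbOfFin rfl

/-- The wavelet state with label set `X ∪ R` (for disjoint `X`, `R`), in which the labels of `X`
are listed first. -/
def ketFirst (L : ℝ) {n : ℕ} (X R : Finset (Wavelet n)) : Fock L :=
  ket L (Fin.append (enum X) (enum R))

/-- The pairs `(β, γ)` of finite sets with `X ⊆ β`, `Y ⊆ γ`, `β \ X = γ \ Y`. -/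
def Completion {n : ℕ} (X Y : Finset (Wavelet n)) : Type :=
  {p : Finset (Wavelet n) × Finset (Wavelet n) //
    X ⊆ p.1 ∧ Y ⊆ p.2 ∧ p.1 \ X = p.2 \ Y}

/-- `⟨β|Ψ⟩⟨Ψ|γ⟩`. The sign of a wavelet state depends on the order of its labels: in `|β⟩` those of
`X` come first, in `|γ⟩` those of `Y`, followed by the common rest in the same order. -/
def cumulTerm {L : ℝ} {n : ℕ} (Ψ : Fock L) (X Y : Finset (Wavelet n)) (p : Completion X Y) : ℂ :=
  inner ℂ (ketFirst L X (p.1.1 \ X)) Ψ * inner ℂ Ψ (ketFirst L Y (p.1.2 \ Y))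

/-- The finite sets of wavelets that are localized in box `b`. -/
def InBox {n : ℕ} (b : Fin n) : Type := {X : Finset (Wavelet n) // ∀ a ∈ X, a.box = b}

/-- The matrix element `⟨f|ρ_b^cumul|g⟩`, where
`ρ_b^cumul = ∑_{X, Y in box b} |X⟩⟨Y| ∑_{β, γ} ⟨β|Ψ⟩⟨Ψ|γ⟩`. -/
def rhoCumul {L : ℝ} {n : ℕ} (Ψ : Fock L) (b : Fin n) (f g : Fock L) : ℂ :=
  ∑' P : InBox b × InBox b,
    inner ℂ f (ket L (enum P.1.1)) * inner ℂ (ket L (enum P.2.1)) g *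
      ∑' p : Completion P.1.1 P.2.1, cumulTerm Ψ P.1.1 P.2.1 p

end HardcoreWavelet

end

noncomputable section

/-!
The hardcore eigenstates and the wavelet states are both Slater determinants up to a sign: the
eigenstate is a Slater determinant of plane waves times `∏_{i<j} sgn(x_i - x_j)`. On the support of
a wavelet state, the factors of this product that belong to points in different boxes are
determined by the boxes, so the wavelet state is, up to a global sign, the same product times a
Slater determinant of one-particle wavelets. The potential is a sum of one-particle operators and
commutes with multiplication by the sign. A Slater determinant of one-particle solutions therefore
solves the Duhamel equation of the hardcore gas, and Gronwall's inequality shows that it is the only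
solution. The wavelet coefficients of the one-particle solutions are `ψ̃_t` in the interaction
picture and `ψ_t` in the Schrödinger picture.

Consequently `⟨β|Ψ(t)⟩` is a determinant with entries `ψ_t(a, α_q)`. The vectors `ψ_t(·, α_q)` are
orthonormal, so, by Laplace expansion, the sum of `⟨X ∪ R|Ψ⟩⟨Ψ|Y ∪ R⟩` over the common rest `R` is
the determinant of the matrix `∑_q ψ_t(x_i, α_q) ψ_t(y_j, α_q)^*`. It is multilinear in the rows of
this matrix, which gives the sum over `q_1, …, q_M`.
-/

namespace HardcoreWavelet

/-! ### Primitives of locally integrable functions -/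

section Primitive

variable {E F : Type*} [NormedAddCommGroup E] [NormedSpace ℝ E]
  [NormedAddCommGroup F] [NormedSpace ℝ F]

theorem intervalIntegrable_of_locallyIntegrable {E : Type*} [NormedAddCommGroup E] {f : ℝ → E}
    (hf : LocallyIntegrable f) (a b : ℝ) : IntervalIntegrable f volume a b :=
  intervalIntegrable_iff.2
    ((hf.integrableOn_isCompact isCompact_uIcc).mono_set Set.uIoc_subset_uIcc)

theorem locallyIntegrable_clm_apply {A : ℝ → E →L[ℝ] F} {f : ℝ → E} (hA : Continuous A)
    (hf : LocallyIntegrable f) : LocallyIntegrable fun t => A t (f t) := by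
  rw [locallyIntegrable_iff] at hf ⊢
  intro k hk
  obtain ⟨C, hC⟩ := hk.exists_bound_of_continuousOn hA.continuousOn
  refine Integrable.mono' ((hf k hk).norm.const_mul C)
    (ContinuousLinearMap.aestronglyMeasurable_comp₂ (.id ℝ _)
      hA.aestronglyMeasurable.restrict (hf k hk).1) ?_
  filter_upwards [ae_restrict_mem hk.measurableSet] with t ht
  exact (A t).le_of_opNorm_le (hC t ht) (f t)

/-- `u` is a primitive of the locally integrable function `f`, so `u' = f` almost everywhere and
the fundamental theorem of calculus holds. -/
structure IsPrimitive (u f : ℝ → E) : Prop where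
  locallyIntegrable : LocallyIntegrable f
  eq_add_integral : ∀ t, u t = u 0 + ∫ s in (0 : ℝ)..t, f s

theorem isPrimitive_integral {f : ℝ → E} (hf : LocallyIntegrable f) (c : E) :
    IsPrimitive (fun t => c + ∫ s in (0 : ℝ)..t, f s) f :=
  ⟨hf, fun t => by simp⟩

namespace IsPrimitive

variable {u f : ℝ → E}

theorem intervalIntegrable (h : IsPrimitive u f) (a b : ℝ) : IntervalIntegrable f volume a b :=
  intervalIntegrable_of_locallyIntegrable h.locallyIntegrable a b

theorem sub_eq (h : IsPrimitive u f) (s t : ℝ) : u t - u s = ∫ r in s..t, f r := by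
  rw [h.eq_add_integral t, h.eq_add_integral s, add_sub_add_left_eq_sub,
    intervalIntegral.integral_interval_sub_left (h.intervalIntegrable 0 t)
      (h.intervalIntegrable 0 s)]

theorem continuous (h : IsPrimitive u f) : Continuous u := by
  rw [funext h.eq_add_integral]
  exact continuous_const.add (intervalIntegral.continuous_primitive h.intervalIntegrable 0)

theorem ae_hasDerivAt [CompleteSpace E] (h : IsPrimitive u f) : ∀ᵐ t, HasDerivAt u (f t) t := by
  filter_upwards [LocallyIntegrable.ae_hasDerivAt_integral h.locallyIntegrable] with t ht
  rw [funext h.eq_add_integral]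
  exact (ht 0).const_add _

theorem dist_le (h : IsPrimitive u f) (s t : ℝ) :
    dist (u s) (u t) ≤ dist (∫ r in (0 : ℝ)..s, ‖f r‖) (∫ r in (0 : ℝ)..t, ‖f r‖) := by
  rw [dist_comm, dist_eq_norm, h.sub_eq, dist_comm, Real.dist_eq,
    intervalIntegral.integral_interval_sub_left (h.intervalIntegrable 0 t).norm
      (h.intervalIntegrable 0 s).norm]
  exact intervalIntegral.norm_integral_le_abs_integral_norm

end IsPrimitive

theorem absolutelyContinuousOnInterval_of_dist_le {X Y : Type*} [PseudoMetricSpace X]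
    [PseudoMetricSpace Y] {u : ℝ → X} {w : ℝ → Y} {a b K : ℝ}
    (hw : AbsolutelyContinuousOnInterval w a b)
    (h : ∀ x ∈ Set.uIcc a b, ∀ y ∈ Set.uIcc a b, dist (u x) (u y) ≤ K * dist (w x) (w y)) :
    AbsolutelyContinuousOnInterval u a b := by
  refine squeeze_zero' (.of_forall fun _ => Finset.sum_nonneg fun _ _ => dist_nonneg) ?_
    (by simpa using Filter.Tendsto.const_mul K hw)
  rw [Filter.eventually_inf_principal]
  filter_upwards with ⟨m, I⟩ hI
  rw [Finset.mul_sum]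
  exact Finset.sum_le_sum fun i hi => h _ (hI.1 i hi).1 _ (hI.1 i hi).2

namespace IsPrimitive

variable {u f : ℝ → E}

theorem absolutelyContinuousOnInterval (h : IsPrimitive u f) (a b : ℝ) :
    AbsolutelyContinuousOnInterval u a b := by
  have hW : AbsolutelyContinuousOnInterval (fun t => ∫ s in a..t, ‖f s‖) a b :=
    (h.intervalIntegrable a b).norm.absolutelyContinuousOnInterval_intervalIntegral
      Set.left_mem_uIcc
  refine absolutelyContinuousOnInterval_of_dist_le (K := 1) hW fun x _ y _ => ?_
  have hint := fun s t => (h.intervalIntegrable s t).norm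
  rw [one_mul, Real.dist_eq, intervalIntegral.integral_interval_sub_left (hint _ _) (hint _ _)]
  refine (h.dist_le x y).trans_eq ?_
  rw [Real.dist_eq, intervalIntegral.integral_interval_sub_left (hint _ _) (hint _ _)]

theorem comp [CompleteSpace E] [CompleteSpace F] {Φ : E → F} (hu : IsPrimitive u f)
    (hΦ : ContDiff ℝ 1 Φ) : IsPrimitive (fun t => Φ (u t)) fun t => fderiv ℝ Φ (u t) (f t) := by
  have hint := locallyIntegrable_clm_apply ((hΦ.continuous_fderiv one_ne_zero).comp hu.continuous)
    hu.locallyIntegrable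
  have hprim := isPrimitive_integral hint (Φ (u 0))
  refine ⟨hint, fun t => ?_⟩
  have hac : AbsolutelyContinuousOnInterval (fun s => Φ (u s)) 0 t := by
    obtain ⟨K, hK⟩ := hΦ.locallyLipschitz.locallyLipschitzOn.exists_lipschitzOnWith_of_compact
      (isCompact_uIcc.image hu.continuous)
    exact absolutelyContinuousOnInterval_of_dist_le (hu.absolutelyContinuousOnInterval 0 t)
      fun x hx y hy => hK.dist_le_mul _ (Set.mem_image_of_mem u hx) _ (Set.mem_image_of_mem u hy)
  obtain ⟨C, hC⟩ :=
    (hac.sub (hprim.absolutelyContinuousOnInterval 0 t)).const_of_ae_hasDerivAt_zero (by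
      filter_upwards [hu.ae_hasDerivAt, hprim.ae_hasDerivAt] with s hus hps _
      have hΦs := (hΦ.differentiable one_ne_zero (u s)).hasFDerivAt.comp_hasDerivAt s hus
      exact (hΦs.sub hps).congr_deriv (sub_self _))
  have h0 := hC 0 Set.left_mem_uIcc
  have ht := hC t Set.right_mem_uIcc
  simp only [Pi.sub_apply, intervalIntegral.integral_same, add_zero, sub_self] at h0 ht
  exact sub_eq_zero.1 (ht.trans h0.symm)

theorem clm [CompleteSpace E] [CompleteSpace F] (hu : IsPrimitive u f) (A : E →L[ℝ] F) :
    IsPrimitive (fun t => A (u t)) fun t => A (f t) := by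
  simpa only [A.fderiv] using hu.comp A.contDiff

theorem pow {u f : ℝ → ℝ} (hu : IsPrimitive u f) (k : ℕ) :
    IsPrimitive (fun t => u t ^ k) fun t => k * u t ^ (k - 1) * f t := by
  simpa [fderiv_pow_ring, mul_assoc] using hu.comp (Φ := fun x : ℝ => x ^ k) (by fun_prop)

theorem prodMk [CompleteSpace E] [CompleteSpace F] (hu : IsPrimitive u f) {w g : ℝ → F}
    (hw : IsPrimitive w g) :
    IsPrimitive (fun t => (u t, w t)) fun t => (f t, g t) := by
  have hfg : LocallyIntegrable fun t => (f t, g t) := locallyIntegrable_iff.2 fun k hk =>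
    (locallyIntegrable_iff.1 hu.locallyIntegrable k hk).prodMk
      (locallyIntegrable_iff.1 hw.locallyIntegrable k hk)
  have hint := intervalIntegrable_of_locallyIntegrable hfg 0
  refine ⟨hfg, fun t => Prod.ext ?_ ?_⟩
  · rw [hu.eq_add_integral t, Prod.fst_add]
    exact congrArg _ ((ContinuousLinearMap.fst ℝ E F).intervalIntegral_comp_comm (hint t))
  · rw [hw.eq_add_integral t, Prod.snd_add]
    exact congrArg _ ((ContinuousLinearMap.snd ℝ E F).intervalIntegral_comp_comm (hint t))

theorem pi {ι : Type*} [Fintype ι] {E : ι → Type*} [∀ i, NormedAddCommGroup (E i)]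
    [∀ i, NormedSpace ℝ (E i)] [∀ i, CompleteSpace (E i)] {u f : ∀ i, ℝ → E i}
    (hu : ∀ i, IsPrimitive (u i) (f i)) :
    IsPrimitive (fun t i => u i t) fun t i => f i t := by
  have hf : LocallyIntegrable fun t i => f i t := locallyIntegrable_iff.2 fun k hk =>
    Integrable.of_eval fun i => locallyIntegrable_iff.1 (hu i).locallyIntegrable k hk
  refine ⟨hf, fun t => funext fun i => ?_⟩
  rw [(hu i).eq_add_integral t, Pi.add_apply]
  congr 1
  exact (ContinuousLinearMap.proj (R := ℝ) i).intervalIntegral_comp_comm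
    (intervalIntegrable_of_locallyIntegrable hf 0 t)

theorem multilinear {ι : Type*} [Fintype ι] [DecidableEq ι] [CompleteSpace E] [CompleteSpace F]
    (Φ : ContinuousMultilinearMap ℝ (fun _ : ι => E) F) {u f : ι → ℝ → E}
    (hu : ∀ i, IsPrimitive (u i) (f i)) :
    IsPrimitive (fun t => Φ fun i => u i t)
      fun t => ∑ i, Φ (Function.update (fun j => u j t) i (f i t)) := by
  simpa only [(Φ.hasFDerivAt _).fderiv, ContinuousMultilinearMap.linearDeriv_apply] using
    (pi hu).comp Φ.contDiff

theorem inner {H : Type*} [NormedAddCommGroup H] [InnerProductSpace ℂ H] [CompleteSpace H]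
    {u f w g : ℝ → H} (hu : IsPrimitive u f) (hw : IsPrimitive w g) :
    IsPrimitive (fun t => inner ℂ (u t) (w t))
      fun t => inner ℂ (u t) (g t) + inner ℂ (f t) (w t) := by
  have hderiv : ∀ t, fderiv ℝ (fun p : H × H => Inner.inner ℂ p.1 p.2) (u t, w t) (f t, g t) =
      Inner.inner ℂ (u t) (g t) + Inner.inner ℂ (f t) (w t) := fun t => by
    rw [fderiv_inner_apply ℂ differentiable_fst.differentiableAt
      differentiable_snd.differentiableAt, fderiv_fst, fderiv_snd]
    rfl
  have h : IsPrimitive (fun t => Inner.inner ℂ (u t) (w t)) _ :=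
    (hu.prodMk hw).comp (contDiff_inner (𝕜 := ℂ) (E := H))
  rwa [funext hderiv] at h

end IsPrimitive

end Primitive

/-! ### Volterra equations with locally integrable coefficients -/

section Volterra

variable {w : ℝ → ℝ}

theorem continuous_integral_of_locallyIntegrable (hw : LocallyIntegrable w) :
    Continuous fun t => ∫ s in (0 : ℝ)..t, w s :=
  intervalIntegral.continuous_primitive (intervalIntegrable_of_locallyIntegrable hw) 0

theorem integral_mul_integral_pow (hw : LocallyIntegrable w) (k : ℕ) (t : ℝ) :
    ∫ s in (0 : ℝ)..t, w s * (∫ r in (0 : ℝ)..s, w r) ^ k =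
      (∫ s in (0 : ℝ)..t, w s) ^ (k + 1) / (k + 1) := by
  have h0 : IsPrimitive (fun t => ∫ s in (0 : ℝ)..t, w s) w := by
    simpa only [zero_add] using isPrimitive_integral hw 0
  have h := (h0.pow (k + 1)).eq_add_integral t
  rw [intervalIntegral.integral_same, zero_pow k.succ_ne_zero, zero_add] at h
  rw [h, eq_div_iff (by positivity), ← intervalIntegral.integral_mul_const]
  congr 1 with s
  rw [Nat.add_sub_cancel]
  push_cast
  ring

theorem exists_abs_integral_eq (hw0 : ∀ s, 0 ≤ w s) (t : ℝ) :
    ∃ ε : ℝ, |ε| = 1 ∧ ∀ s ∈ Set.uIcc 0 t,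
      |∫ r in (0 : ℝ)..s, w r| = ε * ∫ r in (0 : ℝ)..s, w r := by
  rcases le_total 0 t with ht | ht
  · refine ⟨1, abs_one, fun s hs => ?_⟩
    rw [Set.uIcc_of_le ht] at hs
    rw [one_mul, abs_of_nonneg (intervalIntegral.integral_nonneg hs.1 fun r _ => hw0 r)]
  · refine ⟨-1, by simp, fun s hs => ?_⟩
    rw [Set.uIcc_of_ge ht] at hs
    rw [intervalIntegral.integral_symm, abs_neg,
      abs_of_nonneg (intervalIntegral.integral_nonneg hs.2 fun r _ => hw0 r), neg_one_mul, neg_neg]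

theorem abs_integral_mul_abs_integral_pow (hw : LocallyIntegrable w) (hw0 : ∀ s, 0 ≤ w s) (k : ℕ)
    (t : ℝ) :
    |∫ s in (0 : ℝ)..t, w s * |∫ r in (0 : ℝ)..s, w r| ^ k| =
      |∫ s in (0 : ℝ)..t, w s| ^ (k + 1) / (k + 1) := by
  obtain ⟨ε, hε, hW⟩ := exists_abs_integral_eq hw0 t
  have h : ∫ s in (0 : ℝ)..t, w s * |∫ r in (0 : ℝ)..s, w r| ^ k =
      ε ^ k * ∫ s in (0 : ℝ)..t, w s * (∫ r in (0 : ℝ)..s, w r) ^ k := by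
    rw [← intervalIntegral.integral_const_mul]
    exact intervalIntegral.integral_congr fun s hs => by simp only [hW s hs]; ring
  rw [h, integral_mul_integral_pow hw, abs_mul, abs_pow, hε, one_pow, one_mul, abs_div, abs_pow,
    abs_of_nonneg (by positivity : (0 : ℝ) ≤ k + 1)]

theorem norm_integral_le_pow {E : Type*} [NormedAddCommGroup E] [NormedSpace ℝ E]
    (hw : LocallyIntegrable w) (hw0 : ∀ s, 0 ≤ w s) {f : ℝ → E} {C t : ℝ} {k : ℕ} (hC : 0 ≤ C)
    (hf : ∀ s ∈ Set.uIoc 0 t, ‖f s‖ ≤ w s * (C * (|∫ r in (0 : ℝ)..s, w r| ^ k / k !))) :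
    ‖∫ s in (0 : ℝ)..t, f s‖ ≤ C * (|∫ s in (0 : ℝ)..t, w s| ^ (k + 1) / (k + 1)!) := by
  have hint : LocallyIntegrable fun s => w s * (C * (|∫ r in (0 : ℝ)..s, w r| ^ k / k !)) :=
    LocallyIntegrable.mul_continuous (continuous_const.mul <|
      ((continuous_integral_of_locallyIntegrable hw).abs.pow k).div_const _) hw
  calc ‖∫ s in (0 : ℝ)..t, f s‖
      ≤ |∫ s in (0 : ℝ)..t, w s * (C * (|∫ r in (0 : ℝ)..s, w r| ^ k / k !))| :=
        intervalIntegral.norm_integral_le_abs_of_norm_le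
          ((ae_restrict_mem measurableSet_uIoc).mono hf)
          (intervalIntegrable_of_locallyIntegrable hint 0 t)
    _ = C / k ! * |∫ s in (0 : ℝ)..t, w s * |∫ r in (0 : ℝ)..s, w r| ^ k| := by
        rw [← abs_of_nonneg (by positivity : (0 : ℝ) ≤ C / (k ! : ℝ)), ← abs_mul,
          ← intervalIntegral.integral_const_mul]
        congr 2 with s
        ring
    _ = C * (|∫ s in (0 : ℝ)..t, w s| ^ (k + 1) / (k + 1)!) := by
        rw [abs_integral_mul_abs_integral_pow hw hw0, Nat.factorial_succ]
        push_cast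
        field_simp

theorem eq_zero_of_le_integral (hw : LocallyIntegrable w) (hw0 : ∀ s, 0 ≤ w s)
    {D : ℝ → ℝ} (hD : Continuous D) (hD0 : ∀ t, 0 ≤ D t)
    (h : ∀ t, D t ≤ |∫ s in (0 : ℝ)..t, w s * D s|) (t : ℝ) : D t = 0 := by
  obtain ⟨C, hC⟩ := (isCompact_uIcc (a := (0 : ℝ)) (b := t)).exists_bound_of_continuousOn
    hD.continuousOn
  have hC0 : 0 ≤ C := (norm_nonneg _).trans (hC t Set.right_mem_uIcc)
  have hbound : ∀ k : ℕ, ∀ s ∈ Set.uIcc 0 t, D s ≤ C * (|∫ r in (0 : ℝ)..s, w r| ^ k / k !) := by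
    intro k
    induction k with
    | zero => intro s hs; simpa using (le_abs_self _).trans (hC s hs)
    | succ k ih =>
      intro s hs
      refine (h s).trans ?_
      rw [← Real.norm_eq_abs]
      refine norm_integral_le_pow hw hw0 hC0 fun r hr => ?_
      rw [Real.norm_eq_abs, abs_of_nonneg (mul_nonneg (hw0 r) (hD0 r))]
      exact mul_le_mul_of_nonneg_left
        (ih r (Set.uIcc_subset_uIcc Set.left_mem_uIcc hs (Set.uIoc_subset_uIcc hr))) (hw0 r)
  have hlim : Filter.Tendsto (fun k : ℕ => C * (|∫ r in (0 : ℝ)..t, w r| ^ k / k !))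
      Filter.atTop (nhds 0) := by
    simpa only [mul_zero] using (FloorSemiring.tendsto_pow_div_factorial_atTop
      |∫ r in (0 : ℝ)..t, w r|).const_mul C
  exact le_antisymm (ge_of_tendsto' hlim fun k => hbound k t Set.right_mem_uIcc) (hD0 t)

variable {E : Type*} [NormedAddCommGroup E] [NormedSpace ℝ E] {B : ℝ → E →L[ℝ] E}

theorem volterra_unique (hw : LocallyIntegrable w) (hw0 : ∀ s, 0 ≤ w s)
    (hB : ∀ s x, ‖B s x‖ ≤ w s * ‖x‖) {u u' : ℝ → E}
    (hu : IsPrimitive u fun s => B s (u s)) (hu' : IsPrimitive u' fun s => B s (u' s))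
    (h0 : u 0 = u' 0) : u = u' := by
  have hcont : Continuous fun t => ‖u t - u' t‖ := (hu.continuous.sub hu'.continuous).norm
  refine funext fun t => sub_eq_zero.1 <| norm_eq_zero.1 <|
    eq_zero_of_le_integral hw hw0 hcont (fun _ => norm_nonneg _) (fun t => ?_) t
  rw [hu.eq_add_integral t, hu'.eq_add_integral t, h0, add_sub_add_left_eq_sub,
    ← intervalIntegral.integral_sub (hu.intervalIntegrable _ _) (hu'.intervalIntegrable _ _)]
  refine intervalIntegral.norm_integral_le_abs_of_norm_le (.of_forall fun s => ?_)
    (intervalIntegrable_of_locallyIntegrable (LocallyIntegrable.mul_continuous hcont hw) _ _)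
  rw [← map_sub]
  exact hB s _

/-- The `k`-th term of the Dyson series, the Picard iteration of `u' = B u`, `u 0 = u₀`. -/
def dysonTerm (B : ℝ → E →L[ℝ] E) (u₀ : E) : ℕ → ℝ → E
  | 0, _ => u₀
  | k + 1, t => ∫ s in (0 : ℝ)..t, B s (dysonTerm B u₀ k s)

theorem continuous_dysonTerm
    (hint : ∀ u : ℝ → E, Continuous u → LocallyIntegrable fun s => B s (u s)) (u₀ : E) (k : ℕ) :
    Continuous (dysonTerm B u₀ k) := by
  induction k with
  | zero => exact continuous_const
  | succ k ih =>
    exact intervalIntegral.continuous_primitive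
      (intervalIntegrable_of_locallyIntegrable (hint _ ih)) 0

theorem norm_dysonTerm_le (hw : LocallyIntegrable w) (hw0 : ∀ s, 0 ≤ w s)
    (hB : ∀ s x, ‖B s x‖ ≤ w s * ‖x‖) (u₀ : E) (k : ℕ) (t : ℝ) :
    ‖dysonTerm B u₀ k t‖ ≤ ‖u₀‖ * (|∫ s in (0 : ℝ)..t, w s| ^ k / k !) := by
  induction k generalizing t with
  | zero => simp [dysonTerm]
  | succ k ih =>
    exact norm_integral_le_pow hw hw0 (norm_nonneg _) fun s _ =>
      (hB s _).trans (mul_le_mul_of_nonneg_left (ih s) (hw0 s))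

theorem dysonTerm_zero_right (B : ℝ → E →L[ℝ] E) (u₀ : E) (k : ℕ) :
    dysonTerm B u₀ k 0 = if k = 0 then u₀ else 0 := by
  cases k <;> simp [dysonTerm]

variable [CompleteSpace E]

theorem summable_mul_pow_div_factorial (c x : ℝ) : Summable fun k : ℕ => c * (x ^ k / k !) :=
  (Real.summable_pow_div_factorial x).mul_left c

theorem summable_dysonTerm (hw : LocallyIntegrable w) (hw0 : ∀ s, 0 ≤ w s)
    (hB : ∀ s x, ‖B s x‖ ≤ w s * ‖x‖) (u₀ : E) (t : ℝ) :
    Summable fun k => dysonTerm B u₀ k t :=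
  .of_norm_bounded (summable_mul_pow_div_factorial _ _) fun k =>
    norm_dysonTerm_le hw hw0 hB u₀ k t

theorem continuous_tsum_dysonTerm (hw : LocallyIntegrable w) (hw0 : ∀ s, 0 ≤ w s)
    (hB : ∀ s x, ‖B s x‖ ≤ w s * ‖x‖)
    (hint : ∀ u : ℝ → E, Continuous u → LocallyIntegrable fun s => B s (u s)) (u₀ : E) :
    Continuous fun t => ∑' k, dysonTerm B u₀ k t := by
  refine continuous_iff_continuousAt.2 fun t => ?_
  obtain ⟨C, hC⟩ := (isCompact_Icc (a := t - 1) (b := t + 1)).exists_bound_of_continuousOn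
    (continuous_integral_of_locallyIntegrable hw).continuousOn
  have hon : ContinuousOn (fun t => ∑' k, dysonTerm B u₀ k t) (Set.Icc (t - 1) (t + 1)) :=
    continuousOn_tsum (fun k => (continuous_dysonTerm hint u₀ k).continuousOn)
      (summable_mul_pow_div_factorial ‖u₀‖ C) fun k s hs =>
        (norm_dysonTerm_le hw hw0 hB u₀ k s).trans <| by
          have := hC s hs
          rw [Real.norm_eq_abs] at this
          gcongr
  exact hon.continuousAt (Icc_mem_nhds (by linarith) (by linarith))

theorem hasSum_integral_dysonTerm (hw : LocallyIntegrable w) (hw0 : ∀ s, 0 ≤ w s)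
    (hB : ∀ s x, ‖B s x‖ ≤ w s * ‖x‖)
    (hint : ∀ u : ℝ → E, Continuous u → LocallyIntegrable fun s => B s (u s)) (u₀ : E) (t : ℝ) :
    HasSum (fun k => dysonTerm B u₀ (k + 1) t)
      (∫ s in (0 : ℝ)..t, B s (∑' k, dysonTerm B u₀ k s)) := by
  obtain ⟨C, hC⟩ := (isCompact_uIcc (a := (0 : ℝ)) (b := t)).exists_bound_of_continuousOn
    (continuous_integral_of_locallyIntegrable hw).continuousOn
  refine intervalIntegral.hasSum_integral_of_dominated_convergence
    (fun k s => w s * (‖u₀‖ * (C ^ k / k !)))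
    (fun k => (hint _ (continuous_dysonTerm hint u₀ k)).aestronglyMeasurable.restrict)
    (fun k => .of_forall fun s hs => ?_)
    (.of_forall fun s _ => (summable_mul_pow_div_factorial _ _).mul_left _) ?_
    (.of_forall fun s _ => (B s).hasSum (summable_dysonTerm hw hw0 hB u₀ s).hasSum)
  · refine (hB s _).trans (mul_le_mul_of_nonneg_left
      ((norm_dysonTerm_le hw hw0 hB u₀ k s).trans ?_) (hw0 s))
    have := hC s (Set.uIoc_subset_uIcc hs)
    rw [Real.norm_eq_abs] at this
    gcongr
  · simp only [tsum_mul_left]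
    exact (intervalIntegrable_of_locallyIntegrable hw _ _).mul_const _

theorem volterra_exists (hw : LocallyIntegrable w) (hw0 : ∀ s, 0 ≤ w s)
    (hB : ∀ s x, ‖B s x‖ ≤ w s * ‖x‖)
    (hint : ∀ u : ℝ → E, Continuous u → LocallyIntegrable fun s => B s (u s)) (u₀ : E) :
    ∃ u : ℝ → E, u 0 = u₀ ∧ IsPrimitive u fun s => B s (u s) := by
  have hzero : ∑' k, dysonTerm B u₀ k 0 = u₀ := by
    simp only [dysonTerm_zero_right, tsum_ite_eq]
  refine ⟨fun t => ∑' k, dysonTerm B u₀ k t, hzero,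
    hint _ (continuous_tsum_dysonTerm hw hw0 hB hint u₀), fun t => ?_⟩
  rw [hzero, (summable_dysonTerm hw hw0 hB u₀ t).tsum_eq_zero_add,
    (hasSum_integral_dysonTerm hw hw0 hB hint u₀ t).tsum_eq]
  rfl

end Volterra

/-! ### Plane waves on an interval -/

section PlaneWave

/-- Lebesgue measure on `(0, L)`. -/
abbrev lineMeasure (L : ℝ) : Measure ℝ := volume.restrict (Set.Ioo (0 : ℝ) L)

/-- The one-particle space `L²(0, L)`. -/
abbrev OneSpace (L : ℝ) : Type := Lp ℂ 2 (lineMeasure L)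

/-- The normalized plane wave `e^{ipx} / √(d - c)` on `(c, d)`, extended by zero. -/
def waveFun (c d p : ℝ) : ℝ → ℂ :=
  (Set.Ioo c d).indicator fun x =>
    ((Real.sqrt (d - c) : ℝ) : ℂ)⁻¹ * Complex.exp (Complex.I * ((x : ℂ) * (p : ℂ)))

theorem norm_exp_I_mul (x p : ℝ) : ‖Complex.exp (Complex.I * ((x : ℂ) * (p : ℂ)))‖ = 1 := by
  rw [← Complex.ofReal_mul, Complex.norm_exp_I_mul_ofReal]

theorem conj_exp_I_mul (x p : ℝ) : conj (Complex.exp (Complex.I * ((x : ℂ) * (p : ℂ)))) =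
    Complex.exp (-(Complex.I * ((x : ℂ) * (p : ℂ)))) := by
  simp [← Complex.exp_conj]

theorem sqrt_mul_sqrt_complex {r : ℝ} (hr : 0 ≤ r) :
    ((Real.sqrt r : ℝ) : ℂ) * ((Real.sqrt r : ℝ) : ℂ) = r := by
  rw [← Complex.ofReal_mul, Real.mul_self_sqrt hr]

theorem measurable_waveFun (c d p : ℝ) : Measurable (waveFun c d p) :=
  Measurable.indicator (by fun_prop) measurableSet_Ioo

theorem memLp_waveFun (L c d p : ℝ) : MemLp (waveFun c d p) 2 (lineMeasure L) := by
  refine MemLp.of_bound (measurable_waveFun c d p).aestronglyMeasurable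
    ‖((Real.sqrt (d - c) : ℝ) : ℂ)⁻¹‖ (.of_forall fun x => ?_)
  refine (norm_indicator_le_norm_self _ _).trans_eq ?_
  rw [norm_mul, norm_exp_I_mul, mul_one]

/-- The normalized plane wave of momentum `p` on `(c, d)`, as a vector of the one-particle space.
The ring waves are those on `(0, L)`, the wavelets those on the boxes. -/
def waveVec (L c d p : ℝ) : OneSpace L := (memLp_waveFun L c d p).toLp _

theorem waveVec_coeFn (L c d p : ℝ) : waveVec L c d p =ᵐ[lineMeasure L] waveFun c d p :=
  MemLp.coeFn_toLp _

theorem inner_eq_integral_of_ae_eq {X : Type*} [MeasurableSpace X] {μ : Measure X} {f g : Lp ℂ 2 μ}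
    {f' g' : X → ℂ} (hf : f =ᵐ[μ] f') (hg : g =ᵐ[μ] g') :
    inner ℂ f g = ∫ x, conj (f' x) * g' x ∂μ := by
  rw [L2.inner_def]
  refine integral_congr_ae ?_
  filter_upwards [hf, hg] with x h1 h2
  rw [h1, h2, RCLike.inner_apply, mul_comm]

variable {L c d : ℝ}

theorem inner_waveVec_left (hcdL : Set.Ioo c d ⊆ Set.Ioo 0 L) (p : ℝ) {f : OneSpace L} {f' : ℝ → ℂ}
    (hf : f =ᵐ[lineMeasure L] f') :
    inner ℂ (waveVec L c d p) f = ((Real.sqrt (d - c) : ℝ) : ℂ)⁻¹ *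
      ∫ x in Set.Ioo c d, Complex.exp (-(Complex.I * ((x : ℂ) * (p : ℂ)))) * f' x := by
  have hres : (lineMeasure L).restrict (Set.Ioo c d) = volume.restrict (Set.Ioo c d) := by
    rw [Measure.restrict_restrict measurableSet_Ioo, Set.inter_eq_left.2 hcdL]
  have hind : (fun x => conj (waveFun c d p x) * f' x) = (Set.Ioo c d).indicator fun x : ℝ =>
      ((Real.sqrt (d - c) : ℝ) : ℂ)⁻¹ *
        (Complex.exp (-(Complex.I * ((x : ℂ) * (p : ℂ)))) * f' x) := by
    ext x
    by_cases hx : x ∈ Set.Ioo c d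
    · rw [waveFun, Set.indicator_of_mem hx, Set.indicator_of_mem hx, map_mul, conj_exp_I_mul,
        map_inv₀, Complex.conj_ofReal, mul_assoc]
    · rw [waveFun, Set.indicator_of_notMem hx, Set.indicator_of_notMem hx, map_zero, zero_mul]
  rw [inner_eq_integral_of_ae_eq (waveVec_coeFn L c d p) hf, hind,
    integral_indicator measurableSet_Ioo, hres, integral_const_mul]

theorem inner_waveVec_of_subset (hcd : c ≤ d) (hcdL : Set.Ioo c d ⊆ Set.Ioo 0 L) {c' d' : ℝ}
    (hsub : Set.Ioo c d ⊆ Set.Ioo c' d') (p q : ℝ) :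
    inner ℂ (waveVec L c d p) (waveVec L c' d' q) =
      (((Real.sqrt (d - c) : ℝ) : ℂ) * ((Real.sqrt (d' - c') : ℝ) : ℂ))⁻¹ *
        ∫ x in c..d, Complex.exp (Complex.I * ((x : ℂ) * ((q - p : ℝ) : ℂ))) := by
  rw [inner_waveVec_left hcdL p (waveVec_coeFn L c' d' q), mul_inv, mul_assoc,
    intervalIntegral.integral_of_le hcd, integral_Ioc_eq_integral_Ioo]
  congr 1
  rw [← integral_const_mul]
  refine setIntegral_congr_fun measurableSet_Ioo fun x hx => ?_
  simp only [waveFun, Set.indicator_of_mem (hsub hx)]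
  rw [mul_left_comm, ← Complex.exp_add]
  congr 2
  push_cast
  ring

theorem inner_waveVec_of_disjoint (hcdL : Set.Ioo c d ⊆ Set.Ioo 0 L) {c' d' : ℝ}
    (hdis : Disjoint (Set.Ioo c d) (Set.Ioo c' d')) (p q : ℝ) :
    inner ℂ (waveVec L c d p) (waveVec L c' d' q) = 0 := by
  rw [inner_waveVec_left hcdL p (waveVec_coeFn L c' d' q),
    setIntegral_eq_zero_of_forall_eq_zero, mul_zero]
  intro x hx
  rw [waveFun, Set.indicator_of_notMem (Set.disjoint_left.1 hdis hx), mul_zero]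

theorem integral_exp_period (hcd : c < d) {p : ℝ} {k : ℤ} (hp : p * (d - c) = 2 * Real.pi * k) :
    ∫ x in c..d, Complex.exp (Complex.I * ((x : ℂ) * (p : ℂ))) =
      if k = 0 then ((d - c : ℝ) : ℂ) else 0 := by
  have hdc : d - c ≠ 0 := (sub_pos.2 hcd).ne'
  simp_rw [show ∀ x : ℝ, Complex.I * ((x : ℂ) * (p : ℂ)) = (Complex.I * p) * x from
    fun x => by ring]
  split_ifs with hk
  · have hp0 : p = 0 := by simpa [hdc, hk] using hp
    simp [hp0]
  · have hp0 : (p : ℂ) ≠ 0 := by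
      rw [Complex.ofReal_ne_zero]
      rintro rfl
      simp [Real.pi_ne_zero, hk] at hp
    have hpC : (p : ℂ) * (d - c) = 2 * Real.pi * k := by exact_mod_cast hp
    have hends : Complex.I * p * d = Complex.I * p * c + k * (2 * Real.pi * Complex.I) := by
      linear_combination Complex.I * hpC
    rw [integral_exp_mul_complex (mul_ne_zero Complex.I_ne_zero hp0), hends, Complex.exp_add,
      Complex.exp_int_mul_two_pi_mul_I, mul_one, sub_self, zero_div]

theorem inner_waveVec_period (hcd : c < d) (hcdL : Set.Ioo c d ⊆ Set.Ioo 0 L) {p q : ℝ} {k : ℤ}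
    (hpq : (q - p) * (d - c) = 2 * Real.pi * k) :
    inner ℂ (waveVec L c d p) (waveVec L c d q) = if k = 0 then 1 else 0 := by
  have hdc : ((d - c : ℝ) : ℂ) ≠ 0 := Complex.ofReal_ne_zero.2 (sub_pos.2 hcd).ne'
  rw [inner_waveVec_of_subset hcd.le hcdL (d' := d) le_rfl,
    sqrt_mul_sqrt_complex (sub_pos.2 hcd).le, integral_exp_period hcd hpq, mul_ite, mul_zero,
    inv_mul_cancel₀ hdc]

theorem ae_eq_zero_of_fourierCoeffOn (hcd : c < d) {f : ℝ → ℂ}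
    (hf : MemLp f 2 (volume.restrict (Set.Ioo c d))) (h : ∀ k, fourierCoeffOn hcd f k = 0) :
    ∀ᵐ x, x ∈ Set.Ioo c d → f x = 0 := by
  rw [← ae_restrict_iff' measurableSet_Ioo]
  rw [restrict_Ioo_eq_restrict_Ioc] at hf ⊢
  have hparseval := hasSum_sq_fourierCoeffOn hcd hf
  simp only [h, norm_zero, ne_eq, OfNat.ofNat_ne_zero, not_false_eq_true, zero_pow] at hparseval
  have hnorm : ∫ x in c..d, ‖f x‖ ^ 2 = 0 := by
    simpa [(sub_pos.2 hcd).ne'] using hparseval.unique hasSum_zero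
  rw [intervalIntegral.integral_of_le hcd.le,
    integral_eq_zero_iff_of_nonneg (fun x => by positivity)
      ((memLp_two_iff_integrable_sq_norm hf.1).1 hf)] at hnorm
  filter_upwards [hnorm] with x hx
  simpa using hx

theorem ae_eq_zero_of_inner_waveVec (hcd : c < d) (hcdL : Set.Ioo c d ⊆ Set.Ioo 0 L) (p : ℝ)
    {f : OneSpace L}
    (h : ∀ k : ℤ, inner ℂ (waveVec L c d (p + 2 * Real.pi * k / (d - c))) f = 0) :
    ∀ᵐ x, x ∈ Set.Ioo c d → f x = 0 := by
  have hg : MemLp (fun x : ℝ => Complex.exp (-(Complex.I * ((x : ℂ) * (p : ℂ)))) * f x) 2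
      (volume.restrict (Set.Ioo c d)) := by
    refine ((Lp.memLp f).mono_measure (Measure.restrict_mono_set _ hcdL)).of_le
      ((Continuous.aestronglyMeasurable (by fun_prop)).mul
        ((Lp.aestronglyMeasurable f).mono_measure (Measure.restrict_mono_set _ hcdL)))
      (.of_forall fun x => ?_)
    rw [norm_mul, ← conj_exp_I_mul, RCLike.norm_conj, norm_exp_I_mul, one_mul]
  have hcoeff : ∀ k, fourierCoeffOn hcd
      (fun x => Complex.exp (-(Complex.I * ((x : ℂ) * (p : ℂ)))) * f x) k = 0 := by
    intro k
    have hs : (((Real.sqrt (d - c) : ℝ) : ℂ)⁻¹) ≠ 0 := by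
      simpa using (Real.sqrt_pos.2 (sub_pos.2 hcd)).ne'
    have hk := (mul_eq_zero.1 ((inner_waveVec_left hcdL _ (ae_eq_refl _)).symm.trans (h k))
      ).resolve_left hs
    rw [fourierCoeffOn_eq_integral, intervalIntegral.integral_of_le hcd.le,
      integral_Ioc_eq_integral_Ioo, ← smul_zero (1 / (d - c)), ← hk]
    congr 2 with x
    rw [fourier_coe_apply, smul_eq_mul, ← mul_assoc, ← Complex.exp_add]
    congr 2
    push_cast
    ring
  filter_upwards [ae_eq_zero_of_fourierCoeffOn hcd hg hcoeff] with x hx hxI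
  simpa using hx hxI

end PlaneWave

/-! ### The ring and the boxes -/

section Waves

variable {L : ℝ} {n : ℕ}

theorem boxSet_right_sub_left (L : ℝ) (b : Fin n) :
    ((b : ℝ) + 1) * L / n - (b : ℝ) * L / n = L / n := by ring

theorem boxSet_left_lt_right (hL : 0 < L) (b : Fin n) :
    (b : ℝ) * L / n < ((b : ℝ) + 1) * L / n := by
  have hn : (0 : ℝ) < n := by exact_mod_cast (Nat.zero_le _).trans_lt b.2
  gcongr
  linarith

theorem boxSet_subset (hL : 0 < L) (b : Fin n) : boxSet L b ⊆ Set.Ioo 0 L := by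
  have hn : (0 : ℝ) < n := by exact_mod_cast (Nat.zero_le _).trans_lt b.2
  have hb : ((b : ℕ) : ℝ) + 1 ≤ n := by exact_mod_cast b.2
  rintro x ⟨h1, h2⟩
  refine ⟨lt_of_le_of_lt (by positivity) h1, h2.trans_le ?_⟩
  rw [div_le_iff₀ hn, mul_comm L]
  gcongr

theorem lt_of_mem_boxSet (hL : 0 < L) {b c : Fin n} (hbc : b < c) {x y : ℝ}
    (hx : x ∈ boxSet L b) (hy : y ∈ boxSet L c) : x < y := by
  have h : ((b : ℕ) : ℝ) + 1 ≤ (c : ℕ) := by exact_mod_cast hbc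
  refine hx.2.trans_le (le_trans ?_ hy.1.le)
  gcongr

theorem boxSet_unique (hL : 0 < L) {b c : Fin n} {x : ℝ}
    (hx : x ∈ boxSet L b) (hy : x ∈ boxSet L c) : b = c := by
  rcases lt_trichotomy b c with h | h | h
  · exact absurd (lt_of_mem_boxSet hL h hx hy) (lt_irrefl _)
  · exact h
  · exact absurd (lt_of_mem_boxSet hL h hy hx) (lt_irrefl _)

theorem ae_exists_mem_boxSet (hL : 0 < L) (hn : 0 < n) :
    ∀ᵐ x ∂(lineMeasure L), ∃ b : Fin n, x ∈ boxSet L b := by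
  have hn' : (0 : ℝ) < n := by exact_mod_cast hn
  have hc : (Set.range fun k : ℤ => (k : ℝ) * L / n).Countable := Set.countable_range _
  filter_upwards [ae_restrict_mem measurableSet_Ioo,
    ae_restrict_of_ae (hc.ae_notMem (volume : Measure ℝ))] with x hx hxn
  have h0 : 0 < x * n / L := by have := hx.1; positivity
  have hfloor : ⌊x * n / L⌋₊ < n := by
    rw [Nat.floor_lt h0.le, div_lt_iff₀ hL, mul_comm]
    exact mul_lt_mul_of_pos_left hx.2 hn'
  have hle := Nat.floor_le h0.le
  have hlt := Nat.lt_floor_add_one (x * n / L)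
  rw [le_div_iff₀ hL, ← div_le_iff₀ hn'] at hle
  rw [div_lt_iff₀ hL, ← lt_div_iff₀ hn'] at hlt
  exact ⟨⟨_, hfloor⟩, hle.lt_of_ne fun h => hxn ⟨(⌊x * n / L⌋₊ : ℤ), by simpa using h⟩, hlt⟩

/-- The plane wave `e^{iλx} / √L` of the ring, with `λ = 2 π (m + 1/2) / L`. -/
def ringVec (L : ℝ) (m : ℤ) : OneSpace L := waveVec L 0 L (ringMomentum L m)

/-- The wavelet `√(n/L) e^{iax} 1_{box}(x)` with label `a`. -/
def boxVec (L : ℝ) (a : Wavelet n) : OneSpace L :=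
  waveVec L ((a.box : ℝ) * L / n) (((a.box : ℝ) + 1) * L / n) (a.momentum L)

theorem orthonormal_ringVec (hL : 0 < L) : Orthonormal ℂ (ringVec L) := by
  rw [orthonormal_iff_ite]
  intro m m'
  rw [ringVec, ringVec, inner_waveVec_period hL le_rfl (k := m' - m) (by
    simp only [ringMomentum]
    push_cast
    field_simp
    ring)]
  simp only [sub_eq_zero, eq_comm]

theorem orthonormal_boxVec (hL : 0 < L) : Orthonormal ℂ (boxVec L : Wavelet n → OneSpace L) := by
  rw [orthonormal_iff_ite]
  intro a a'
  by_cases hbox : a.box = a'.box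
  · have hn : (0 : ℝ) < n := by exact_mod_cast (Nat.zero_le _).trans_lt a.box.2
    rw [boxVec, boxVec, ← hbox, inner_waveVec_period (boxSet_left_lt_right hL _)
      (boxSet_subset hL _) (k := (ofLex a').2 - (ofLex a).2) (by
        rw [boxSet_right_sub_left, Wavelet.momentum, Wavelet.momentum]
        push_cast
        field_simp)]
    refine if_congr ⟨fun h => ?_, fun h => by rw [h, sub_self]⟩ rfl rfl
    exact ofLex.injective (Prod.ext hbox (sub_eq_zero.1 h).symm)
  · rw [if_neg fun h => hbox (congrArg Wavelet.box h)]
    exact inner_waveVec_of_disjoint (boxSet_subset hL _)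
      (Set.disjoint_left.2 fun x hx hx' => hbox (boxSet_unique hL hx hx')) _ _

theorem eq_zero_of_inner_ringVec (hL : 0 < L) {f : OneSpace L}
    (h : ∀ m, inner ℂ (ringVec L m) f = 0) : f = 0 := by
  have hzero := ae_eq_zero_of_inner_waveVec hL le_rfl (ringMomentum L 0) (f := f) fun k => by
    rw [← h k, ringVec, ringMomentum, ringMomentum]
    congr 2
    push_cast
    ring
  exact Lp.eq_zero_iff_ae_eq_zero.2 ((ae_restrict_iff' measurableSet_Ioo).2 hzero)

theorem eq_zero_of_inner_boxVec (hL : 0 < L) (hn : 0 < n) {f : OneSpace L}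
    (h : ∀ a : Wavelet n, inner ℂ (boxVec L a) f = 0) : f = 0 := by
  have hbox : ∀ b : Fin n, ∀ᵐ x, x ∈ boxSet L b → f x = 0 := fun b =>
    ae_eq_zero_of_inner_waveVec (boxSet_left_lt_right hL b) (boxSet_subset hL b) 0 fun k => by
      rw [← h (toLex (b, k)), boxVec, Wavelet.momentum, boxSet_right_sub_left, zero_add]
      congr 2
      rw [ofLex_toLex]
      field_simp
  rw [Lp.eq_zero_iff_ae_eq_zero]
  filter_upwards [ae_exists_mem_boxSet hL hn, ae_restrict_of_ae (ae_all_iff.2 hbox)]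
    with x ⟨b, hx⟩ hx'
  exact hx' b hx

/-- The orthonormal basis of plane waves of the ring. -/
def ringBasis (hL : 0 < L) : HilbertBasis ℤ ℂ (OneSpace L) :=
  .mkOfOrthogonalEqBot (orthonormal_ringVec hL) <| (Submodule.eq_bot_iff _).2 fun _ hf =>
    eq_zero_of_inner_ringVec hL fun m => hf _ (Submodule.subset_span ⟨m, rfl⟩)

/-- The orthonormal basis of wavelets. -/
def boxBasis (hL : 0 < L) (hn : 0 < n) : HilbertBasis (Wavelet n) ℂ (OneSpace L) :=
  .mkOfOrthogonalEqBot (orthonormal_boxVec hL) <| (Submodule.eq_bot_iff _).2 fun _ hf =>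
    eq_zero_of_inner_boxVec hL hn fun a => hf _ (Submodule.subset_span ⟨a, rfl⟩)

@[simp] theorem ringBasis_apply (hL : 0 < L) (m : ℤ) : ringBasis hL m = ringVec L m := by
  simp [ringBasis]

@[simp] theorem boxBasis_apply (hL : 0 < L) (hn : 0 < n) (a : Wavelet n) :
    boxBasis hL hn a = boxVec L a := by
  simp [boxBasis]

theorem ringMomentum_ne_momentum (hL : 0 < L) (m : ℤ) (a : Wavelet n) :
    ringMomentum L m ≠ a.momentum L := by
  unfold ringMomentum Wavelet.momentum
  intro h
  have hreal : (m : ℝ) + 1 / 2 = n * ((ofLex a).2 : ℤ) := by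
    have := Real.pi_pos
    field_simp at h
    linarith
  have hint : (2 * m + 1 : ℤ) = 2 * (n * (ofLex a).2) := by
    have : (2 * m + 1 : ℝ) = 2 * (n * ((ofLex a).2 : ℤ)) := by linarith
    exact_mod_cast this
  omega

theorem exp_I_mul_momentum (hL : 0 < L) (a : Wavelet n) (k : ℤ) :
    Complex.exp (Complex.I * (((k * L / n : ℝ) : ℂ) * (a.momentum L : ℂ))) = 1 := by
  have hn : (n : ℂ) ≠ 0 := by exact_mod_cast ((Nat.zero_le _).trans_lt a.box.2).ne'
  have hLC : (L : ℂ) ≠ 0 := by exact_mod_cast hL.ne'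
  rw [Complex.exp_eq_one_iff]
  refine ⟨k * (ofLex a).2, ?_⟩
  rw [Wavelet.momentum]
  push_cast
  field_simp

theorem conj_overlap (lam : ℝ) (a : Wavelet n) :
    conj (overlap L lam a) = ((Real.sqrt n : ℝ) : ℂ) / L *
      ((Complex.exp (Complex.I * ((((a.box : ℝ) + 1) * L / n : ℝ) * (lam : ℂ))) -
        Complex.exp (Complex.I * (((a.box : ℝ) * L / n : ℝ) * (lam : ℂ)))) /
          (Complex.I * ((lam : ℂ) - a.momentum L))) := by
  have hleft : Complex.exp (Complex.I * (((a.box : ℝ) * L / n : ℝ) * (lam : ℂ))) =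
      Complex.exp (-Complex.I * L * lam / n) *
        Complex.exp (Complex.I * ((((a.box : ℝ) + 1) * L / n : ℝ) * (lam : ℂ))) := by
    rw [← Complex.exp_add]
    congr 1
    push_cast
    ring
  have hright : Complex.exp (Complex.I * L * (((a.box : ℕ) : ℂ) + 1) / n * lam) =
      Complex.exp (Complex.I * ((((a.box : ℝ) + 1) * L / n : ℝ) * (lam : ℂ))) := by
    congr 1
    push_cast
    ring
  simp only [overlap, map_mul, map_div₀, map_sub, map_one, map_add, map_neg, map_natCast,
    ← Complex.exp_conj, Complex.conj_I, Complex.conj_ofReal, neg_neg]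
  rw [hleft, hright, div_mul_eq_div_div (_ - _), Complex.div_I]
  ring

theorem inner_boxVec_ringVec (hL : 0 < L) (m : ℤ) (a : Wavelet n) :
    inner ℂ (boxVec L a) (ringVec L m) = conj (overlap L (ringMomentum L m) a) := by
  have hne : ((ringMomentum L m - a.momentum L : ℝ) : ℂ) ≠ 0 :=
    Complex.ofReal_ne_zero.2 (sub_ne_zero.2 (ringMomentum_ne_momentum hL m a))
  have hprefactor : (((Real.sqrt (L / n) : ℝ) : ℂ) * ((Real.sqrt (L - 0) : ℝ) : ℂ))⁻¹ =
      ((Real.sqrt n : ℝ) : ℂ) / L := by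
    rw [sub_zero, Real.sqrt_div hL.le, Complex.ofReal_div, div_mul_eq_mul_div,
      sqrt_mul_sqrt_complex hL.le, inv_div]
  have hend : ∀ k : ℤ, Complex.exp (Complex.I * ((ringMomentum L m - a.momentum L : ℝ) : ℂ) *
      ((k * L / n : ℝ) : ℂ)) =
        Complex.exp (Complex.I * (((k * L / n : ℝ) : ℂ) * (ringMomentum L m : ℂ))) := by
    intro k
    rw [← mul_one (Complex.exp (_ * _ * _)), ← exp_I_mul_momentum hL a k, ← Complex.exp_add]
    congr 1
    push_cast
    ring
  have hleft := hend (a.box : ℕ)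
  have hright := hend ((a.box : ℕ) + 1)
  push_cast at hleft hright
  rw [boxVec, ringVec, inner_waveVec_of_subset (boxSet_left_lt_right hL _).le
    (boxSet_subset hL _) (boxSet_subset hL _), boxSet_right_sub_left, hprefactor, conj_overlap]
  simp_rw [mul_left_comm Complex.I, mul_comm ((_ : ℝ) : ℂ) (Complex.I * _)]
  rw [integral_exp_mul_complex (mul_ne_zero Complex.I_ne_zero hne)]
  push_cast
  rw [hleft, hright]
  ring_nf

theorem inner_ringVec_boxVec (hL : 0 < L) (m : ℤ) (a : Wavelet n) :
    inner ℂ (ringVec L m) (boxVec L a) = overlap L (ringMomentum L m) a := by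
  rw [← inner_conj_symm, inner_boxVec_ringVec hL, Complex.conj_conj]

end Waves

/-! ### The unitary group of a diagonal operator -/

section PhaseGroup

variable {ι H : Type*} [NormedAddCommGroup H] [InnerProductSpace ℂ H] (b : HilbertBasis ι ℂ H)

theorem eq_of_inner_hilbertBasis {x y : H} (h : ∀ i, inner ℂ (b i) x = inner ℂ (b i) y) : x = y :=
  b.repr.injective <| lp.ext <| funext fun i => by
    rw [b.repr_apply_apply, b.repr_apply_apply, h]

theorem norm_exp_phase (t r : ℝ) : ‖Complex.exp (-Complex.I * t * r)‖ = 1 := by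
  rw [show -Complex.I * t * r = ((-(t * r) : ℝ) : ℂ) * Complex.I by push_cast; ring,
    Complex.norm_exp_ofReal_mul_I]

theorem conj_exp_phase (t r : ℝ) :
    conj (Complex.exp (-Complex.I * t * r)) = Complex.exp (-Complex.I * (-t : ℝ) * r) := by
  rw [← Complex.exp_conj]
  simp

theorem exp_phase_mul_neg (t r : ℝ) :
    Complex.exp (-Complex.I * t * r) * Complex.exp (-Complex.I * (-t : ℝ) * r) = 1 := by
  rw [← Complex.exp_add, ← Complex.exp_zero]
  congr 1
  push_cast
  ring

variable (E : ι → ℝ)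

theorem orthonormal_phase_smul (t : ℝ) :
    Orthonormal ℂ fun i => Complex.exp (-Complex.I * t * E i) • b i := by
  refine ⟨fun i => ?_, fun i j hij => ?_⟩
  · rw [norm_smul, norm_exp_phase, b.orthonormal.1, mul_one]
  · simp only [inner_smul_left, inner_smul_right, b.orthonormal.2 hij, mul_zero, mul_zero]

variable [CompleteSpace H]

/-- The Hilbert basis `e^{-itE_i} b_i`. -/
def phaseBasis (t : ℝ) : HilbertBasis ι ℂ H :=
  .mkOfOrthogonalEqBot (orthonormal_phase_smul b E t) <| (Submodule.eq_bot_iff _).2 fun x hx =>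
    eq_of_inner_hilbertBasis b fun i => by
      have hi := hx _ (Submodule.subset_span ⟨i, rfl⟩)
      simpa only [inner_smul_left, mul_eq_zero, map_eq_zero, Complex.exp_ne_zero, false_or,
        inner_zero_right] using hi

/-- The unitary group `e^{-itA}` of the (in general unbounded) operator `A` that is diagonal in the
basis `b`, with eigenvalues `E`: it maps `b` to the basis `e^{-itE_i} b_i`. -/
def phaseGroup (t : ℝ) : H ≃ₗᵢ[ℂ] H := b.repr.trans (phaseBasis b E t).repr.symm

theorem phaseGroup_apply_basis (t : ℝ) (i : ι) :
    phaseGroup b E t (b i) = Complex.exp (-Complex.I * t * E i) • b i := by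
  classical
  rw [phaseGroup, LinearIsometryEquiv.trans_apply, b.repr_self, HilbertBasis.repr_symm_single,
    phaseBasis, HilbertBasis.coe_mkOfOrthogonalEqBot]

theorem inner_basis_phaseGroup (t : ℝ) (x : H) (i : ι) :
    inner ℂ (b i) (phaseGroup b E t x) =
      Complex.exp (-Complex.I * t * E i) * inner ℂ (b i) x := by
  rw [← (phaseGroup b E t).inner_map_map (b i) x, phaseGroup_apply_basis, inner_smul_left,
    conj_exp_phase, ← mul_assoc, exp_phase_mul_neg, one_mul]

theorem hasSum_inner_phaseGroup (t : ℝ) (x y : H) :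
    HasSum (fun i => inner ℂ x (b i) * inner ℂ (b i) y * Complex.exp (-Complex.I * t * E i))
      (inner ℂ x (phaseGroup b E t y)) := by
  have h := b.hasSum_inner_mul_inner x (phaseGroup b E t y)
  simp only [inner_basis_phaseGroup] at h
  simpa only [mul_assoc, mul_comm (inner ℂ (b _) y)] using h

theorem phaseGroup_zero (x : H) : phaseGroup b E 0 x = x :=
  eq_of_inner_hilbertBasis b fun i => by simp [inner_basis_phaseGroup]

theorem phaseGroup_phaseGroup_neg (t : ℝ) (x : H) :
    phaseGroup b E t (phaseGroup b E (-t) x) = x :=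
  eq_of_inner_hilbertBasis b fun i => by
    rw [inner_basis_phaseGroup, inner_basis_phaseGroup, ← mul_assoc, exp_phase_mul_neg, one_mul]

theorem inner_phaseGroup_left (t : ℝ) (x y : H) :
    inner ℂ (phaseGroup b E t x) y = inner ℂ x (phaseGroup b E (-t) y) := by
  rw [← (phaseGroup b E t).inner_map_map x, phaseGroup_phaseGroup_neg]

theorem continuous_phaseGroup_prod : Continuous fun p : H × ℝ => phaseGroup b E p.2 p.1 := by
  refine continuous_prod_of_dense_continuous_lipschitzWith _ 1
    (Submodule.dense_iff_topologicalClosure_eq_top.2 b.dense_span) (fun x hx => ?_)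
    fun t => (phaseGroup b E t).lipschitz
  induction hx using Submodule.span_induction with
  | mem x hx =>
    obtain ⟨i, rfl⟩ := hx
    simp only [phaseGroup_apply_basis]
    fun_prop
  | zero => simpa only [map_zero] using continuous_const
  | add x y _ _ hx hy => simp only [map_add]; fun_prop
  | smul c x _ hx => simp only [map_smul]; fun_prop

theorem continuous_phaseGroup {u : ℝ → H} (hu : Continuous u) {r : ℝ → ℝ} (hr : Continuous r) :
    Continuous fun t => phaseGroup b E (r t) (u t) := by
  simpa only [Function.comp_def] using (continuous_phaseGroup_prod b E).comp (hu.prodMk hr)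

end PhaseGroup

/-! ### The interaction picture -/

section InteractionPicture

variable {ι κ β H : Type*} [Fintype β] [NormedAddCommGroup H] [InnerProductSpace ℂ H]

/-- The potential `∑_b v_b(s) B_b` at time `s`. -/
def potOp (B : β → H →L[ℂ] H) (v : β → ℝ → ℝ) (s : ℝ) : H →L[ℂ] H := ∑ b, (v b s : ℂ) • B b

theorem potOp_apply (B : β → H →L[ℂ] H) (v : β → ℝ → ℝ) (s : ℝ) (x : H) :
    potOp B v s x = ∑ b, (v b s : ℂ) • B b x := by
  rw [potOp, _root_.sum_apply]
  rfl

theorem norm_potOp_le (B : β → H →L[ℂ] H) (v : β → ℝ → ℝ) (s : ℝ) (x : H) :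
    ‖potOp B v s x‖ ≤ (∑ b, |v b s| * ‖B b‖) * ‖x‖ := by
  rw [potOp_apply, Finset.sum_mul]
  refine (norm_sum_le _ _).trans (Finset.sum_le_sum fun b _ => ?_)
  rw [norm_smul, Complex.norm_real, Real.norm_eq_abs, mul_assoc]
  exact mul_le_mul_of_nonneg_left ((B b).le_opNorm x) (abs_nonneg _)

theorem inner_potOp_left {B : β → H →L[ℂ] H}
    (hB : ∀ b x y, inner ℂ (B b x) y = inner ℂ x (B b y)) (v : β → ℝ → ℝ) (s : ℝ) (x y : H) :
    inner ℂ (potOp B v s x) y = inner ℂ x (potOp B v s y) := by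
  simp only [potOp_apply, sum_inner, inner_sum, inner_smul_left, inner_smul_right,
    Complex.conj_ofReal, hB]

variable [CompleteSpace H] (b : HilbertBasis ι ℂ H) (E : ι → ℝ) (B : β → H →L[ℂ] H)
  (v : β → ℝ → ℝ)

/-- The potential `e^{isA} V(s) e^{-isA}` in the interaction picture, for the operator `A` with
eigenvectors `b` and eigenvalues `E` and for `V(s) = ∑_b v_b(s) B_b`. -/
def interactionOp (s : ℝ) : H →L[ℂ] H :=
  (phaseGroup b E (-s) : H →L[ℂ] H) ∘L potOp B v s ∘L phaseGroup b E s

theorem interactionOp_apply (s : ℝ) (x : H) :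
    interactionOp b E B v s x = phaseGroup b E (-s) (potOp B v s (phaseGroup b E s x)) := rfl

theorem phaseGroup_interactionOp (s : ℝ) (x : H) :
    phaseGroup b E s (interactionOp b E B v s x) = potOp B v s (phaseGroup b E s x) :=
  phaseGroup_phaseGroup_neg _ _ _ _

theorem inner_interactionOp_right (s : ℝ) (x y : H) :
    inner ℂ x (interactionOp b E B v s y) =
      inner ℂ (phaseGroup b E s x) (potOp B v s (phaseGroup b E s y)) := by
  rw [interactionOp_apply, ← inner_phaseGroup_left]

variable {B} in
theorem inner_interactionOp_left (hB : ∀ b x y, inner ℂ (B b x) y = inner ℂ x (B b y)) (s : ℝ)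
    (x y : H) : inner ℂ (interactionOp b E B v s x) y = inner ℂ x (interactionOp b E B v s y) := by
  rw [← inner_conj_symm, inner_interactionOp_right, inner_conj_symm, inner_potOp_left hB,
    inner_interactionOp_right]

theorem norm_neg_I_smul_interactionOp_le (s : ℝ) (x : H) :
    ‖(-Complex.I • interactionOp b E B v s).restrictScalars ℝ x‖ ≤
      (∑ b, |v b s| * ‖B b‖) * ‖x‖ := by
  have hx := norm_potOp_le B v s (phaseGroup b E s x)
  simpa [norm_smul, interactionOp_apply] using hx

variable {v}

theorem locallyIntegrable_sum_abs_mul (hv : ∀ b, LocallyIntegrable (v b)) (c : β → ℝ) :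
    LocallyIntegrable fun s => ∑ b, |v b s| * c b :=
  locallyIntegrable_finsetSum _ fun b _ => LocallyIntegrable.mul_continuous continuous_const
    ((hv b).mono (hv b).aestronglyMeasurable.norm (by simp))

theorem locallyIntegrable_interactionOp (hv : ∀ b, LocallyIntegrable (v b)) {u : ℝ → H}
    (hu : Continuous u) : LocallyIntegrable fun s => interactionOp b E B v s (u s) := by
  have hsum : ∀ s, interactionOp b E B v s (u s) =
      ∑ j, v j s • phaseGroup b E (-s) (B j (phaseGroup b E s (u s))) := fun s => by
    simp only [interactionOp_apply, potOp_apply, map_sum, map_smul]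
    rfl
  simp only [hsum]
  exact locallyIntegrable_finsetSum _ fun j _ => LocallyIntegrable.smul_continuous
    (continuous_phaseGroup _ _ ((B j).continuous.comp
      (continuous_phaseGroup _ _ hu continuous_id)) continuous_neg) (hv j)

variable (v) in
/-- The solutions `u` of `∂ₛu = -i e^{isA} V(s) e^{-isA} u`, the Schrödinger equation in the
interaction picture, in integrated form. -/
def IsOrbit (u : ℝ → H) : Prop := IsPrimitive u fun s => -Complex.I • interactionOp b E B v s (u s)

theorem exists_isOrbit (hv : ∀ b, LocallyIntegrable (v b)) (u₀ : H) :
    ∃ u, u 0 = u₀ ∧ IsOrbit b E B v u :=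
  volterra_exists (locallyIntegrable_sum_abs_mul hv _)
    (fun _ => Finset.sum_nonneg fun _ _ => mul_nonneg (abs_nonneg _) (norm_nonneg _))
    (norm_neg_I_smul_interactionOp_le b E B v)
    (fun _ hu => (locallyIntegrable_interactionOp b E B hv hu).smul (-Complex.I)) u₀

variable {b E B}

theorem IsOrbit.unique (hv : ∀ b, LocallyIntegrable (v b)) {u u' : ℝ → H}
    (hu : IsOrbit b E B v u) (hu' : IsOrbit b E B v u') (h : u 0 = u' 0) : u = u' :=
  volterra_unique (locallyIntegrable_sum_abs_mul hv _)
    (fun _ => Finset.sum_nonneg fun _ _ => mul_nonneg (abs_nonneg _) (norm_nonneg _))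
    (norm_neg_I_smul_interactionOp_le b E B v) hu hu' h

theorem IsOrbit.inner_eq (hB : ∀ b x y, inner ℂ (B b x) y = inner ℂ x (B b y)) {u u' : ℝ → H}
    (hu : IsOrbit b E B v u) (hu' : IsOrbit b E B v u') (t : ℝ) :
    inner ℂ (u t) (u' t) = inner ℂ (u 0) (u' 0) := by
  have hderiv : ∀ s, inner ℂ (u s) (-Complex.I • interactionOp b E B v s (u' s)) +
      inner ℂ (-Complex.I • interactionOp b E B v s (u s)) (u' s) = 0 := fun s => by
    simp [inner_smul_left, inner_smul_right, inner_interactionOp_left _ _ _ hB]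
  have hprim := (IsPrimitive.inner hu hu').eq_add_integral t
  simpa only [hderiv, intervalIntegral.integral_zero, add_zero] using hprim

theorem IsOrbit.isPrimitive_inner {u : ℝ → H} (hu : IsOrbit b E B v u) (x : H) :
    IsPrimitive (fun t => inner ℂ x (u t))
      fun s => -Complex.I * inner ℂ x (interactionOp b E B v s (u s)) := by
  simpa [inner_smul_right] using IsPrimitive.clm hu ((innerSL ℂ x).restrictScalars ℝ)

theorem isOrbit_of_inner_hilbertBasis (b' : HilbertBasis κ ℂ H)
    (hv : ∀ b, LocallyIntegrable (v b)) {u : ℝ → H} (hu : Continuous u)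
    (h : ∀ t i, inner ℂ (b' i) (u t) = inner ℂ (b' i) (u 0) -
      Complex.I * ∫ s in (0 : ℝ)..t, inner ℂ (b' i) (interactionOp b E B v s (u s))) :
    IsOrbit b E B v u := by
  have hloc : LocallyIntegrable fun s => -Complex.I • interactionOp b E B v s (u s) :=
    (locallyIntegrable_interactionOp b E B hv hu).smul (-Complex.I)
  refine ⟨hloc, fun t => eq_of_inner_hilbertBasis b' fun i => ?_⟩
  have hcomm := ((innerSL ℂ (b' i)).restrictScalars ℝ).intervalIntegral_comp_comm
    (intervalIntegrable_of_locallyIntegrable hloc 0 t)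
  simp only [ContinuousLinearMap.coe_restrictScalars', innerSL_apply_apply, inner_smul_right,
    intervalIntegral.integral_const_mul] at hcomm
  rw [h, inner_add_right, ← hcomm]
  ring

end InteractionPicture

/-! ### Multiplication operators -/

section MulOp

variable {X : Type*} [MeasurableSpace X] {μ : Measure X} {w : X → ℝ}

/-- Multiplication by an essentially bounded real function. The box projections, the number of
particles in a box and the sign of an arrangement of points all act on wave functions in this
way. -/
def mulOp (hw : MemLp w ∞ μ) : Lp ℂ 2 μ →L[ℂ] Lp ℂ 2 μ :=
  (ContinuousLinearMap.mul ℂ ℂ).holderL μ ∞ 2 2 (hw.ofReal (K := ℂ)).toLp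

theorem mulOp_coeFn (hw : MemLp w ∞ μ) (f : Lp ℂ 2 μ) :
    mulOp hw f =ᵐ[μ] fun x => (w x : ℂ) * f x := by
  filter_upwards [(ContinuousLinearMap.mul ℂ ℂ).coeFn_holder (r := 2)
    (hw.ofReal (K := ℂ)).toLp f, (hw.ofReal (K := ℂ)).coeFn_toLp] with x hx hwx
  rw [mulOp, ContinuousLinearMap.holderL_apply_apply, hx, hwx, ContinuousLinearMap.mul_apply']
  rfl

theorem inner_mulOp_left (hw : MemLp w ∞ μ) (f g : Lp ℂ 2 μ) :
    inner ℂ (mulOp hw f) g = inner ℂ f (mulOp hw g) := by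
  rw [inner_eq_integral_of_ae_eq (mulOp_coeFn hw f) (ae_eq_refl _),
    inner_eq_integral_of_ae_eq (ae_eq_refl _) (mulOp_coeFn hw g)]
  simp only [map_mul, Complex.conj_ofReal, mul_left_comm, mul_assoc]

theorem mulOp_comm {w' : X → ℝ} (hw : MemLp w ∞ μ) (hw' : MemLp w' ∞ μ) (f : Lp ℂ 2 μ) :
    mulOp hw (mulOp hw' f) = mulOp hw' (mulOp hw f) := by
  refine Lp.ext ?_
  filter_upwards [mulOp_coeFn hw (mulOp hw' f), mulOp_coeFn hw' f,
    mulOp_coeFn hw' (mulOp hw f), mulOp_coeFn hw f] with x h1 h2 h3 h4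
  rw [h1, h2, h3, h4, mul_left_comm]

theorem mulOp_mulOp_of_sq_eq_one (hw : MemLp w ∞ μ) (hsq : ∀ᵐ x ∂μ, w x * w x = 1)
    (f : Lp ℂ 2 μ) : mulOp hw (mulOp hw f) = f := by
  refine Lp.ext ?_
  filter_upwards [mulOp_coeFn hw (mulOp hw f), mulOp_coeFn hw f, hsq] with x h1 h2 h3
  rw [h1, h2, ← mul_assoc, ← Complex.ofReal_mul, h3, Complex.ofReal_one, one_mul]

end MulOp

/-! ### One particle on the ring -/

section BoxPotential

variable (L : ℝ) {n : ℕ}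

/-- The indicator function of box `b`. -/
def boxIndicator (b : Fin n) : ℝ → ℝ := (boxSet L b).indicator 1

theorem measurable_boxIndicator (b : Fin n) : Measurable (boxIndicator L b) :=
  measurable_one.indicator measurableSet_Ioo

theorem abs_boxIndicator_le (b : Fin n) (x : ℝ) : |boxIndicator L b x| ≤ 1 := by
  by_cases hx : x ∈ boxSet L b <;> simp [boxIndicator, hx]

theorem memLp_top_boxIndicator_comp {X : Type*} [MeasurableSpace X] {μ : Measure X} (b : Fin n)
    {p : X → ℝ} (hp : Measurable p) : MemLp (fun x => boxIndicator L b (p x)) ∞ μ :=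
  memLp_top_of_bound ((measurable_boxIndicator L b).comp hp).aestronglyMeasurable 1
    (.of_forall fun x => abs_boxIndicator_le L b (p x))

/-- The orthogonal projection onto the functions supported in box `b`. -/
def boxProj (b : Fin n) : OneSpace L →L[ℂ] OneSpace L :=
  mulOp (memLp_top_boxIndicator_comp L b measurable_id)

theorem boxVec_coeFn (a : Wavelet n) :
    boxVec L a =ᵐ[lineMeasure L] (boxSet L a.box).indicator fun x => waveFun
      (a.box * L / n) ((a.box + 1) * L / n) (a.momentum L) x := by
  refine (waveVec_coeFn L _ _ _).trans (.of_forall fun x => ?_)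
  by_cases hx : x ∈ boxSet L a.box
  · rw [Set.indicator_of_mem hx]
  · rw [Set.indicator_of_notMem hx]
    exact Set.indicator_of_notMem hx _

theorem boxProj_boxVec {L : ℝ} (hL : 0 < L) (b : Fin n) (a : Wavelet n) :
    boxProj L b (boxVec L a) = if a.box = b then boxVec L a else 0 := by
  refine Lp.ext ?_
  split_ifs with h
  · subst h
    filter_upwards [mulOp_coeFn (memLp_top_boxIndicator_comp L a.box measurable_id) (boxVec L a),
      boxVec_coeFn L a] with x h1 h2
    rw [boxProj, h1, h2]
    by_cases hx : x ∈ boxSet L a.box <;> simp [boxIndicator, hx]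
  · filter_upwards [mulOp_coeFn (memLp_top_boxIndicator_comp L b measurable_id) (boxVec L a),
      boxVec_coeFn L a, Lp.coeFn_zero ℂ 2 (lineMeasure L)] with x h1 h2 h3
    rw [boxProj, h1, h2, h3]
    by_cases hx : x ∈ boxSet L b
    · have : x ∉ boxSet L a.box := fun h' => h (boxSet_unique hL h' hx)
      simp [this]
    · simp [boxIndicator, hx]

theorem inner_boxProj_left (b : Fin n) (f g : OneSpace L) :
    inner ℂ (boxProj L b f) g = inner ℂ f (boxProj L b g) := inner_mulOp_left _ f g

theorem potOp_boxVec {L : ℝ} (hL : 0 < L) (v : Fin n → ℝ → ℝ) (s : ℝ) (a : Wavelet n) :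
    potOp (boxProj L) v s (boxVec L a) = (v a.box s : ℂ) • boxVec L a := by
  simp [potOp_apply, boxProj_boxVec hL]

end BoxPotential

section OneParticle

variable {L : ℝ} (hL : 0 < L) {n : ℕ} {v : Fin n → ℝ → ℝ}

/-- The free evolution `e^{-itλ²}` of one particle on the ring. -/
abbrev freeProp (t : ℝ) : OneSpace L ≃ₗᵢ[ℂ] OneSpace L :=
  phaseGroup (ringBasis hL) (fun m => ringMomentum L m ^ 2) t

variable (v) in
/-- The potential of one particle in the interaction picture. -/
abbrev intOp (s : ℝ) : OneSpace L →L[ℂ] OneSpace L :=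
  interactionOp (ringBasis hL) (fun m => ringMomentum L m ^ 2) (boxProj L) v s

/-- The solution of the one-particle Schrödinger equation in the interaction picture that starts at
the wavelet `c`. -/
def orbit (hv : ∀ b, LocallyIntegrable (v b)) (c : Wavelet n) : ℝ → OneSpace L :=
  (exists_isOrbit (ringBasis hL) (fun m => ringMomentum L m ^ 2) (boxProj L) hv
    (boxVec L c)).choose

theorem orbit_zero (hv : ∀ b, LocallyIntegrable (v b)) (c : Wavelet n) :
    orbit hL hv c 0 = boxVec L c :=
  (exists_isOrbit (ringBasis hL) _ (boxProj L) hv (boxVec L c)).choose_spec.1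

theorem isOrbit_orbit (hv : ∀ b, LocallyIntegrable (v b)) (c : Wavelet n) :
    IsOrbit (ringBasis hL) (fun m => ringMomentum L m ^ 2) (boxProj L) v (orbit hL hv c) :=
  (exists_isOrbit (ringBasis hL) _ (boxProj L) hv (boxVec L c)).choose_spec.2

theorem green_eq_inner (t : ℝ) (a c : Wavelet n) :
    green L t a c = inner ℂ (boxVec L a) (freeProp hL t (boxVec L c)) := by
  rw [freeProp, ← (hasSum_inner_phaseGroup _ _ t _ _).tsum_eq, green]
  refine tsum_congr fun m => ?_
  rw [ringBasis_apply, ← inner_ringVec_boxVec hL, ← inner_ringVec_boxVec hL, inner_conj_symm,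
    Complex.ofReal_pow]

theorem interaction_eq_inner (hn : 0 < n) (t : ℝ) (a c : Wavelet n) :
    interaction L v t a c = inner ℂ (boxVec L a) (intOp hL v t (boxVec L c)) := by
  rw [inner_interactionOp_right, ← (boxBasis hL hn).tsum_inner_mul_inner, interaction]
  refine tsum_congr fun g => ?_
  rw [green_eq_inner hL, green_eq_inner hL, boxBasis_apply,
    ← inner_potOp_left (inner_boxProj_left L), potOp_boxVec hL, inner_smul_left,
    Complex.conj_ofReal, mul_assoc, freeProp, ← inner_phaseGroup_left]

theorem hasSum_interaction_mul (hn : 0 < n) (t : ℝ) (a : Wavelet n) (x : OneSpace L) :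
    HasSum (fun g => interaction L v t a g * inner ℂ (boxVec L g) x)
      (inner ℂ (boxVec L a) (intOp hL v t x)) := by
  simpa only [interaction_eq_inner hL hn, boxBasis_apply,
    ← inner_interactionOp_left _ _ _ (inner_boxProj_left L)] using
    (boxBasis hL hn).hasSum_inner_mul_inner (intOp hL v t (boxVec L a)) x

theorem hasSum_green_mul (hn : 0 < n) (t : ℝ) (a : Wavelet n) (x : OneSpace L) :
    HasSum (fun g => green L t a g * inner ℂ (boxVec L g) x)
      (inner ℂ (boxVec L a) (freeProp hL t x)) := by
  have h := (boxBasis hL hn).hasSum_inner_mul_inner (freeProp hL (-t) (boxVec L a)) x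
  simpa only [green_eq_inner hL, freeProp, inner_phaseGroup_left, neg_neg, boxBasis_apply] using h

theorem isPsiTilde_orbit (hn : 0 < n) (hv : ∀ b, LocallyIntegrable (v b)) :
    IsPsiTilde L v fun t a c => inner ℂ (boxVec L a) (orbit hL hv c t) := by
  have hp := fun a c : Wavelet n => (isOrbit_orbit hL hv c).isPrimitive_inner (boxVec L a)
  refine ⟨fun c => ⟨fun t => (boxBasis hL hn).repr (orbit hL hv c t), ?_, fun t a => ?_⟩,
    fun a c t => ?_, fun a c t => ?_⟩
  · exact (boxBasis hL hn).repr.continuous.comp (isOrbit_orbit hL hv c).continuous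
  · rw [HilbertBasis.repr_apply_apply, boxBasis_apply]
  · simp only [(hasSum_interaction_mul hL hn _ _ _).tsum_eq]
    simpa [← mul_assoc] using ((hp a c).intervalIntegrable 0 t).const_mul Complex.I
  · simp only [(hasSum_interaction_mul hL hn _ _ _).tsum_eq]
    rw [(hp a c).eq_add_integral t, orbit_zero, orthonormal_iff_ite.1 (orthonormal_boxVec hL) a c,
      intervalIntegral.integral_const_mul]
    ring

theorem IsPsiTilde.eq_inner_orbit (hn : 0 < n) (hv : ∀ b, LocallyIntegrable (v b))
    {ψt : ℝ → Wavelet n → Wavelet n → ℂ} (h : IsPsiTilde L v ψt) (t : ℝ) (a c : Wavelet n) :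
    ψt t a c = inner ℂ (boxVec L a) (orbit hL hv c t) := by
  obtain ⟨u, hu, hψ⟩ := h.column c
  let x : ℝ → OneSpace L := fun t => (boxBasis hL hn).repr.symm (u t)
  have hx : Continuous x := (boxBasis hL hn).repr.symm.continuous.comp hu
  have hinner : ∀ t a, inner ℂ (boxVec L a) (x t) = ψt t a c := fun t a => by
    rw [← boxBasis_apply hL hn, ← HilbertBasis.repr_apply_apply,
      LinearIsometryEquiv.apply_symm_apply, hψ]
  have hx0 : x 0 = boxVec L c := eq_of_inner_hilbertBasis (boxBasis hL hn) fun a => by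
    rw [boxBasis_apply, hinner, h.equation, intervalIntegral.integral_same, mul_zero, sub_zero,
      orthonormal_iff_ite.1 (orthonormal_boxVec hL)]
  have horbit : IsOrbit (ringBasis hL) (fun m => ringMomentum L m ^ 2) (boxProj L) v x :=
    isOrbit_of_inner_hilbertBasis (boxBasis hL hn) hv hx fun t a => by
      rw [boxBasis_apply]
      simp only [← (hasSum_interaction_mul hL hn _ _ _).tsum_eq]
      simp only [hinner, h.equation a c t, h.equation a c 0, intervalIntegral.integral_same,
        mul_zero, sub_zero]
  rw [← hinner, horbit.unique hv (isOrbit_orbit hL hv c) (by rw [hx0, orbit_zero])]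

include hL in
theorem existsUnique_psiTilde (hn : 0 < n) (hv : ∀ b, LocallyIntegrable (v b)) :
    ∃! ψt : ℝ → Wavelet n → Wavelet n → ℂ, IsPsiTilde L v ψt :=
  ⟨_, isPsiTilde_orbit hL hn hv, fun _ h => by
    funext t a c
    exact h.eq_inner_orbit hL hn hv t a c⟩

theorem IsPsiTilde.psi_eq_inner (hn : 0 < n) (hv : ∀ b, LocallyIntegrable (v b))
    {ψt : ℝ → Wavelet n → Wavelet n → ℂ} (h : IsPsiTilde L v ψt) (t : ℝ) (a c : Wavelet n) :
    psi L ψt t a c = inner ℂ (boxVec L a) (freeProp hL t (orbit hL hv c t)) := by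
  simp only [psi, h.eq_inner_orbit hL hn hv, (hasSum_green_mul hL hn t a _).tsum_eq]

end OneParticle

/-! ### Wave functions on the cube -/

section PairSign

variable {N : ℕ}

/-- The sign `∏_{i < j} sgn (x_i - x_j)` of an arrangement of points on the line. Multiplication by
it turns antisymmetric functions into symmetric ones, that is, free fermions into hardcore
bosons. -/
def pairSign (x : Fin N → ℝ) : ℝ := ∏ i, ∏ j, if i < j then Real.sign (x i - x j) else 1

theorem real_sign_mul (a b : ℝ) : Real.sign (a * b) = Real.sign a * Real.sign b := by
  rcases lt_trichotomy a 0 with ha | rfl | ha <;> rcases lt_trichotomy b 0 with hb | rfl | hb <;>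
    simp [*, Real.sign_of_neg, Real.sign_of_pos, mul_pos_of_neg_of_neg, mul_neg_of_pos_of_neg,
      mul_neg_of_neg_of_pos]

theorem real_sign_prod {ι : Type*} (s : Finset ι) (f : ι → ℝ) :
    Real.sign (∏ i ∈ s, f i) = ∏ i ∈ s, Real.sign (f i) :=
  map_prod (⟨⟨Real.sign, Real.sign_one⟩, real_sign_mul⟩ : ℝ →* ℝ) f s

theorem pairSign_eq_sign_det (x : Fin N → ℝ) :
    pairSign x = Real.sign (Matrix.vandermonde (-x)).det := by
  simp only [Matrix.det_vandermonde, real_sign_prod, pairSign]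
  refine Finset.prod_congr rfl fun i _ => ?_
  rw [← Finset.prod_filter]
  refine Finset.prod_congr (by ext; simp) fun j _ => ?_
  rw [Pi.neg_apply, Pi.neg_apply, neg_sub_neg]

theorem pairSign_comp (x : Fin N → ℝ) (σ : Equiv.Perm (Fin N)) :
    pairSign (x ∘ σ) = ((Equiv.Perm.sign σ : ℤ) : ℝ) * pairSign x := by
  have h : Matrix.vandermonde (-(x ∘ σ)) = (Matrix.vandermonde (-x)).submatrix σ id := by
    ext i j
    simp [Matrix.vandermonde_apply]
  rw [pairSign_eq_sign_det, pairSign_eq_sign_det, h, Matrix.det_permute, real_sign_mul]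
  rcases Int.units_eq_one_or (Equiv.Perm.sign σ) with h | h <;> simp [h, Real.sign_of_neg]

theorem sign_mul_self_complex {ι : Type*} [Fintype ι] [DecidableEq ι] (σ : Equiv.Perm ι) :
    ((Equiv.Perm.sign σ : ℤ) : ℂ) * ((Equiv.Perm.sign σ : ℤ) : ℂ) = 1 := by
  rcases Int.units_eq_one_or (Equiv.Perm.sign σ) with h | h <;> simp [h]

theorem pairSign_mul_self {x : Fin N → ℝ} (hx : Function.Injective x) :
    pairSign x * pairSign x = 1 := by
  have : (Matrix.vandermonde (-x)).det ≠ 0 :=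
    Matrix.det_vandermonde_ne_zero_iff.2 (neg_injective.comp hx)
  rw [pairSign_eq_sign_det]
  rcases this.lt_or_gt with h | h
  · simp [Real.sign_of_neg h]
  · simp [Real.sign_of_pos h]

theorem abs_pairSign_le (x : Fin N → ℝ) : |pairSign x| ≤ 1 := by
  rw [pairSign_eq_sign_det]
  rcases Real.sign_apply_eq (Matrix.vandermonde (-x)).det with h | h | h <;> simp [h]

theorem measurable_real_sign : Measurable Real.sign :=
  Measurable.ite measurableSet_Iio measurable_const
    (Measurable.ite measurableSet_Ioi measurable_const measurable_const)

theorem measurable_pairSign : Measurable (pairSign : (Fin N → ℝ) → ℝ) := by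
  refine Finset.measurable_fun_prod _ fun i _ => Finset.measurable_fun_prod _ fun j _ => ?_
  split_ifs
  · exact measurable_real_sign.comp ((measurable_pi_apply i).sub (measurable_pi_apply j))
  · exact measurable_const

theorem memLp_top_pairSign {μ : Measure (Fin N → ℝ)} : MemLp pairSign ∞ μ :=
  memLp_top_of_bound measurable_pairSign.aestronglyMeasurable 1 (.of_forall abs_pairSign_le)

end PairSign

section Cube

variable (L : ℝ) {N : ℕ}

theorem cubeMeasure_eq_pi (N : ℕ) :
    cubeMeasure L N = Measure.pi fun _ : Fin N => lineMeasure L := by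
  rw [cubeMeasure, volume_pi, Measure.restrict_pi_pi]

theorem ae_cube_of_ae_line {p : Fin N → ℝ → Prop} (h : ∀ j, ∀ᵐ x ∂(lineMeasure L), p j x) :
    ∀ᵐ x ∂(cubeMeasure L N), ∀ j, p j (x j) := by
  rw [ae_all_iff, cubeMeasure_eq_pi]
  intro j
  exact (Measure.quasiMeasurePreserving_eval (fun _ : Fin N => lineMeasure L) j).ae (h j)

theorem ae_injective (N : ℕ) : ∀ᵐ x ∂(cubeMeasure L N), Function.Injective x := by
  have hpair (i j : Fin N) (hij : i ≠ j) : ∀ᵐ x ∂(cubeMeasure L N), x i ≠ x j := by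
    let diagonal : Submodule ℝ (Fin N → ℝ) :=
      LinearMap.ker ((LinearMap.proj i : (Fin N → ℝ) →ₗ[ℝ] ℝ) - LinearMap.proj j)
    have hproper : diagonal ≠ ⊤ := fun htop => by
      have : Pi.single i (1 : ℝ) ∈ diagonal := htop ▸ Submodule.mem_top
      simp [diagonal, hij.symm] at this
    refine ae_restrict_of_ae ?_
    filter_upwards [measure_eq_zero_iff_ae_notMem.1
      (Measure.addHaar_submodule volume diagonal hproper)] with x hx hxe
    exact hx (by simp [diagonal, hxe])
  filter_upwards [ae_all_iff.2 fun i => ae_all_iff.2 fun j => Filter.eventually_imp_distrib_left.2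
    (hpair i j)] with x hx i j hij
  exact not_ne_iff.1 fun hne => hx i j hne hij

theorem measurePreserving_comp_perm (σ : Equiv.Perm (Fin N)) :
    MeasurePreserving (fun x : Fin N → ℝ => x ∘ σ) (cubeMeasure L N) (cubeMeasure L N) := by
  have hcoe : ⇑(MeasurableEquiv.piCongrLeft (fun _ : Fin N => ℝ) σ.symm) = fun x => x ∘ σ := by
    funext x j
    obtain ⟨i, rfl⟩ := σ.symm.surjective j
    rw [MeasurableEquiv.coe_piCongrLeft, Equiv.piCongrLeft_apply_apply, Function.comp_apply,
      Equiv.apply_symm_apply]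
  rw [cubeMeasure_eq_pi, ← hcoe]
  exact measurePreserving_piCongrLeft (fun _ => lineMeasure L) σ.symm

/-- The operator `f ↦ f (x_{σ 1}, …, x_{σ N})`. -/
def permute (σ : Equiv.Perm (Fin N)) : NSpace L N →ₗᵢ[ℂ] NSpace L N :=
  Lp.compMeasurePreservingₗᵢ ℂ _ (measurePreserving_comp_perm L σ)

/-- Multiplication by the sign of the arrangement of the particles. -/
def signMul : NSpace L N →L[ℂ] NSpace L N := mulOp memLp_top_pairSign

variable {L}

theorem permute_coeFn (σ : Equiv.Perm (Fin N)) (f : NSpace L N) :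
    permute L σ f =ᵐ[cubeMeasure L N] fun x => f (x ∘ σ) :=
  Lp.coeFn_compMeasurePreserving f (measurePreserving_comp_perm L σ)

theorem isBosonic_iff_permute {f : NSpace L N} : IsBosonic f ↔ ∀ σ, permute L σ f = f := by
  refine forall_congr' fun σ => ⟨fun h => Lp.ext ?_, fun h => ?_⟩
  · exact (permute_coeFn σ f).trans h
  · have := permute_coeFn σ f
    rw [h] at this
    exact this.symm

theorem signMul_signMul (f : NSpace L N) : signMul L (signMul L f) = f :=
  mulOp_mulOp_of_sq_eq_one _ ((ae_injective L N).mono fun _ hx => pairSign_mul_self hx) f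

theorem permute_signMul (σ : Equiv.Perm (Fin N)) (f : NSpace L N) :
    permute L σ (signMul L f) = ((Equiv.Perm.sign σ : ℤ) : ℂ) • signMul L (permute L σ f) := by
  refine Lp.ext ?_
  filter_upwards [permute_coeFn σ (signMul L f), permute_coeFn σ f,
    (measurePreserving_comp_perm L σ).quasiMeasurePreserving.ae (mulOp_coeFn memLp_top_pairSign f),
    mulOp_coeFn memLp_top_pairSign (permute L σ f),
    Lp.coeFn_smul ((Equiv.Perm.sign σ : ℤ) : ℂ) (signMul L (permute L σ f))] with x h1 h2 h3 h4 h5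
  rw [h1, h5, Pi.smul_apply, signMul, h3, h4, h2, pairSign_comp, smul_eq_mul]
  push_cast
  ring

theorem IsBosonic.signMul_eq {F : NSpace L N} (hF : IsBosonic F) (σ : Equiv.Perm (Fin N)) :
    signMul L F = ((Equiv.Perm.sign σ : ℤ) : ℂ) • permute L σ (signMul L F) := by
  rw [permute_signMul, isBosonic_iff_permute.1 hF σ, smul_smul, sign_mul_self_complex, one_smul]

end Cube

section Tensor

variable {L : ℝ} {N : ℕ}

theorem memLp_prod_apply (g : Fin N → OneSpace L) :
    MemLp (fun x : Fin N → ℝ => ∏ j, g j (x j)) 2 (cubeMeasure L N) := by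
  have hm : StronglyMeasurable fun x : Fin N → ℝ => ∏ j, g j (x j) :=
    Finset.stronglyMeasurable_fun_prod _ fun j _ =>
      (Lp.stronglyMeasurable (g j)).comp_measurable (measurable_pi_apply j)
  rw [memLp_two_iff_integrable_sq_norm hm.aestronglyMeasurable, cubeMeasure_eq_pi]
  simp only [norm_prod, ← Finset.prod_pow]
  exact Integrable.fintype_prod (f := fun j x => ‖g j x‖ ^ 2) fun j =>
    (memLp_two_iff_integrable_sq_norm (Lp.aestronglyMeasurable (g j))).1 (Lp.memLp (g j))

theorem inner_toLp_prod_apply (f g : Fin N → OneSpace L) :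
    inner ℂ (memLp_prod_apply f).toLp (memLp_prod_apply g).toLp = ∏ j, inner ℂ (f j) (g j) := by
  rw [inner_eq_integral_of_ae_eq (MemLp.coeFn_toLp _) (MemLp.coeFn_toLp _)]
  simp only [map_prod, ← Finset.prod_mul_distrib]
  rw [cubeMeasure_eq_pi, integral_fintype_prod_eq_prod (fun j x => conj (f j x) * g j x)]
  exact Finset.prod_congr rfl fun j _ =>
    (inner_eq_integral_of_ae_eq (ae_eq_refl _) (ae_eq_refl _)).symm

theorem toLp_prod_apply_update {g : Fin N → OneSpace L} {i : Fin N} {h : OneSpace L} {h' : ℝ → ℂ}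
    (hh : h =ᵐ[lineMeasure L] h') :
    (memLp_prod_apply (Function.update g i h)).toLp =ᵐ[cubeMeasure L N] fun x =>
      MultilinearMap.mkPiAlgebra ℂ (Fin N) ℂ
        (Function.update (fun j => g j (x j)) i (h' (x i))) := by
  filter_upwards [MemLp.coeFn_toLp (memLp_prod_apply (Function.update g i h)),
    ae_cube_of_ae_line L fun _ => hh] with x hx hhx
  rw [hx, MultilinearMap.mkPiAlgebra_apply, ← hhx]
  exact Finset.prod_congr rfl fun j _ =>
    Function.apply_update (fun j (f : OneSpace L) => f (x j)) g i h j

theorem norm_toLp_prod_apply (g : Fin N → OneSpace L) :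
    ‖(memLp_prod_apply g).toLp _‖ = ∏ j, ‖g j‖ := by
  refine (sq_eq_sq₀ (norm_nonneg _) (by positivity)).1 (Complex.ofReal_injective ?_)
  have h := inner_toLp_prod_apply g g
  simp only [inner_self_eq_norm_sq_to_K] at h
  rw [← Finset.prod_pow]
  exact_mod_cast h

variable (L N) in
/-- The tensor product `g₁ ⊗ ⋯ ⊗ g_N`, the wave function `∏ⱼ gⱼ(xⱼ)`. -/
def tensor : ContinuousMultilinearMap ℂ (fun _ : Fin N => OneSpace L) (NSpace L N) :=
  MultilinearMap.mkContinuous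
    (MultilinearMap.mk' (fun g => (memLp_prod_apply g).toLp)
      (fun g i f h => by
        refine Lp.ext ((toLp_prod_apply_update (Lp.coeFn_add f h)).trans ?_)
        filter_upwards [Lp.coeFn_add (memLp_prod_apply (Function.update g i f)).toLp
          (memLp_prod_apply (Function.update g i h)).toLp,
          toLp_prod_apply_update (g := g) (i := i) (ae_eq_refl f),
          toLp_prod_apply_update (g := g) (i := i) (ae_eq_refl h)] with x h0 h1 h2
        rw [h0, Pi.add_apply, Pi.add_apply, h1, h2, MultilinearMap.map_update_add])
      (fun g i c f => by
        refine Lp.ext ((toLp_prod_apply_update (Lp.coeFn_smul c f)).trans ?_)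
        filter_upwards [Lp.coeFn_smul c (memLp_prod_apply (Function.update g i f)).toLp,
          toLp_prod_apply_update (g := g) (i := i) (ae_eq_refl f)] with x h0 h1
        rw [h0, Pi.smul_apply, Pi.smul_apply, h1, MultilinearMap.map_update_smul])) 1
    fun g => (norm_toLp_prod_apply g).trans_le (one_mul _).ge

theorem tensor_coeFn (g : Fin N → OneSpace L) :
    tensor L N g =ᵐ[cubeMeasure L N] fun x => ∏ j, g j (x j) :=
  MemLp.coeFn_toLp (memLp_prod_apply g)

theorem inner_tensor (f g : Fin N → OneSpace L) :
    inner ℂ (tensor L N f) (tensor L N g) = ∏ j, inner ℂ (f j) (g j) :=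
  inner_toLp_prod_apply f g

theorem permute_tensor (σ : Equiv.Perm (Fin N)) (g : Fin N → OneSpace L) :
    permute L σ (tensor L N (g ∘ σ)) = tensor L N g := by
  refine Lp.ext ?_
  filter_upwards [permute_coeFn σ (tensor L N (g ∘ σ)), tensor_coeFn g,
    (measurePreserving_comp_perm L σ).quasiMeasurePreserving.ae (tensor_coeFn (g ∘ σ))]
    with x h1 h2 h3
  rw [h1, h2, h3]
  exact Equiv.prod_comp σ fun j => g j (x j)

end Tensor

section Slater

variable (L : ℝ) {N : ℕ}

/-- The hardcore boson state with orbitals `g₁, …, g_N`: their Slater determinant, multiplied by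
the sign of the arrangement of the particles. -/
def slater : OneSpace L [⋀^Fin N]→L[ℂ] NSpace L N :=
  ((Real.sqrt (N ! : ℝ) : ℝ) : ℂ)⁻¹ • (signMul L).compContinuousAlternatingMap
    (ContinuousMultilinearMap.alternatization (tensor L N))

variable {L}

theorem slater_apply (g : Fin N → OneSpace L) :
    slater L g = ((Real.sqrt (N ! : ℝ) : ℝ) : ℂ)⁻¹ • signMul L
      (∑ σ : Equiv.Perm (Fin N), ((Equiv.Perm.sign σ : ℤ) : ℂ) • tensor L N (g ∘ σ)) := by
  simp only [Int.cast_smul_eq_zsmul, ← Units.smul_def]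
  rw [← ContinuousMultilinearMap.alternatization_apply_apply]
  rfl

theorem isBosonic_slater (g : Fin N → OneSpace L) : IsBosonic (slater L g) := by
  rw [isBosonic_iff_permute]
  intro τ
  set A := ∑ σ : Equiv.Perm (Fin N), ((Equiv.Perm.sign σ : ℤ) : ℂ) • tensor L N (g ∘ σ) with hA
  have hanti : permute L τ A = ((Equiv.Perm.sign τ : ℤ) : ℂ) • A := by
    rw [hA, map_sum, Finset.smul_sum]
    refine Fintype.sum_equiv (Equiv.mulRight τ⁻¹) _ _ fun σ => ?_
    have hcomp : g ∘ σ = (g ∘ (σ * τ⁻¹ : Equiv.Perm (Fin N))) ∘ τ := by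
      funext j
      simp
    have hsign : Equiv.Perm.sign σ = Equiv.Perm.sign τ * Equiv.Perm.sign (σ * τ⁻¹) := by
      rw [map_mul, Equiv.Perm.sign_inv, mul_left_comm, Int.units_mul_self, mul_one]
    rw [map_smul, hcomp, permute_tensor, Equiv.coe_mulRight, smul_smul, hsign]
    push_cast
    rfl
  rw [slater_apply, ← hA, map_smul, permute_signMul, hanti, map_smul, smul_smul ((_ : ℤ) : ℂ),
    sign_mul_self_complex, one_smul]

theorem sqrt_factorial_ne_zero (N : ℕ) : ((Real.sqrt (N ! : ℝ) : ℝ) : ℂ) ≠ 0 :=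
  Complex.ofReal_ne_zero.2 (Real.sqrt_pos.2 (by positivity)).ne'

theorem inner_slater_left (g : Fin N → OneSpace L) {F : NSpace L N} (hF : IsBosonic F) :
    inner ℂ (slater L g) F =
      ((Real.sqrt (N ! : ℝ) : ℝ) : ℂ) * inner ℂ (tensor L N g) (signMul L F) := by
  have hterm (σ : Equiv.Perm (Fin N)) :
      inner ℂ (((Equiv.Perm.sign σ : ℤ) : ℂ) • tensor L N (g ∘ σ)) (signMul L F) =
        inner ℂ (tensor L N g) (signMul L F) := by
    conv_rhs => rw [← permute_tensor σ g, hF.signMul_eq σ, inner_smul_right,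
      LinearIsometry.inner_map_map]
    rw [inner_smul_left, map_intCast]
  rw [slater_apply, inner_smul_left, signMul, inner_mulOp_left, ← signMul, sum_inner,
    Finset.sum_congr rfl fun σ _ => hterm σ, Finset.sum_const, Finset.card_univ, Fintype.card_perm,
    Fintype.card_fin, nsmul_eq_mul, ← mul_assoc, map_inv₀, Complex.conj_ofReal]
  congr 1
  rw [inv_mul_eq_iff_eq_mul₀ (sqrt_factorial_ne_zero N), sqrt_mul_sqrt_complex (by positivity),
    Complex.ofReal_natCast]

theorem inner_slater_slater (f g : Fin N → OneSpace L) :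
    inner ℂ (slater L f) (slater L g) = (Matrix.of fun i j => inner ℂ (f i) (g j)).det := by
  rw [inner_slater_left f (isBosonic_slater g), slater_apply, map_smul, signMul_signMul,
    inner_smul_right, ← mul_assoc, mul_inv_cancel₀ (sqrt_factorial_ne_zero N), one_mul, inner_sum,
    ← Matrix.det_transpose, Matrix.det_apply']
  refine Finset.sum_congr rfl fun σ _ => ?_
  rw [inner_smul_right, inner_tensor]
  rfl

/-- The pointwise form of `slater`. -/
def slaterFun (g : Fin N → ℝ → ℂ) (x : Fin N → ℝ) : ℂ :=
  ((Real.sqrt (N ! : ℝ) : ℝ) : ℂ)⁻¹ * ((pairSign x : ℂ) *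
    ∑ σ : Equiv.Perm (Fin N), ((Equiv.Perm.sign σ : ℤ) : ℂ) * ∏ j, g (σ j) (x j))

theorem slater_ae_eq {g : Fin N → OneSpace L} {g' : Fin N → ℝ → ℂ}
    (h : ∀ i, g i =ᵐ[lineMeasure L] g' i) : slater L g =ᵐ[cubeMeasure L N] slaterFun g' := by
  have htensor (σ : Equiv.Perm (Fin N)) :
      ⇑(((Equiv.Perm.sign σ : ℤ) : ℂ) • tensor L N (g ∘ σ)) =ᵐ[cubeMeasure L N]
        fun x => ((Equiv.Perm.sign σ : ℤ) : ℂ) * ∏ j, g' (σ j) (x j) := by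
    filter_upwards [Lp.coeFn_smul ((Equiv.Perm.sign σ : ℤ) : ℂ) (tensor L N (g ∘ σ)),
      tensor_coeFn (g ∘ σ), ae_cube_of_ae_line L fun j => h (σ j)] with x h1 h2 h3
    rw [h1, Pi.smul_apply, h2, smul_eq_mul]
    simp only [Function.comp_apply, h3]
  rw [slater_apply]
  filter_upwards [Lp.coeFn_smul ((Real.sqrt (N ! : ℝ) : ℝ) : ℂ)⁻¹ (signMul L
      (∑ σ : Equiv.Perm (Fin N), ((Equiv.Perm.sign σ : ℤ) : ℂ) • tensor L N (g ∘ σ))),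
    mulOp_coeFn memLp_top_pairSign
      (∑ σ : Equiv.Perm (Fin N), ((Equiv.Perm.sign σ : ℤ) : ℂ) • tensor L N (g ∘ σ)),
    Lp.coeFn_fun_finsetSum Finset.univ
      (fun σ : Equiv.Perm (Fin N) => ((Equiv.Perm.sign σ : ℤ) : ℂ) • tensor L N (g ∘ σ)),
    ae_all_iff.2 htensor] with x h1 h2 h3 h4
  rw [h1, Pi.smul_apply, signMul, h2, h3, smul_eq_mul, slaterFun]
  simp only [h4]

end Slater

section SlaterStates

variable {N : ℕ}

theorem bosonize_const_mul (c : ℂ) (χ : (Fin N → ℝ) → ℂ) (x : Fin N → ℝ) :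
    bosonize (fun y => c * χ y) x = c * bosonize χ x := by
  rw [bosonize, bosonize, ← Finset.mul_sum, mul_left_comm]

theorem sum_sign_mul_prod_apply (g : Fin N → ℝ → ℂ) (x : Fin N → ℝ) (σ : Equiv.Perm (Fin N)) :
    ∑ τ : Equiv.Perm (Fin N), ((Equiv.Perm.sign τ : ℤ) : ℂ) *
        (((Equiv.Perm.sign σ : ℤ) : ℂ) * ∏ j, g (σ j) (x (τ j))) =
      ∑ ρ : Equiv.Perm (Fin N), ((Equiv.Perm.sign ρ : ℤ) : ℂ) * ∏ j, g (ρ j) (x j) := by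
  refine Fintype.sum_equiv ((Equiv.inv _).trans (Equiv.mulLeft σ)) _ _ fun τ => ?_
  have hprod : ∏ j, g (σ j) (x (τ j)) = ∏ j, g ((σ * τ⁻¹) j) (x j) := by
    rw [← Equiv.prod_comp τ fun j => g ((σ * τ⁻¹) j) (x j)]
    simp
  simp only [Equiv.trans_apply, Equiv.inv_apply, Equiv.coe_mulLeft, map_mul, Equiv.Perm.sign_inv,
    hprod]
  push_cast
  ring

theorem bosonize_pairSign_mul_sum (G : Finset (Equiv.Perm (Fin N))) (g : Fin N → ℝ → ℂ)
    (x : Fin N → ℝ) :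
    bosonize (fun y => (pairSign y : ℂ) *
      ∑ σ ∈ G, ((Equiv.Perm.sign σ : ℤ) : ℂ) * ∏ j, g (σ j) (y j)) x = G.card * slaterFun g x := by
  have hterm (τ : Equiv.Perm (Fin N)) : ((pairSign (x ∘ τ) : ℝ) : ℂ) *
      ∑ σ ∈ G, ((Equiv.Perm.sign σ : ℤ) : ℂ) * ∏ j, g (σ j) ((x ∘ τ) j) =
      (pairSign x : ℂ) * ∑ σ ∈ G, ((Equiv.Perm.sign τ : ℤ) : ℂ) *
        (((Equiv.Perm.sign σ : ℤ) : ℂ) * ∏ j, g (σ j) (x (τ j))) := by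
    rw [pairSign_comp, ← Finset.mul_sum]
    push_cast [Function.comp_apply]
    ring
  simp only [bosonize, hterm]
  rw [← Finset.mul_sum, Finset.sum_comm]
  simp only [sum_sign_mul_prod_apply, Finset.sum_const, nsmul_eq_mul, slaterFun]
  ring

theorem exp_I_mul_sum (x p : Fin N → ℝ) :
    Complex.exp (Complex.I * ∑ j, (x j : ℂ) * (p j : ℂ)) =
      ∏ j, Complex.exp (Complex.I * ((x j : ℂ) * (p j : ℂ))) := by
  rw [Finset.mul_sum, Complex.exp_sum]

theorem prod_waveFun {c d p x : Fin N → ℝ} {ℓ : ℝ} (hℓ : ∀ j, d j - c j = ℓ)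
    (hx : ∀ j, x j ∈ Set.Ioo (c j) (d j)) :
    ∏ j, waveFun (c j) (d j) (p j) (x j) = (((Real.sqrt ℓ : ℝ) : ℂ) ^ N)⁻¹ *
      Complex.exp (Complex.I * ∑ j, (x j : ℂ) * (p j : ℂ)) := by
  simp only [waveFun, Set.indicator_of_mem (hx _), hℓ, exp_I_mul_sum, Finset.prod_mul_distrib,
    Finset.prod_const, Finset.card_univ, Fintype.card_fin, inv_pow]

theorem ofReal_pairSign (x : Fin N → ℝ) : ((pairSign x : ℝ) : ℂ) =
    ∏ i, ∏ j, if i < j then ((Real.sign (x i - x j) : ℝ) : ℂ) else 1 := by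
  simp only [pairSign, Complex.ofReal_prod, apply_ite Complex.ofReal, Complex.ofReal_one]

theorem eigenChi_eq {L : ℝ} (k : Fin N → ℤ) {x : Fin N → ℝ} (hx : ∀ j, x j ∈ Set.Ioo 0 L) :
    eigenChi L k x = ((N ! : ℕ) : ℂ)⁻¹ * ((pairSign x : ℂ) *
      ∑ σ ∈ (Finset.univ : Finset (Equiv.Perm (Fin N))), ((Equiv.Perm.sign σ : ℤ) : ℂ) *
        ∏ j, waveFun 0 L (ringMomentum L (k (σ j))) (x j)) := by
  have hwave (σ : Equiv.Perm (Fin N)) :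
      ∏ j, waveFun 0 L (ringMomentum L (k (σ j))) (x j) = (((Real.sqrt L : ℝ) : ℂ) ^ N)⁻¹ *
        Complex.exp (Complex.I * ∑ j, (x j : ℂ) * (ringMomentum L (k (σ j)) : ℂ)) :=
    prod_waveFun (fun _ => sub_zero L) hx
  simp only [hwave, mul_left_comm _ (((Real.sqrt L : ℝ) : ℂ) ^ N)⁻¹, ← Finset.mul_sum]
  rw [eigenChi, ofReal_pairSign, mul_inv]
  ring

theorem bosonize_eigenChi {L : ℝ} (k : Fin N → ℤ) {x : Fin N → ℝ} (hx : ∀ j, x j ∈ Set.Ioo 0 L) :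
    bosonize (eigenChi L k) x = slaterFun (fun i => waveFun 0 L (ringMomentum L (k i))) x := by
  have hχ (τ : Equiv.Perm (Fin N)) := eigenChi_eq k (x := x ∘ τ) fun j => hx (τ j)
  have hfactor : bosonize (eigenChi L k) x = ((N ! : ℕ) : ℂ)⁻¹ * bosonize (fun y =>
      (pairSign y : ℂ) * ∑ σ ∈ (Finset.univ : Finset (Equiv.Perm (Fin N))),
        ((Equiv.Perm.sign σ : ℤ) : ℂ) *
          ∏ j, waveFun 0 L (ringMomentum L (k (σ j))) (y j)) x := by
    rw [← bosonize_const_mul]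
    simp only [bosonize, hχ]
  have hfactorial : ((N ! : ℕ) : ℂ) ≠ 0 := Nat.cast_ne_zero.2 (Nat.factorial_ne_zero N)
  rw [hfactor, bosonize_pairSign_mul_sum _ fun i => waveFun 0 L (ringMomentum L (k i)),
    Finset.card_univ, Fintype.card_perm, Fintype.card_fin, inv_mul_cancel_left₀ hfactorial]

theorem eigenState_eq_slater (L : ℝ) (k : Fin N → ℤ) :
    eigenState L k = slater L fun i => ringVec L (k i) := by
  refine Lp.ext ?_
  filter_upwards [MemLp.coeFn_toLp (memLp_eigen L k),
    slater_ae_eq fun i => waveVec_coeFn L 0 L (ringMomentum L (k i)),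
    ae_restrict_mem (MeasurableSet.univ_pi fun _ : Fin N => measurableSet_Ioo)] with x h1 h2 hx
  rw [eigenState, h1, bosonize_eigenChi k fun j => hx j (Set.mem_univ j)]
  exact h2.symm

end SlaterStates

section BoxSign

variable {n N : ℕ}

/-- The sign `∏_{i < j, b_i ≠ b_j} sgn (b_i - b_j)` of a list of boxes. It relates a wavelet state,
which carries signs only for pairs of particles in the same box, to a Slater determinant. -/
def boxSign (b : Fin N → Fin n) : ℝ :=
  ∏ i, ∏ j, if i < j ∧ b i ≠ b j then Real.sign ((b i : ℕ) - (b j : ℕ) : ℝ) else 1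

theorem real_sign_mul_self {r : ℝ} (hr : r ≠ 0) : Real.sign r * Real.sign r = 1 := by
  rcases hr.lt_or_gt with h | h
  · simp [Real.sign_of_neg h]
  · simp [Real.sign_of_pos h]

theorem boxSign_mul_self (b : Fin N → Fin n) : boxSign b * boxSign b = 1 := by
  simp only [boxSign, ← Finset.prod_mul_distrib]
  refine Finset.prod_eq_one fun i _ => Finset.prod_eq_one fun j _ => ?_
  split_ifs with h
  · exact real_sign_mul_self (sub_ne_zero.2 fun e => h.2 (Fin.ext (by exact_mod_cast e)))
  · exact one_mul 1

theorem boxSign_const (c : Fin n) : boxSign (fun _ : Fin N => c) = 1 := by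
  simp [boxSign]

theorem sign_sub_of_mem_boxSet {L : ℝ} (hL : 0 < L) {b c : Fin n} (hbc : b ≠ c) {x y : ℝ}
    (hx : x ∈ boxSet L b) (hy : y ∈ boxSet L c) :
    Real.sign (x - y) = Real.sign ((b : ℕ) - (c : ℕ) : ℝ) := by
  rcases lt_or_gt_of_ne hbc with h | h
  · have h' : ((b : ℕ) : ℝ) < (c : ℕ) := by exact_mod_cast h
    rw [Real.sign_of_neg (sub_neg.2 (lt_of_mem_boxSet hL h hx hy)), Real.sign_of_neg (sub_neg.2 h')]
  · have h' : ((c : ℕ) : ℝ) < (b : ℕ) := by exact_mod_cast h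
    rw [Real.sign_of_pos (sub_pos.2 (lt_of_mem_boxSet hL h hy hx)), Real.sign_of_pos (sub_pos.2 h')]

open scoped Classical in
theorem prod_sign_same_box {L : ℝ} (hL : 0 < L) {b : Fin N → Fin n} {x : Fin N → ℝ}
    (hx : ∀ j, x j ∈ boxSet L (b j)) :
    (∏ i, ∏ j, if i < j ∧ b i = b j then Real.sign (x i - x j) else 1) =
      boxSign b * pairSign x := by
  have hsplit : pairSign x = boxSign b *
      ∏ i, ∏ j, if i < j ∧ b i = b j then Real.sign (x i - x j) else 1 := by
    simp only [pairSign, boxSign, ← Finset.prod_mul_distrib]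
    refine Finset.prod_congr rfl fun i _ => Finset.prod_congr rfl fun j _ => ?_
    by_cases hij : i < j
    · by_cases hb : b i = b j
      · simp [hij, hb]
      · simp [hij, hb, sign_sub_of_mem_boxSet hL hb (hx i) (hx j)]
    · simp [hij]
  rw [hsplit, ← mul_assoc, boxSign_mul_self, one_mul]

end BoxSign

section WaveletState

open scoped Classical in
/-- The permutations that preserve the boxes of the labels `a`, the group `∏_b 𝔖_{N_b}`. -/
def boxPerms {n N : ℕ} (a : Fin N → Wavelet n) : Finset (Equiv.Perm (Fin N)) :=
  Finset.univ.filter fun σ => ∀ j, (a (σ j)).box = (a j).box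

variable {L : ℝ} {n N : ℕ}

open scoped Classical in
theorem card_boxPerms (a : Fin N → Wavelet n) : ((boxPerms a).card : ℂ) =
    ∏ b : Fin n, ((Finset.univ.filter fun j => (a j).box = b).card ! : ℂ) := by
  have hstab := DomMulAct.stabilizer_card fun j => (a j).box
  simp only [Fintype.card_subtype] at hstab
  rw [← Nat.cast_prod, ← hstab, boxPerms]
  congr 2
  ext σ
  simp [funext_iff]

/-- The wavelet `√(n/L) e^{iax}` on its box, as a function. -/
def boxFun (L : ℝ) (a : Wavelet n) : ℝ → ℂ :=
  waveFun ((a.box : ℝ) * L / n) (((a.box : ℝ) + 1) * L / n) (a.momentum L)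

theorem prod_boxFun_of_mem {a : Fin N → Wavelet n} {x : Fin N → ℝ}
    (hx : ∀ j, x j ∈ boxSet L (a j).box) {σ : Equiv.Perm (Fin N)} (hσ : σ ∈ boxPerms a) :
    ∏ j, boxFun L (a (σ j)) (x j) = ((Real.sqrt ((n : ℝ) / L) : ℝ) : ℂ) ^ N *
      Complex.exp (Complex.I * ∑ j, (x j : ℂ) * ((a (σ j)).momentum L : ℂ)) := by
  have hlength (j : Fin N) : (((a (σ j)).box : ℝ) + 1) * L / n - ((a (σ j)).box : ℝ) * L / n =
      L / n := by ring
  have hmem (j : Fin N) : x j ∈ boxSet L (a (σ j)).box := by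
    rw [(Finset.mem_filter.1 hσ).2 j]
    exact hx j
  have hwave := prod_waveFun (p := fun j => (a (σ j)).momentum L) hlength hmem
  rw [← inv_pow, ← Complex.ofReal_inv, ← Real.sqrt_inv, inv_div] at hwave
  exact hwave

theorem prod_boxFun_of_notMem {a : Fin N → Wavelet n} {x : Fin N → ℝ} {i : Fin N}
    (hx : x i ∉ boxSet L (a i).box) {σ : Equiv.Perm (Fin N)} (hσ : σ ∈ boxPerms a) :
    ∏ j, boxFun L (a (σ j)) (x j) = 0 := by
  have hnotMem : x i ∉ boxSet L (a (σ i)).box := by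
    rwa [(Finset.mem_filter.1 hσ).2 i]
  refine Finset.prod_eq_zero (Finset.mem_univ i) ?_
  rw [boxFun, waveFun]
  exact Set.indicator_of_notMem hnotMem _

open scoped Classical in
theorem prod_indicator_boxSet (a : Fin N → Wavelet n) (x : Fin N → ℝ) :
    ∏ j, (boxSet L (a j).box).indicator (fun _ => (1 : ℂ)) (x j) =
      if ∀ j, x j ∈ boxSet L (a j).box then 1 else 0 := by
  simp only [Set.indicator_apply]
  exact Finset.prod_ite_zero.trans (by simp)

theorem waveletChi_eq (hL : 0 < L) (a : Fin N → Wavelet n) (x : Fin N → ℝ) :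
    waveletChi L a x = (boxSign fun j => (a j).box) * ((boxPerms a).card : ℂ)⁻¹ *
      ((pairSign x : ℂ) * ∑ σ ∈ boxPerms a,
        ((Equiv.Perm.sign σ : ℤ) : ℂ) * ∏ j, boxFun L (a (σ j)) (x j)) := by
  rw [waveletChi, ← card_boxPerms, ← boxPerms, prod_indicator_boxSet]
  split_ifs with hx
  · have hsign := congrArg Complex.ofReal (prod_sign_same_box hL hx)
    simp only [Complex.ofReal_prod, apply_ite Complex.ofReal, Complex.ofReal_one,
      Complex.ofReal_mul] at hsign
    have hsum : ∑ σ ∈ boxPerms a, ((Equiv.Perm.sign σ : ℤ) : ℂ) * ∏ j, boxFun L (a (σ j)) (x j) =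
        ((Real.sqrt ((n : ℝ) / L) : ℝ) : ℂ) ^ N * ∑ σ ∈ boxPerms a, ((Equiv.Perm.sign σ : ℤ) : ℂ) *
          Complex.exp (Complex.I * ∑ j, (x j : ℂ) * ((a (σ j)).momentum L : ℂ)) := by
      rw [Finset.mul_sum]
      refine Finset.sum_congr rfl fun σ hσ => ?_
      rw [prod_boxFun_of_mem hx hσ, mul_left_comm]
    rw [hsum, hsign]
    ring
  · obtain ⟨i, hi⟩ := not_forall.1 hx
    rw [mul_zero, Finset.sum_eq_zero fun σ hσ => by rw [prod_boxFun_of_notMem hi hσ, mul_zero],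
      mul_zero, mul_zero]

theorem bosonize_waveletChi (hL : 0 < L) (a : Fin N → Wavelet n) (x : Fin N → ℝ) :
    bosonize (waveletChi L a) x =
      (boxSign fun j => (a j).box) * slaterFun (fun i => boxFun L (a i)) x := by
  have hcard : ((boxPerms a).card : ℂ) ≠ 0 := by
    rw [card_boxPerms]
    exact Finset.prod_ne_zero_iff.2 fun b _ => Nat.cast_ne_zero.2 (Nat.factorial_ne_zero _)
  rw [funext (waveletChi_eq hL a), bosonize_const_mul,
    bosonize_pairSign_mul_sum _ fun i => boxFun L (a i), mul_assoc, inv_mul_cancel_left₀ hcard]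

theorem waveletState_eq_slater (hL : 0 < L) (a : Fin N → Wavelet n) :
    waveletState L a =
      ((boxSign fun j => (a j).box : ℝ) : ℂ) • slater L fun i => boxVec L (a i) := by
  refine Lp.ext ?_
  filter_upwards [MemLp.coeFn_toLp (memLp_wavelet L a),
    slater_ae_eq fun i => waveVec_coeFn L _ _ ((a i).momentum L),
    Lp.coeFn_smul ((boxSign fun j => (a j).box : ℝ) : ℂ) (slater L fun i => boxVec L (a i))]
    with x h1 h2 h3
  rw [waveletState, h1, h3, bosonize_waveletChi hL, Pi.smul_apply, smul_eq_mul]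
  exact congrArg _ h2.symm

end WaveletState

/-! ### The hardcore eigenstates as a basis of the bosonic states -/

section Completeness

variable {L : ℝ} {N : ℕ}

theorem multilinear_eq_zero_of_hilbertBasis {ι : Type*} {H G : Type*} [NormedAddCommGroup H]
    [InnerProductSpace ℂ H] [NormedAddCommGroup G] [NormedSpace ℂ G] (e : HilbertBasis ι ℂ H)
    (Φ : ContinuousMultilinearMap ℂ (fun _ : Fin N => H) G) (h : ∀ k : Fin N → ι, Φ (e ∘ k) = 0)
    (g : Fin N → H) : Φ g = 0 := by
  have hpartial (s : Finset (Fin N)) : ∀ g : Fin N → H, (∀ j ∉ s, g j ∈ Set.range e) → Φ g = 0 := by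
    induction s using Finset.induction_on with
    | empty =>
      intro g hg
      choose k hk using fun j => hg j (Finset.notMem_empty j)
      rw [← funext hk]
      exact h k
    | insert i s _ ih =>
      intro g hg
      have hbasis : Set.EqOn (Φ.toContinuousLinearMap g i) 0 (Set.range e) := by
        rintro _ ⟨m, rfl⟩
        refine ih _ fun j hj => ?_
        obtain rfl | hji := eq_or_ne j i
        · exact ⟨m, (Function.update_self j (e m) g).symm⟩
        · rw [Function.update_of_ne hji]
          exact hg j (by simp [hji, hj])
      have hzero : Φ.toContinuousLinearMap g i = 0 := ContinuousLinearMap.ext_on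
        (Submodule.dense_iff_topologicalClosure_eq_top.2 e.dense_span) hbasis
      simpa using DFunLike.congr_fun hzero (g i)
  exact hpartial Finset.univ g fun j hj => absurd (Finset.mem_univ j) hj

theorem setIntegral_pi_eq_zero_of_inner_tensor {F : NSpace L N}
    (h : ∀ g : Fin N → OneSpace L, inner ℂ (tensor L N g) F = 0) {A : Fin N → Set ℝ}
    (hA : ∀ j, MeasurableSet (A j)) : ∫ x in Set.univ.pi A, F x ∂(cubeMeasure L N) = 0 := by
  have hprod : tensor L N (fun j => indicatorConstLp 2 (hA j) (measure_ne_top _ _) (1 : ℂ))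
      =ᵐ[cubeMeasure L N] (Set.univ.pi A).indicator 1 := by
    filter_upwards [tensor_coeFn fun j => indicatorConstLp 2 (hA j) (measure_ne_top _ _) (1 : ℂ),
      ae_cube_of_ae_line L fun j => indicatorConstLp_coeFn (p := 2) (hs := hA j)
        (hμs := measure_ne_top (lineMeasure L) _) (c := (1 : ℂ))] with x h1 h2
    classical
    simp only [h1, h2, Set.indicator_apply, Finset.prod_ite_zero, Set.mem_univ_pi]
    simp
  have hinner := h fun j => indicatorConstLp 2 (hA j) (measure_ne_top _ _) (1 : ℂ)
  rw [inner_eq_integral_of_ae_eq hprod (ae_eq_refl _)] at hinner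
  rw [← hinner, ← integral_indicator (MeasurableSet.univ_pi hA)]
  refine integral_congr_ae (.of_forall fun x => ?_)
  by_cases hx : x ∈ Set.univ.pi A <;> simp [hx]

theorem eq_zero_of_inner_tensor {F : NSpace L N}
    (h : ∀ g : Fin N → OneSpace L, inner ℂ (tensor L N g) F = 0) : F = 0 := by
  have : IsFiniteMeasure (cubeMeasure L N) := by
    rw [cubeMeasure_eq_pi]
    infer_instance
  have hint : Integrable F (cubeMeasure L N) := (Lp.memLp F).integrable one_le_two
  have hzero (s : Set (Fin N → ℝ)) (hs : MeasurableSet s) :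
      ∫ x in s, F x ∂(cubeMeasure L N) = 0 := by
    refine MeasurableSpace.induction_on_inter (C := fun s _ => ∫ x in s, F x ∂(cubeMeasure L N) = 0)
      generateFrom_pi.symm isPiSystem_pi (by simp) ?_ ?_ ?_ s hs
    · rintro _ ⟨A, hA, rfl⟩
      exact setIntegral_pi_eq_zero_of_inner_tensor h fun j => hA j trivial
    · intro s hs hs0
      have huniv := setIntegral_pi_eq_zero_of_inner_tensor h fun _ => MeasurableSet.univ
      rw [Set.pi_univ, setIntegral_univ, ← integral_add_compl hs hint, hs0, zero_add] at huniv
      exact huniv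
    · intro f hd hm hf0
      simp [integral_iUnion hm hd hint.integrableOn, hf0]
  exact (Lp.eq_zero_iff_ae_eq_zero).2
    (hint.ae_eq_zero_of_forall_setIntegral_eq_zero fun s hs _ => hzero s hs)

theorem eq_zero_of_inner_slater {ι : Type*} (e : HilbertBasis ι ℂ (OneSpace L)) {F : NSpace L N}
    (hF : IsBosonic F) (h : ∀ k : Fin N → ι, inner ℂ (slater L (e ∘ k)) F = 0) : F = 0 := by
  have hsign : signMul L F = 0 := by
    refine eq_zero_of_inner_tensor fun g => ?_
    rw [← inner_conj_symm, map_eq_zero]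
    refine multilinear_eq_zero_of_hilbertBasis e
      ((innerSL ℂ (signMul L F)).compContinuousMultilinearMap (tensor L N)) (fun k => ?_) g
    have hk := h k
    rw [inner_slater_left _ hF] at hk
    rw [ContinuousLinearMap.compContinuousMultilinearMap_coe, Function.comp_apply,
      innerSL_apply_apply, ← inner_conj_symm,
      (mul_eq_zero.1 hk).resolve_left (sqrt_factorial_ne_zero N), map_zero]
  rw [← signMul_signMul F, hsign, map_zero]

theorem eq_zero_of_inner_eigenState (hL : 0 < L) {F : NSpace L N} (hF : IsBosonic F)
    (h : ∀ k : Fin N → ℤ, StrictMono k → inner ℂ (eigenState L k) F = 0) : F = 0 := by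
  refine eq_zero_of_inner_slater (ringBasis hL) hF fun k => ?_
  by_cases hk : Function.Injective k
  · have hsorted := h (k ∘ Tuple.sort k)
      ((Tuple.monotone_sort k).strictMono_of_injective (hk.comp (Tuple.sort k).injective))
    have hperm : eigenState L (k ∘ Tuple.sort k) =
        ((Equiv.Perm.sign (Tuple.sort k) : ℤ) : ℂ) • slater L (ringBasis hL ∘ k) := by
      rw [eigenState_eq_slater, Int.cast_smul_eq_zsmul, ← Units.smul_def]
      have hmap := (slater L).toAlternatingMap.map_perm (ringBasis hL ∘ k) (Tuple.sort k)
      simpa only [Function.comp_def, ringBasis_apply, ContinuousAlternatingMap.coe_toAlternatingMap]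
        using hmap
    rw [hperm, inner_smul_left, map_intCast] at hsorted
    exact (mul_eq_zero.1 hsorted).resolve_left
      (left_ne_zero_of_mul_eq_one (sign_mul_self_complex _))
  · have hrep : ¬ Function.Injective (ringBasis hL ∘ k) := fun hinj => hk hinj.of_comp
    rw [(slater L).map_eq_zero_of_not_injective _ hrep, inner_zero_left]

end Completeness

section Orthonormal

variable {N : ℕ} {ι H : Type*} [NormedAddCommGroup H] [InnerProductSpace ℂ H] {e : ι → H}

theorem det_inner_of_injective (he : Orthonormal ℂ e) {a : Fin N → ι} (ha : Function.Injective a) :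
    (Matrix.of fun i j => inner ℂ (e (a i)) (e (a j))).det = 1 := by
  classical
  refine (congrArg Matrix.det (Matrix.ext fun i j => ?_)).trans Matrix.det_one
  rw [Matrix.of_apply, orthonormal_iff_ite.1 he, Matrix.one_apply]
  simp only [ha.eq_iff]

theorem det_inner_of_notMem_range (he : Orthonormal ℂ e) {a c : Fin N → ι} {i : Fin N}
    (hi : a i ∉ Set.range c) : (Matrix.of fun i j => inner ℂ (e (a i)) (e (c j))).det = 0 :=
  Matrix.det_eq_zero_of_row_eq_zero i fun j => he.2 fun h => hi ⟨j, h.symm⟩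

theorem exists_notMem_range_of_ne [LinearOrder ι] {a c : Fin N → ι} (ha : StrictMono a)
    (hc : StrictMono c) (h : a ≠ c) : ∃ i, a i ∉ Set.range c := by
  by_contra! hall
  have hcard : (Set.range c).ncard ≤ (Set.range a).ncard := by
    rw [← Set.image_univ, ← Set.image_univ, Set.ncard_image_of_injective _ ha.injective,
      Set.ncard_image_of_injective _ hc.injective]
  exact h ((StrictMono.range_inj ha hc).1
    (Set.eq_of_subset_of_ncard_le (Set.range_subset_iff.2 hall) hcard))

end Orthonormal

section BosonicBasis

variable (L : ℝ) (N : ℕ)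

/-- The Hilbert space of symmetric wave functions. -/
def bosonic : Submodule ℂ (NSpace L N) :=
  ⨅ σ, LinearMap.eqLocus (permute L σ).toLinearMap (LinearMap.id (M := NSpace L N))

variable {L N}

theorem mem_bosonic {F : NSpace L N} : F ∈ bosonic L N ↔ IsBosonic F := by
  simp [bosonic, isBosonic_iff_permute]

instance : CompleteSpace (bosonic L N) := by
  have hclosed : IsClosed (bosonic L N : Set (NSpace L N)) := by
    rw [bosonic, Submodule.coe_iInf]
    exact isClosed_iInter fun σ => isClosed_eq (permute L σ).continuous continuous_id
  exact hclosed.completeSpace_coe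

theorem eigenState_mem_bosonic (k : Fin N → ℤ) : eigenState L k ∈ bosonic L N :=
  mem_bosonic.2 (eigenState_eq_slater L k ▸ isBosonic_slater _)

theorem orthonormal_eigenState (hL : 0 < L) : Orthonormal ℂ
    fun k : {k : Fin N → ℤ // StrictMono k} => (⟨_, eigenState_mem_bosonic k.1⟩ : bosonic L N) := by
  classical
  rw [orthonormal_iff_ite]
  intro k l
  simp only [Submodule.coe_inner, eigenState_eq_slater, inner_slater_slater]
  split_ifs with h
  · exact h ▸ det_inner_of_injective (orthonormal_ringVec hL) k.2.injective
  · obtain ⟨i, hi⟩ := exists_notMem_range_of_ne k.2 l.2 fun e => h (Subtype.ext e)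
    exact det_inner_of_notMem_range (orthonormal_ringVec hL) hi

/-- The eigenstates `|λ⟩` of the hardcore boson Hamiltonian, as a basis of the symmetric wave
functions. -/
def eigenBasis (hL : 0 < L) : HilbertBasis {k : Fin N → ℤ // StrictMono k} ℂ (bosonic L N) :=
  .mkOfOrthogonalEqBot (orthonormal_eigenState hL) <| (Submodule.eq_bot_iff _).2 fun F hF =>
    Subtype.ext <| eq_zero_of_inner_eigenState hL (mem_bosonic.1 F.2) fun k hk =>
      hF _ (Submodule.subset_span ⟨⟨k, hk⟩, rfl⟩)

theorem coe_eigenBasis (hL : 0 < L) (k : {k : Fin N → ℤ // StrictMono k}) :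
    (eigenBasis hL k : NSpace L N) = eigenState L k.1 := by
  rw [eigenBasis, HilbertBasis.coe_mkOfOrthogonalEqBot]

end BosonicBasis

/-! ### The evolution of a Slater determinant -/

section ManyBodyPotential

variable (L : ℝ) {n N : ℕ}

/-- The number of particles in box `b`, the operator `∫_{box b} φ†(x) φ(x) dx`. -/
def boxNumber (b : Fin n) : NSpace L N →L[ℂ] NSpace L N :=
  ∑ j, mulOp (memLp_top_boxIndicator_comp L b (measurable_pi_apply j))

theorem boxNumber_apply (b : Fin n) (F : NSpace L N) :
    boxNumber L b F = ∑ j, mulOp (memLp_top_boxIndicator_comp L b (measurable_pi_apply j)) F := by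
  rw [boxNumber, _root_.sum_apply]

theorem mulOp_boxIndicator_tensor (b : Fin n) (j : Fin N) (g : Fin N → OneSpace L) :
    mulOp (memLp_top_boxIndicator_comp L b (measurable_pi_apply j)) (tensor L N g) =
      tensor L N (Function.update g j (boxProj L b (g j))) := by
  refine Lp.ext ?_
  filter_upwards [mulOp_coeFn (memLp_top_boxIndicator_comp L b (measurable_pi_apply j))
      (tensor L N g), tensor_coeFn g, tensor_coeFn (Function.update g j (boxProj L b (g j))),
    ae_cube_of_ae_line L fun _ => mulOp_coeFn (memLp_top_boxIndicator_comp L b measurable_id) (g j)]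
    with x h1 h2 h3 h4
  have hfactor (i : Fin N) : (Function.update g j (boxProj L b (g j)) i) (x i) =
      (if i = j then (boxIndicator L b (x j) : ℂ) else 1) * g i (x i) := by
    obtain rfl | hij := eq_or_ne i j
    · rw [Function.update_self, if_pos rfl]
      exact h4 i
    · rw [Function.update_of_ne hij, if_neg hij, one_mul]
  simp only [h1, h2, h3, hfactor, Finset.prod_mul_distrib, Finset.prod_ite_eq', Finset.mem_univ,
    if_true]

theorem boxNumber_slater (b : Fin n) (g : Fin N → OneSpace L) :
    boxNumber L b (slater L g) =
      ∑ i, slater L (Function.update g i (boxProj L b (g i))) := by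
  have hterm (σ : Equiv.Perm (Fin N)) (j : Fin N) :
      mulOp (memLp_top_boxIndicator_comp L b (measurable_pi_apply j)) (tensor L N (g ∘ σ)) =
        tensor L N (Function.update g (σ j) (boxProj L b (g (σ j))) ∘ σ) := by
    rw [mulOp_boxIndicator_tensor, Function.update_comp_eq_of_injective _ σ.injective,
      Function.comp_apply]
  simp only [boxNumber_apply, slater_apply, map_smul, signMul, mulOp_comm _ memLp_top_pairSign,
    map_sum, hterm, ← Finset.smul_sum]
  congr 1
  rw [Finset.sum_comm]
  refine Finset.sum_congr rfl fun σ _ => ?_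
  rw [← Finset.smul_sum, Equiv.sum_comp σ fun i => mulOp memLp_top_pairSign
    (tensor L N (Function.update g i (boxProj L b (g i)) ∘ σ))]

variable (v : Fin n → ℝ → ℝ) (s : ℝ)

theorem potOp_boxNumber_coeFn (F : NSpace L N) :
    potOp (boxNumber L) v s F =ᵐ[cubeMeasure L N] fun x => (potential L v s x : ℂ) * F x := by
  have hbox (b : Fin n) : boxNumber L b F =ᵐ[cubeMeasure L N]
      fun x => ∑ j, (boxIndicator L b (x j) : ℂ) * F x := by
    rw [boxNumber_apply]
    filter_upwards [Lp.coeFn_fun_finsetSum Finset.univ fun j : Fin N =>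
        mulOp (memLp_top_boxIndicator_comp L b (measurable_pi_apply j)) F,
      ae_all_iff.2 fun j : Fin N =>
        mulOp_coeFn (memLp_top_boxIndicator_comp L b (measurable_pi_apply j)) F] with x h1 h2
    simp only [h1, h2]
  rw [potOp_apply]
  filter_upwards [Lp.coeFn_fun_finsetSum Finset.univ fun b => (v b s : ℂ) • boxNumber L b F,
    ae_all_iff.2 fun b => Lp.coeFn_smul (v b s : ℂ) (boxNumber L b F), ae_all_iff.2 hbox]
    with x h1 h2 h3
  simp only [h1, h2, h3, Pi.smul_apply, smul_eq_mul, Finset.mul_sum, potential, boxIndicator,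
    Complex.ofReal_sum, Finset.sum_mul]
  rw [Finset.sum_comm]
  refine Finset.sum_congr rfl fun j _ => Finset.sum_congr rfl fun b _ => ?_
  by_cases hx : x j ∈ boxSet L b <;> simp [hx]

theorem potentialElement_eq_inner (k : Fin N → ℤ) (F : NSpace L N) :
    potentialElement L v s k F = inner ℂ (eigenState L k) (potOp (boxNumber L) v s F) := by
  have heigen : eigenState L k =ᵐ[cubeMeasure L N] bosonize (eigenChi L k) := MemLp.coeFn_toLp _
  rw [inner_eq_integral_of_ae_eq heigen (potOp_boxNumber_coeFn L v s F), potentialElement]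
  simp only [mul_assoc]

theorem potOp_slater (g : Fin N → OneSpace L) :
    potOp (boxNumber L) v s (slater L g) =
      ∑ i, slater L (Function.update g i (potOp (boxProj L) v s (g i))) := by
  have hterm (i : Fin N) : slater L (Function.update g i (potOp (boxProj L) v s (g i))) =
      ∑ b, (v b s : ℂ) • slater L (Function.update g i (boxProj L b (g i))) := by
    rw [potOp_apply]
    refine ((slater L).map_update_sum ..).trans (Finset.sum_congr rfl fun b _ => ?_)
    exact (slater L).map_update_smul ..
  simp only [potOp_apply (boxNumber L), boxNumber_slater, hterm, Finset.smul_sum]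
  exact Finset.sum_comm

end ManyBodyPotential

section Uniqueness

variable {L : ℝ} {n N : ℕ}

variable (L N) in
/-- The number of particles in box `b`, compressed to the symmetric wave functions. -/
def bosonicNumber (b : Fin n) : bosonic L N →L[ℂ] bosonic L N :=
  (bosonic L N).orthogonalProjectionOnto ∘L boxNumber L b ∘L (bosonic L N).subtypeL

theorem inner_potOp_bosonicNumber (v : Fin n → ℝ → ℝ) (s : ℝ) (F G : bosonic L N) :
    inner ℂ F (potOp (bosonicNumber L N) v s G) =
      inner ℂ (F : NSpace L N) (potOp (boxNumber L) v s (G : NSpace L N)) := by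
  simp only [potOp_apply, inner_sum, inner_smul_right, bosonicNumber]
  refine Finset.sum_congr rfl fun b _ => congrArg _ ?_
  exact Submodule.inner_orthogonalProjectionOnto_eq_of_mem_left F _

variable {v : Fin n → ℝ → ℝ} {α : Fin N → Wavelet n} (hL : 0 < L)

/-- The evolution `e^{-itH₀}` of hardcore bosons. -/
abbrev hardcoreProp (t : ℝ) : bosonic L N ≃ₗᵢ[ℂ] bosonic L N :=
  phaseGroup (eigenBasis hL) (fun k => energy L k.1) t

theorem isOrbit_of_isEvolution (hv : ∀ b, LocallyIntegrable (v b)) {F : ℝ → bosonic L N}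
    (h : IsEvolution L v α fun t => F t) :
    IsOrbit (eigenBasis hL) (fun k => energy L k.1) (bosonicNumber L N) v
      fun t => hardcoreProp hL (-t) (F t) := by
  have hF : Continuous F := Topology.IsInducing.subtypeVal.continuous_iff.2 h.continuous
  refine isOrbit_of_inner_hilbertBasis (eigenBasis hL) hv
    (continuous_phaseGroup _ _ hF continuous_neg) fun t k => ?_
  have hphase (s : ℝ) : inner ℂ (eigenBasis hL k) (hardcoreProp hL (-s) (F s)) =
      Complex.exp (-Complex.I * (-s : ℝ) * energy L k.1) * inner ℂ (eigenState L k.1) (F s) := by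
    rw [inner_basis_phaseGroup, Submodule.coe_inner, coe_eigenBasis]
  have hV (s : ℝ) : inner ℂ (eigenBasis hL k) (interactionOp (eigenBasis hL)
      (fun k => energy L k.1) (bosonicNumber L N) v s (hardcoreProp hL (-s) (F s))) =
      Complex.exp (-Complex.I * (-t : ℝ) * energy L k.1) *
        (Complex.exp (-Complex.I * (t - s) * energy L k.1) * potentialElement L v s k.1 (F s)) := by
    rw [interactionOp_apply, inner_basis_phaseGroup, phaseGroup_phaseGroup_neg,
      inner_potOp_bosonicNumber, coe_eigenBasis, ← potentialElement_eq_inner, ← mul_assoc,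
      ← Complex.exp_add]
    push_cast
    ring_nf
  simp only [hV, hphase, h.duhamel k.1 k.2 t, intervalIntegral.integral_const_mul]
  simp only [neg_zero, Complex.ofReal_zero, mul_zero, zero_mul, Complex.exp_zero]
  linear_combination inner ℂ (eigenState L k.1) (F 0 : NSpace L N) *
    exp_phase_mul_neg t (energy L k.1)

include hL in
theorem IsEvolution.unique (hv : ∀ b, LocallyIntegrable (v b)) {Ψ Φ : ℝ → NSpace L N}
    (hΨ : IsEvolution L v α Ψ) (hΦ : IsEvolution L v α Φ) : Ψ = Φ := by
  lift Ψ to ℝ → HardcoreWavelet.bosonic L N using fun t => mem_bosonic.2 (hΨ.bosonic t)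
  lift Φ to ℝ → HardcoreWavelet.bosonic L N using fun t => mem_bosonic.2 (hΦ.bosonic t)
  have h := (isOrbit_of_isEvolution hL hv hΨ).unique hv (isOrbit_of_isEvolution hL hv hΦ)
    (by simp only [Subtype.ext (hΨ.initial.trans hΦ.initial.symm)])
  funext t
  exact congrArg Subtype.val ((hardcoreProp hL (-t)).injective (congrFun h t))

end Uniqueness

section Existence

variable {L : ℝ} (hL : 0 < L) {n N : ℕ} {v : Fin n → ℝ → ℝ}

theorem inner_eigenState_slater_freeProp (k : Fin N → ℤ) (t : ℝ) (g : Fin N → OneSpace L) :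
    inner ℂ (eigenState L k) (slater L fun q => freeProp hL t (g q)) =
      Complex.exp (-Complex.I * t * energy L k) * inner ℂ (eigenState L k) (slater L g) := by
  have hexp : Complex.exp (-Complex.I * t * energy L k) =
      ∏ i, Complex.exp (-Complex.I * t * (ringMomentum L (k i) ^ 2 : ℝ)) := by
    rw [← Complex.exp_sum, ← Finset.mul_sum, energy, Complex.ofReal_sum]
  rw [eigenState_eq_slater, inner_slater_slater, inner_slater_slater, hexp,
    ← Matrix.det_mul_column]
  refine congrArg Matrix.det (Matrix.ext fun i q => ?_)
  rw [Matrix.of_apply, Matrix.of_apply, Matrix.of_apply, ← ringBasis_apply hL,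
    inner_basis_phaseGroup]

/-- The evolution of the wavelet state: every particle evolves on its own. -/
def evolved (hv : ∀ b, LocallyIntegrable (v b)) (α : Fin N → Wavelet n) (t : ℝ) : NSpace L N :=
  ((boxSign fun j => (α j).box : ℝ) : ℂ) • slater L fun q => freeProp hL t (orbit hL hv (α q) t)

theorem isPrimitive_slater_orbit (hv : ∀ b, LocallyIntegrable (v b)) (α : Fin N → Wavelet n) :
    IsPrimitive (fun t => slater L fun q => orbit hL hv (α q) t) fun t =>
      -Complex.I • ∑ i, slater L (Function.update (fun q => orbit hL hv (α q) t) i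
        (intOp hL v t (orbit hL hv (α i) t))) := by
  have hsmul (t : ℝ) (i : Fin N) :
      -Complex.I • slater L (Function.update (fun q => orbit hL hv (α q) t) i
        (intOp hL v t (orbit hL hv (α i) t))) =
      slater L (Function.update (fun q => orbit hL hv (α q) t) i
        (-Complex.I • intOp hL v t (orbit hL hv (α i) t))) :=
    ((slater L).map_update_smul ..).symm
  simp only [Finset.smul_sum, hsmul]
  exact IsPrimitive.multilinear
    ((slater L (N := N)).toContinuousMultilinearMap.restrictScalars ℝ)
    fun q => isOrbit_orbit hL hv (α q)

theorem potentialElement_slater_freeProp (k : Fin N → ℤ) (s : ℝ) (g : Fin N → OneSpace L) :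
    potentialElement L v s k (slater L fun q => freeProp hL s (g q)) =
      Complex.exp (-Complex.I * s * energy L k) *
        ∑ i, inner ℂ (eigenState L k) (slater L (Function.update g i (intOp hL v s (g i)))) := by
  have hupdate (i : Fin N) : Function.update (fun q => freeProp hL s (g q)) i
      (potOp (boxProj L) v s (freeProp hL s (g i))) =
      fun q => freeProp hL s (Function.update g i (intOp hL v s (g i)) q) := by
    rw [← phaseGroup_interactionOp]
    exact (Function.comp_update ..).symm
  simp only [potentialElement_eq_inner, potOp_slater, inner_sum, hupdate,
    inner_eigenState_slater_freeProp, Finset.mul_sum]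

theorem inner_eigenState_evolved (hv : ∀ b, LocallyIntegrable (v b)) (α : Fin N → Wavelet n)
    (k : Fin N → ℤ) (t : ℝ) :
    inner ℂ (eigenState L k) (evolved hL hv α t) =
      (boxSign fun j => (α j).box : ℝ) * (Complex.exp (-Complex.I * t * energy L k) *
        inner ℂ (eigenState L k) (slater L fun q => orbit hL hv (α q) t)) := by
  rw [evolved, inner_smul_right, inner_eigenState_slater_freeProp]

theorem potentialElement_evolved (hv : ∀ b, LocallyIntegrable (v b)) (α : Fin N → Wavelet n)
    (k : Fin N → ℤ) (s : ℝ) :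
    potentialElement L v s k (evolved hL hv α s) =
      (boxSign fun j => (α j).box : ℝ) * (Complex.exp (-Complex.I * s * energy L k) *
        ∑ i, inner ℂ (eigenState L k) (slater L (Function.update (fun q => orbit hL hv (α q) s) i
          (intOp hL v s (orbit hL hv (α i) s))))) := by
  rw [← potentialElement_slater_freeProp, potentialElement_eq_inner, potentialElement_eq_inner,
    evolved, map_smul, inner_smul_right]

theorem isEvolution_evolved (hv : ∀ b, LocallyIntegrable (v b)) (α : Fin N → Wavelet n) :
    IsEvolution L v α (evolved hL hv α) := by
  have hslater : Continuous fun t => slater L fun q => freeProp hL t (orbit hL hv (α q) t) :=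
    (slater L).cont.comp <| continuous_pi fun q =>
      continuous_phaseGroup _ _ (isOrbit_orbit hL hv (α q)).continuous continuous_id
  have hprim (k : Fin N → ℤ) := (isPrimitive_slater_orbit hL hv α).clm
    ((innerSL ℂ (eigenState L k)).restrictScalars ℝ)
  simp only [ContinuousLinearMap.coe_restrictScalars', innerSL_apply_apply, inner_smul_right,
    inner_sum] at hprim
  refine ⟨hslater.const_smul ((boxSign fun j => (α j).box : ℝ) : ℂ), fun t => ?_, ?_,
    fun k _ t => ?_, fun k _ t => ?_⟩
  · exact mem_bosonic.1 ((bosonic L N).smul_mem _ (mem_bosonic.2 (isBosonic_slater _)))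
  · simp only [evolved, phaseGroup_zero, orbit_zero, waveletState_eq_slater hL]
  · simp only [potentialElement_evolved]
    have h := (((hprim k).intervalIntegrable 0 t).const_mul Complex.I)
    simp only [← mul_assoc, mul_neg, Complex.I_mul_I, neg_neg, one_mul] at h
    exact (h.continuousOn_mul (by fun_prop)).const_mul _
  · have hphase (s : ℝ) (z : ℂ) : Complex.exp (-Complex.I * (t - s) * energy L k) *
        ((boxSign fun j => (α j).box : ℝ) * (Complex.exp (-Complex.I * s * energy L k) * z)) =
        (boxSign fun j => (α j).box : ℝ) * Complex.exp (-Complex.I * t * energy L k) * z := by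
      rw [mul_left_comm, ← mul_assoc (Complex.exp _), ← Complex.exp_add, mul_assoc]
      ring_nf
    simp only [inner_eigenState_evolved, potentialElement_evolved, hphase,
      (hprim k).eq_add_integral t, intervalIntegral.integral_const_mul]
    simp only [Complex.ofReal_zero, mul_zero, zero_mul, Complex.exp_zero]
    ring

include hL in
theorem existsUnique_evolution (hv : ∀ b, LocallyIntegrable (v b)) (α : Fin N → Wavelet n) :
    ∃! Ψ : ℝ → NSpace L N, IsEvolution L v α Ψ :=
  ⟨_, isEvolution_evolved hL hv α, fun _ h => h.unique hL hv (isEvolution_evolved hL hv α)⟩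

end Existence

/-! ### Summing a product of two determinants over common rows -/

section CommonRows

open scoped Matrix

variable {μ ν κ ι : Type*}

theorem eq_sumCongr_of_comp_inl [Finite μ] [Finite ν] {σ : Equiv.Perm (μ ⊕ ν)}
    (h : σ ∘ Sum.inl = Sum.inl) : ∃ ρ : Equiv.Perm ν, Equiv.Perm.sumCongr 1 ρ = σ := by
  obtain ⟨⟨ρ₁, ρ₂⟩, rfl⟩ := Equiv.Perm.mem_sumCongrHom_range_of_perm_mapsTo_inl
    (σ := σ) (by rintro _ ⟨i, rfl⟩; exact ⟨i, (congrFun h i).symm⟩)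
  have hρ₁ : ρ₁ = 1 := Equiv.ext fun i => Sum.inl_injective (congrFun h i)
  exact ⟨ρ₂, by rw [hρ₁]; rfl⟩

variable [Fintype μ] [DecidableEq μ]

theorem det_submatrix_eq_zero_of_not_injective (A : Matrix ι μ ℂ) {z : μ → ι}
    (hz : ¬ Function.Injective z) : (A.submatrix z id).det = 0 := by
  obtain ⟨i, j, hij, hne⟩ := Function.not_injective_iff.1 hz
  exact Matrix.det_zero_of_row_eq hne (funext fun k => congrArg (A · k) hij)

theorem sum_det_eq_det_mul_conjTranspose [Fintype κ] (B C : Matrix μ κ ℂ) :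
    ∑ q : μ → κ, (Matrix.of fun i j => B i (q i) * star (C i (q j))).det = (B * Cᴴ).det := by
  have hexpand (q : μ → κ) : (Matrix.of fun i j => B i (q i) * star (C i (q j))).det =
      ∑ σ : Equiv.Perm μ, ((Equiv.Perm.sign σ : ℤ) : ℂ) *
        ∏ i, B i (q i) * star (C (σ i) (q i)) := by
    simp only [Matrix.det_apply', Matrix.of_apply, Finset.prod_mul_distrib]
    exact Finset.sum_congr rfl fun σ _ => by rw [Equiv.prod_comp σ fun i => B i (q i)]
  simp_rw [hexpand]
  rw [Finset.sum_comm, ← Matrix.det_transpose, Matrix.det_apply']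
  refine Finset.sum_congr rfl fun σ _ => ?_
  simp only [← Finset.mul_sum, Matrix.transpose_apply, Matrix.mul_apply,
    Matrix.conjTranspose_apply, Finset.prod_univ_sum, Fintype.piFinset_univ]

variable [Fintype ν] [DecidableEq ν]

theorem card_perm_comp_inl {q : μ → μ ⊕ ν} (hq : Function.Injective q) :
    (Finset.univ.filter fun σ : Equiv.Perm (μ ⊕ ν) => σ ∘ Sum.inl = q).card =
      (Fintype.card ν)! := by
  obtain ⟨σ₀, hσ₀⟩ := Equiv.Perm.exists_extending_pair Sum.inl q Sum.inl_injective hq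
  have himage : (Finset.univ.filter fun σ : Equiv.Perm (μ ⊕ ν) => σ ∘ Sum.inl = q) =
      Finset.univ.image fun ρ : Equiv.Perm ν => σ₀ * Equiv.Perm.sumCongr 1 ρ := by
    ext σ
    simp only [Finset.mem_filter, Finset.mem_univ, true_and, Finset.mem_image]
    refine ⟨fun h => ?_, ?_⟩
    · obtain ⟨ρ, hρ⟩ := eq_sumCongr_of_comp_inl (σ := σ₀⁻¹ * σ) <| funext fun i => by
        rw [Function.comp_apply, Equiv.Perm.mul_apply, Equiv.Perm.inv_eq_iff_eq, hσ₀]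
        exact congrFun h i
      exact ⟨ρ, by rw [hρ, mul_inv_cancel_left]⟩
    · rintro ⟨ρ, rfl⟩
      exact funext fun i => hσ₀ i
  rw [himage, Finset.card_image_of_injective, Finset.card_univ, Fintype.card_perm]
  intro ρ ρ' h
  ext k
  exact Sum.inr_injective (congrArg (· (Sum.inr k)) (mul_left_cancel h))

theorem sum_perm_comp_inl {F : (μ → μ ⊕ ν) → ℂ} (hF : ∀ q, ¬ Function.Injective q → F q = 0) :
    ∑ σ : Equiv.Perm (μ ⊕ ν), F (σ ∘ Sum.inl) = (Fintype.card ν)! * ∑ q, F q := by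
  rw [← Finset.sum_fiberwise' Finset.univ
    (fun σ : Equiv.Perm (μ ⊕ ν) => (σ ∘ Sum.inl : μ → μ ⊕ ν)) F, Finset.mul_sum]
  refine Finset.sum_congr rfl fun q _ => ?_
  rw [Finset.sum_const, nsmul_eq_mul]
  by_cases hq : Function.Injective q
  · rw [card_perm_comp_inl hq]
  · rw [hF q hq, mul_zero, mul_zero]

theorem det_fromRows_one_submatrix (B : Matrix μ (μ ⊕ ν) ℂ) (σ : Equiv.Perm (μ ⊕ ν)) :
    (Matrix.fromRows B ((1 : Matrix (μ ⊕ ν) (μ ⊕ ν) ℂ).submatrix (σ ∘ Sum.inr) id)).det =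
      (Equiv.Perm.sign σ : ℤ) * (B.submatrix id (σ ∘ Sum.inl)).det := by
  have hblocks : (Matrix.fromRows B
      ((1 : Matrix (μ ⊕ ν) (μ ⊕ ν) ℂ).submatrix (σ ∘ Sum.inr) id)).submatrix id σ =
      Matrix.fromBlocks (B.submatrix id (σ ∘ Sum.inl)) (B.submatrix id (σ ∘ Sum.inr)) 0 1 := by
    ext (i | k) (j | l) <;> simp [Matrix.one_apply]
  have hdet := Matrix.det_permute' σ
    (Matrix.fromRows B ((1 : Matrix (μ ⊕ ν) (μ ⊕ ν) ℂ).submatrix (σ ∘ Sum.inr) id))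
  rw [hblocks, Matrix.det_fromBlocks_zero₂₁, Matrix.det_one, mul_one] at hdet
  rw [hdet, ← mul_assoc, sign_mul_self_complex, one_mul]

variable {K : ℕ}

omit [Fintype μ] [DecidableEq μ] in
theorem hasSum_pi_prod {f : Fin K → ι → ℂ} {s : Fin K → ℂ} (h : ∀ k, HasSum (f k) (s k)) :
    HasSum (fun r : Fin K → ι => ∏ k, f k (r k)) (∏ k, s k) := by
  induction K with
  | zero => simp
  | succ K ih =>
    have htail := ih fun k => h k.succ
    have hsummable := summable_mul_of_summable_norm (h 0).summable.norm htail.summable.norm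
    have hprod := (h 0).mul htail hsummable
    rw [Fin.prod_univ_succ, ← (Fin.consEquiv fun _ => ι).hasSum_iff]
    exact hprod.congr_fun fun p => by simp [Fin.prod_univ_succ, Fin.consEquiv]

theorem hasSum_det_fromRows (B : Matrix μ (μ ⊕ Fin K) ℂ) {f : Fin K → ι → μ ⊕ Fin K → ℂ}
    {s : Matrix (Fin K) (μ ⊕ Fin K) ℂ} (h : ∀ k q, HasSum (fun a => f k a q) (s k q)) :
    HasSum (fun r : Fin K → ι => (Matrix.fromRows B (Matrix.of fun k => f k (r k))).det)
      (Matrix.fromRows B s).det := by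
  have hexpand (T : Matrix (Fin K) (μ ⊕ Fin K) ℂ) : (Matrix.fromRows B T).det =
      ∑ τ : Equiv.Perm (μ ⊕ Fin K), ((Equiv.Perm.sign τ : ℤ) : ℂ) *
        (∏ i, B i (τ (Sum.inl i))) * ∏ k, T k (τ (Sum.inr k)) := by
    simp only [← Matrix.det_transpose (Matrix.fromRows B T), Matrix.det_apply',
      Matrix.transpose_apply, Fintype.prod_sum_type, Matrix.fromRows_apply_inl,
      Matrix.fromRows_apply_inr, mul_assoc]
  simp only [hexpand, Matrix.of_apply]
  exact hasSum_sum fun τ _ => (hasSum_pi_prod fun k => h k _).mul_left _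

theorem det_submatrix_mul_star_det (A : Matrix ι (μ ⊕ ν) ℂ) (x y : μ → ι) (r : ν → ι) :
    (A.submatrix (Sum.elim x r) id).det * star (A.submatrix (Sum.elim y r) id).det =
      ∑ σ : Equiv.Perm (μ ⊕ ν), (Equiv.Perm.sign σ : ℤ) * (∏ i, A (x i) (σ (Sum.inl i))) *
        (Matrix.fromRows ((A.submatrix y id).map star) (Matrix.of fun k q =>
          A (r k) (σ (Sum.inr k)) * star (A (r k) q))).det := by
  have hscale (c : ν → ℂ) :
      (Matrix.fromRows ((A.submatrix y id).map star) (Matrix.of fun k q =>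
        c k * star (A (r k) q))).det = (∏ k, c k) * star (A.submatrix (Sum.elim y r) id).det := by
    rw [← Matrix.det_conjTranspose, ← Matrix.det_transpose (Matrix.conjTranspose _)]
    have hdet := Matrix.det_mul_column (Sum.elim 1 c)
      ((A.submatrix (Sum.elim y r) id).map star)
    simp only [Fintype.prod_sum_type, Sum.elim_inl, Sum.elim_inr, Pi.one_apply,
      Finset.prod_const_one, one_mul] at hdet
    refine Eq.trans (congrArg _ ?_) hdet
    ext (i | k) q <;> simp
  simp only [hscale]
  rw [← Matrix.det_transpose (A.submatrix (Sum.elim x r) id), Matrix.det_apply', Finset.sum_mul]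
  simp only [Matrix.transpose_apply, Matrix.submatrix_apply, Fintype.prod_sum_type, Sum.elim_inl,
    Sum.elim_inr, id, mul_assoc]

theorem sum_perm_mul_det_submatrix (B C : Matrix μ (μ ⊕ ν) ℂ) :
    ∑ σ : Equiv.Perm (μ ⊕ ν), (∏ i, B i (σ (Sum.inl i))) *
      ((C.map star).submatrix id (σ ∘ Sum.inl)).det = (Fintype.card ν)! * (B * Cᴴ).det := by
  have hcol (q : μ → μ ⊕ ν) : (∏ i, B i (q i)) * ((C.map star).submatrix id q).det =
      (Matrix.of fun i j => B i (q i) * star (C i (q j))).det :=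
    (Matrix.det_mul_column _ _).symm
  rw [← sum_det_eq_det_mul_conjTranspose, ← sum_perm_comp_inl]
  · exact Finset.sum_congr rfl fun σ _ => hcol (σ ∘ Sum.inl)
  · intro q hq
    rw [← hcol, ← Matrix.det_transpose, Matrix.transpose_submatrix,
      det_submatrix_eq_zero_of_not_injective _ hq, mul_zero]

theorem hasSum_det_mul_star_det {A : Matrix ι (μ ⊕ Fin K) ℂ}
    (hA : ∀ p q, HasSum (fun a => A a p * star (A a q)) ((1 : Matrix _ _ ℂ) p q)) (x y : μ → ι) :
    HasSum (fun r : Fin K → ι => (A.submatrix (Sum.elim x r) id).det *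
        star (A.submatrix (Sum.elim y r) id).det)
      (K ! * (A.submatrix x id * (A.submatrix y id)ᴴ).det) := by
  have hsum (σ : Equiv.Perm (μ ⊕ Fin K)) := (hasSum_det_fromRows ((A.submatrix y id).map star)
    fun k q => hA (σ (Sum.inr k)) q).mul_left
      ((Equiv.Perm.sign σ : ℤ) * ∏ i, A (x i) (σ (Sum.inl i)))
  have hvalue : (K ! : ℂ) * (A.submatrix x id * (A.submatrix y id)ᴴ).det =
      ∑ σ : Equiv.Perm (μ ⊕ Fin K), (Equiv.Perm.sign σ : ℤ) * (∏ i, A (x i) (σ (Sum.inl i))) *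
        (Matrix.fromRows ((A.submatrix y id).map star)
          ((1 : Matrix _ _ ℂ).submatrix (σ ∘ Sum.inr) id)).det := by
    have hperm := sum_perm_mul_det_submatrix (ν := Fin K) (A.submatrix x id) (A.submatrix y id)
    rw [Fintype.card_fin] at hperm
    rw [← hperm]
    refine Finset.sum_congr rfl fun σ _ => ?_
    rw [det_fromRows_one_submatrix, mul_mul_mul_comm, sign_mul_self_complex, one_mul]
    rfl
  simp only [det_submatrix_mul_star_det, hvalue]
  exact hasSum_sum fun σ _ => hsum σ

end CommonRows

section Tuples

open scoped Matrix

variable {ι : Type*} {M K : ℕ}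

theorem det_submatrix_append (A : Matrix ι (Fin (M + K)) ℂ) (x : Fin M → ι) (r : Fin K → ι) :
    (A.submatrix (Fin.append x r) id).det =
      ((A.submatrix id finSumFinEquiv).submatrix (Sum.elim x r) id).det := by
  rw [← Matrix.det_submatrix_equiv_self finSumFinEquiv]
  congr 1
  ext (i | i) j <;> simp

theorem det_submatrix_sumElim_comp_perm {μ : Type*} [Fintype μ] [DecidableEq μ]
    (A : Matrix ι (μ ⊕ Fin K) ℂ) (z : μ → ι) (r : Fin K → ι) (σ : Equiv.Perm (Fin K)) :
    (A.submatrix (Sum.elim z (r ∘ σ)) id).det =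
      (Equiv.Perm.sign σ : ℤ) * (A.submatrix (Sum.elim z r) id).det := by
  have hperm := Matrix.det_permute (Equiv.Perm.sumCongr 1 σ) (A.submatrix (Sum.elim z r) id)
  rw [Equiv.Perm.sign_sumCongr, Equiv.Perm.sign_one, one_mul] at hperm
  rw [← hperm]
  congr 1
  ext (i | i) j <;> simp

variable [LinearOrder ι]

theorem injective_orderEmbOfFin_comp_perm : Function.Injective
    fun p : {R : Finset ι // R.card = K} × Equiv.Perm (Fin K) =>
      (p.1.1.orderEmbOfFin p.1.2 ∘ p.2 : Fin K → ι) := by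
  rintro ⟨⟨R, hR⟩, σ⟩ ⟨⟨R', hR'⟩, σ'⟩ h
  obtain rfl : R = R' := by simpa [Set.range_comp] using congrArg Set.range h
  exact Prod.ext rfl (Equiv.ext fun i => (R.orderEmbOfFin hR).injective (congrFun h i))

theorem exists_orderEmbOfFin_comp_perm_eq {r : Fin K → ι} (hr : Function.Injective r) :
    ∃ p : {R : Finset ι // R.card = K} × Equiv.Perm (Fin K),
      p.1.1.orderEmbOfFin p.1.2 ∘ p.2 = r := by
  have hcard : (Finset.univ.image r).card = K := by
    rw [Finset.card_image_of_injective _ hr, Finset.card_univ, Fintype.card_fin]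
  have hsort : r ∘ Tuple.sort r = (Finset.univ.image r).orderEmbOfFin hcard :=
    Finset.orderEmbOfFin_unique hcard (fun i => Finset.mem_image_of_mem r (Finset.mem_univ _))
      ((Tuple.monotone_sort r).strictMono_of_injective (hr.comp (Tuple.sort r).injective))
  refine ⟨(⟨_, hcard⟩, (Tuple.sort r)⁻¹), funext fun i => ?_⟩
  simp [← hsort]

theorem hasSum_orderEmbOfFin {g : (Fin K → ι) → ℂ} {S : ℂ} (h : HasSum g (K ! * S))
    (hsymm : ∀ r (σ : Equiv.Perm (Fin K)), g (r ∘ σ) = g r)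
    (hzero : ∀ r, ¬ Function.Injective r → g r = 0) :
    HasSum (fun R : {R : Finset ι // R.card = K} => g (R.1.orderEmbOfFin R.2)) S := by
  have hpairs := (injective_orderEmbOfFin_comp_perm.hasSum_iff fun r hr =>
    hzero r fun hinj => hr (exists_orderEmbOfFin_comp_perm_eq hinj)).2 h
  have hfiber : HasSum (fun R : {R : Finset ι // R.card = K} =>
      (K ! : ℂ) * g (R.1.orderEmbOfFin R.2)) (K ! * S) := by
    refine hpairs.prod_fiberwise fun R => ?_
    simp only [Function.comp_def]
    have hconst := hasSum_fintype fun _ : Equiv.Perm (Fin K) => g (R.1.orderEmbOfFin R.2)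
    rw [Finset.sum_const, nsmul_eq_mul, Finset.card_univ, Fintype.card_perm,
      Fintype.card_fin] at hconst
    exact hconst.congr_fun fun σ => hsymm _ σ
  exact (hasSum_mul_left_iff (Nat.cast_ne_zero.2 (Nat.factorial_ne_zero K))).1 hfiber

theorem hasSum_finset_det_mul_star_det {A : Matrix ι (Fin (M + K)) ℂ}
    (hA : ∀ p q, HasSum (fun a => A a p * star (A a q)) ((1 : Matrix _ _ ℂ) p q))
    (x y : Fin M → ι) :
    HasSum (fun R : {R : Finset ι // R.card = K} =>
        (A.submatrix (Fin.append x (R.1.orderEmbOfFin R.2)) id).det *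
          star (A.submatrix (Fin.append y (R.1.orderEmbOfFin R.2)) id).det)
      (A.submatrix x id * (A.submatrix y id)ᴴ).det := by
  have hcols (p q : Fin M ⊕ Fin K) : HasSum (fun a => A.submatrix id finSumFinEquiv a p *
      star (A.submatrix id finSumFinEquiv a q)) ((1 : Matrix _ _ ℂ) p q) := by
    simpa [Matrix.one_apply] using hA (finSumFinEquiv p) (finSumFinEquiv q)
  have htuples := hasSum_det_mul_star_det hcols x y
  have hreindex : (A.submatrix id finSumFinEquiv).submatrix x id *
      ((A.submatrix id finSumFinEquiv).submatrix y id)ᴴ =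
      A.submatrix x id * (A.submatrix y id)ᴴ := by
    ext i j
    exact Equiv.sum_comp finSumFinEquiv fun q => A (x i) q * star (A (y j) q)
  rw [hreindex] at htuples
  simp only [det_submatrix_append]
  refine hasSum_orderEmbOfFin htuples (fun r σ => ?_) fun r hr => ?_
  · rw [det_submatrix_sumElim_comp_perm, det_submatrix_sumElim_comp_perm, star_mul',
      mul_mul_mul_comm, star_intCast, sign_mul_self_complex, one_mul]
  · rw [det_submatrix_eq_zero_of_not_injective, zero_mul]
    exact fun hinj => hr (hinj.comp Sum.inr_injective)

end Tuples

/-! ### Overlaps with a Slater determinant -/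

section Overlaps

open scoped Matrix

variable {L : ℝ} {n N M K : ℕ}

theorem inner_ket_single (a : Fin N → Wavelet n) (f : NSpace L N) :
    inner ℂ (ket L a) (lp.single 2 N f) = inner ℂ (waveletState L a) f := by
  rw [ket, lp.inner_single_left, lp.single_apply_self]

theorem inner_ket_single_of_ne (h : M ≠ N) (a : Fin M → Wavelet n) (f : NSpace L N) :
    inner ℂ (ket L a) (lp.single 2 N f) = 0 := by
  rw [ket, lp.inner_single_left, lp.single_apply_ne _ _ _ h, inner_zero_right]

theorem inner_ketFirst_single {X R : Finset (Wavelet n)} (hX : X.card = M) (hR : R.card = K)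
    (f : NSpace L (M + K)) : inner ℂ (ketFirst L X R) (lp.single 2 (M + K) f) =
      inner ℂ (waveletState L (Fin.append (X.orderEmbOfFin hX) (R.orderEmbOfFin hR))) f := by
  subst hX hR
  exact inner_ket_single _ _

/-- The amplitudes `⟨a|g_q⟩` of the orbitals `g` in the one-particle wavelet basis. -/
def amplitude (g : Fin N → OneSpace L) : Matrix (Wavelet n) (Fin N) ℂ :=
  Matrix.of fun a q => inner ℂ (boxVec L a) (g q)

theorem hasSum_amplitude_mul_star (hL : 0 < L) (hn : 0 < n) {g : Fin N → OneSpace L}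
    (hg : Orthonormal ℂ g) (p q : Fin N) :
    HasSum (fun a : Wavelet n => amplitude g a p * star (amplitude g a q))
      ((1 : Matrix _ _ ℂ) p q) := by
  have hparseval := (boxBasis hL hn).hasSum_inner_mul_inner (g q) (g p)
  rw [orthonormal_iff_ite.1 hg] at hparseval
  simp_rw [eq_comm (a := q)] at hparseval
  refine hparseval.congr_fun fun a => ?_
  rw [boxBasis_apply, mul_comm, amplitude, Matrix.of_apply, Matrix.of_apply, ← starRingEnd_apply,
    inner_conj_symm]

theorem inner_waveletState_smul_slater (hL : 0 < L) (a : Fin N → Wavelet n) (c : ℂ)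
    (g : Fin N → OneSpace L) : inner ℂ (waveletState L a) (c • slater L g) =
      (boxSign fun j => (a j).box : ℝ) * c * ((amplitude g).submatrix a id).det := by
  rw [waveletState_eq_slater hL, inner_smul_left, inner_smul_right, inner_slater_slater,
    Complex.conj_ofReal, mul_assoc]
  rfl

/-- The contribution `⟨X ∪ R|Ψ⟩⟨Ψ|Y ∪ R⟩` of the common rest `R` to the cumulative reduced density
matrix. In contrast to `cumulTerm`, it is defined also if `R` meets `X` or `Y`. -/
def commonTerm (Ψ : Fock L) (X Y R : Finset (Wavelet n)) : ℂ :=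
  inner ℂ (ketFirst L X R) Ψ * inner ℂ Ψ (ketFirst L Y R)

variable {X Y R : Finset (Wavelet n)}

theorem cumulTerm_eq_commonTerm (Ψ : Fock L) (p : Completion X Y) :
    cumulTerm Ψ X Y p = commonTerm Ψ X Y (p.1.1 \ X) := by
  rw [cumulTerm, commonTerm, p.2.2.2]

theorem commonTerm_single_eq_zero (h : X.card + R.card ≠ N ∨ Y.card + R.card ≠ N)
    (f : NSpace L N) : commonTerm (lp.single 2 N f) X Y R = 0 := by
  rcases h with h | h
  · exact mul_eq_zero_of_left (inner_ket_single_of_ne h _ _) _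
  · exact mul_eq_zero_of_right _ (inner_eq_zero_symm.1 (inner_ket_single_of_ne h _ _))

theorem cumulTerm_single_eq_zero (h : X.card ≠ Y.card ∨ N < X.card) (f : NSpace L N)
    (p : Completion X Y) : cumulTerm (lp.single 2 N f) X Y p = 0 := by
  rw [cumulTerm_eq_commonTerm]
  exact commonTerm_single_eq_zero (by omega) f

theorem injective_completion_sdiff :
    Function.Injective fun p : Completion X Y => p.1.1 \ X := by
  intro p p' h
  have hX : p.1.1 \ X = p'.1.1 \ X := h
  have hY : p.1.2 \ Y = p'.1.2 \ Y := by rw [← p.2.2.2, ← p'.2.2.2, hX]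
  refine Subtype.ext (Prod.ext ?_ ?_)
  · rw [← Finset.sdiff_union_of_subset p.2.1, hX, Finset.sdiff_union_of_subset p'.2.1]
  · rw [← Finset.sdiff_union_of_subset p.2.2.1, hY, Finset.sdiff_union_of_subset p'.2.2.1]

theorem exists_completion_sdiff_eq (hX : Disjoint R X) (hY : Disjoint R Y) :
    ∃ p : Completion X Y, p.1.1 \ X = R :=
  ⟨⟨(R ∪ X, R ∪ Y), Finset.subset_union_right, Finset.subset_union_right,
    (Finset.union_sdiff_cancel_right hX).trans (Finset.union_sdiff_cancel_right hY).symm⟩,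
    Finset.union_sdiff_cancel_right hX⟩

theorem not_injective_append_orderEmbOfFin (hX : X.card = M) (hR : R.card = K)
    (h : ¬ Disjoint R X) :
    ¬ Function.Injective (Fin.append (X.orderEmbOfFin hX) (R.orderEmbOfFin hR)) := by
  obtain ⟨a, haR, haX⟩ := Finset.not_disjoint_iff.1 h
  rw [← Finset.mem_coe, ← Finset.range_orderEmbOfFin _ hR] at haR
  rw [← Finset.mem_coe, ← Finset.range_orderEmbOfFin _ hX] at haX
  obtain ⟨⟨k, hk⟩, i, hi⟩ := haR, haX
  intro hinj
  have hik := @hinj (Fin.castAdd K i) (Fin.natAdd M k) (by simp [hk, hi])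
  have := congrArg Fin.val hik
  simp at this
  omega

section Slater

variable {b : Fin n} {c : ℂ}

theorem commonTerm_slater (hL : 0 < L) (hXb : ∀ a ∈ X, a.box = b) (hYb : ∀ a ∈ Y, a.box = b)
    (hX : X.card = M) (hY : Y.card = M) (hR : R.card = K) (hc : c * star c = 1)
    (g : Fin (M + K) → OneSpace L) :
    commonTerm (lp.single 2 (M + K) (c • slater L g)) X Y R =
      ((amplitude g).submatrix (Fin.append (X.orderEmbOfFin hX) (R.orderEmbOfFin hR)) id).det *
      star ((amplitude g).submatrix
        (Fin.append (Y.orderEmbOfFin hY) (R.orderEmbOfFin hR)) id).det := by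
  have hbox : (fun j => (Fin.append (X.orderEmbOfFin hX) (R.orderEmbOfFin hR) j).box) =
      fun j => (Fin.append (Y.orderEmbOfFin hY) (R.orderEmbOfFin hR) j).box := by
    refine funext (Fin.addCases (fun i => ?_) fun i => ?_)
    · rw [Fin.append_left, Fin.append_left, hXb _ (Finset.orderEmbOfFin_mem _ _ _),
        hYb _ (Finset.orderEmbOfFin_mem _ _ _)]
    · rw [Fin.append_right, Fin.append_right]
  rw [commonTerm, ← inner_conj_symm (lp.single 2 (M + K) _), inner_ketFirst_single hX hR,
    inner_ketFirst_single hY hR, inner_waveletState_smul_slater hL,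
    inner_waveletState_smul_slater hL, hbox, map_mul, map_mul, Complex.conj_ofReal,
    mul_mul_mul_comm, mul_mul_mul_comm _ c, ← Complex.ofReal_mul, boxSign_mul_self]
  simp only [starRingEnd_apply, hc, Complex.ofReal_one, one_mul]

theorem hasSum_cumulTerm_slater (hL : 0 < L) (hn : 0 < n) (hXb : ∀ a ∈ X, a.box = b)
    (hYb : ∀ a ∈ Y, a.box = b) (hX : X.card = M) (hY : Y.card = M) (hc : c * star c = 1)
    {g : Fin (M + K) → OneSpace L} (hg : Orthonormal ℂ g) :
    HasSum (cumulTerm (lp.single 2 (M + K) (c • slater L g)) X Y)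
      ((amplitude g).submatrix (X.orderEmbOfFin hX) id *
        ((amplitude g).submatrix (Y.orderEmbOfFin hY) id)ᴴ).det := by
  set Ψ : Fock L := lp.single 2 (M + K) (c • slater L g)
  have hfixed : HasSum (fun R : {R : Finset (Wavelet n) // R.card = K} => commonTerm Ψ X Y R.1)
      ((amplitude g).submatrix (X.orderEmbOfFin hX) id *
        ((amplitude g).submatrix (Y.orderEmbOfFin hY) id)ᴴ).det :=
    (hasSum_finset_det_mul_star_det (hasSum_amplitude_mul_star hL hn hg) _ _).congr_fun
      fun R => commonTerm_slater hL hXb hYb hX hY R.2 hc g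
  have hall : HasSum (commonTerm Ψ X Y) _ := (Subtype.val_injective.hasSum_iff fun R hR =>
    commonTerm_single_eq_zero (.inl fun h => hR ⟨⟨R, by omega⟩, rfl⟩) _).1 hfixed
  rw [funext (cumulTerm_eq_commonTerm Ψ)]
  refine (injective_completion_sdiff.hasSum_iff fun R hR => ?_).2 hall
  by_cases hK : R.card = K
  · rw [commonTerm_slater hL hXb hYb hX hY hK hc]
    by_cases hRX : Disjoint R X
    · have hRY : ¬ Disjoint R Y := fun hRY => hR (exists_completion_sdiff_eq hRX hRY)
      rw [det_submatrix_eq_zero_of_not_injective _ (not_injective_append_orderEmbOfFin hY hK hRY),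
        star_zero, mul_zero]
    · rw [det_submatrix_eq_zero_of_not_injective _ (not_injective_append_orderEmbOfFin hX hK hRX),
        zero_mul]
  · exact commonTerm_single_eq_zero (.inl (by omega)) _

end Slater

end Overlaps

/-! ### The cumulative reduced density matrix -/

section CumulativeDensity

open scoped Matrix

variable {L : ℝ} {n N M M' K : ℕ} {b : Fin n} {x : Fin M → Wavelet n} {y : Fin M' → Wavelet n}

theorem inner_ket_ket (hL : 0 < L) {y : Fin M → Wavelet n} (hx : ∀ i, (x i).box = b)
    (hy : ∀ i, (y i).box = b) :
    inner ℂ (ket L x) (ket L y) = ((1 : Matrix (Wavelet n) _ ℂ).submatrix x y).det := by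
  rw [ket.eq_def L y, inner_ket_single, waveletState_eq_slater hL x, waveletState_eq_slater hL y,
    inner_smul_left, inner_smul_right, inner_slater_slater]
  simp only [hx, hy, boxSign_const, Complex.ofReal_one, map_one, one_mul]
  congr 1
  ext i j
  exact orthonormal_iff_ite.1 (orthonormal_boxVec hL) _ _

theorem inner_ket_enum (hL : 0 < L) (hx : ∀ i, (x i).box = b) (X : InBox b) (hX : X.1.card = M) :
    inner ℂ (ket L x) (ket L (enum X.1)) =
      ((1 : Matrix (Wavelet n) _ ℂ).submatrix x (X.1.orderEmbOfFin hX)).det := by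
  subst hX
  exact inner_ket_ket hL hx fun i => X.2 _ (Finset.orderEmbOfFin_mem _ _ _)

/-- The labels of a family that is localized in a box, as a set. -/
def labelSet (hx : ∀ i, (x i).box = b) : InBox b :=
  ⟨Finset.univ.image x, by simpa using hx⟩

theorem card_labelSet (hxi : Function.Injective x) (hx : ∀ i, (x i).box = b) :
    (labelSet hx).1.card = M := by
  rw [labelSet, Finset.card_image_of_injective _ hxi, Finset.card_univ, Fintype.card_fin]

theorem inner_ket_enum_eq_zero (hL : 0 < L) (hxi : Function.Injective x)
    (hx : ∀ i, (x i).box = b) {X : InBox b} (hne : X ≠ labelSet hx) :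
    inner ℂ (ket L x) (ket L (enum X.1)) = 0 := by
  by_cases hX : X.1.card = M
  · obtain ⟨i, hi⟩ : ∃ i, x i ∉ X.1 := by
      by_contra! h
      exact hne (Subtype.ext (Finset.eq_of_subset_of_card_le
        (Finset.image_subset_iff.2 fun i _ => h i) (hX.trans (card_labelSet hxi hx).symm).le).symm)
    rw [inner_ket_enum hL hx X hX]
    refine Matrix.det_eq_zero_of_row_eq_zero i fun j => Matrix.one_apply_ne fun h => hi ?_
    rw [h]
    exact Finset.orderEmbOfFin_mem _ _ _
  · exact inner_ket_single_of_ne (Ne.symm hX) _ _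

theorem rhoCumul_ket_ket (hL : 0 < L) (hxi : Function.Injective x) (hyi : Function.Injective y)
    (hx : ∀ i, (x i).box = b) (hy : ∀ i, (y i).box = b) (Ψ : Fock L) :
    rhoCumul Ψ b (ket L x) (ket L y) =
      inner ℂ (ket L x) (ket L (enum (labelSet hx).1)) *
        inner ℂ (ket L (enum (labelSet hy).1)) (ket L y) *
        ∑' p, cumulTerm Ψ (labelSet hx).1 (labelSet hy).1 p := by
  refine tsum_eq_single (labelSet hx, labelSet hy) fun P hP => ?_
  by_cases hPx : P.1 = labelSet hx
  · have hPy : P.2 ≠ labelSet hy := fun hPy => hP (Prod.ext hPx hPy)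
    rw [inner_eq_zero_symm.1 (inner_ket_enum_eq_zero hL hyi hy hPy), mul_zero, zero_mul]
  · rw [inner_ket_enum_eq_zero hL hxi hx hPx, zero_mul, zero_mul]

theorem rhoCumul_single_eq_zero (hL : 0 < L) (hxi : Function.Injective x)
    (hyi : Function.Injective y) (hx : ∀ i, (x i).box = b) (hy : ∀ i, (y i).box = b)
    (h : M ≠ M' ∨ N < M) (f : NSpace L N) :
    rhoCumul (lp.single 2 N f) b (ket L x) (ket L y) = 0 := by
  rw [← card_labelSet hxi hx, ← card_labelSet hyi hy] at h
  rw [rhoCumul_ket_ket hL hxi hyi hx hy, tsum_congr (cumulTerm_single_eq_zero h f), tsum_zero,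
    mul_zero]

theorem one_submatrix_mul_submatrix {ι μ κ R : Type*} [DecidableEq ι] [Fintype μ]
    [NonAssocSemiring R] {x ξ : μ → ι} (hξ : Function.Injective ξ)
    (hx : Set.range x ⊆ Set.range ξ) (A : Matrix ι κ R) :
    (1 : Matrix ι ι R).submatrix x ξ * A.submatrix ξ id = A.submatrix x id := by
  classical
  ext i j
  obtain ⟨k, hk⟩ := hx ⟨i, rfl⟩
  simp [Matrix.mul_apply, Matrix.one_apply, ← hk, hξ.eq_iff]

theorem det_mul_eq_zero_of_card_lt {μ κ F : Type*} [Fintype μ] [DecidableEq μ] [Fintype κ]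
    [Field F] (h : Fintype.card κ < Fintype.card μ) (A : Matrix μ κ F) (B : Matrix κ μ F) :
    (A * B).det = 0 := by
  by_contra hdet
  have hrank := Matrix.rank_of_isUnit (A * B)
    ((Matrix.isUnit_iff_isUnit_det _).2 (isUnit_iff_ne_zero.2 hdet))
  exact h.not_ge (hrank ▸ (Matrix.rank_mul_le_left A B).trans A.rank_le_card_width)

theorem rhoCumul_slater (hL : 0 < L) (hn : 0 < n) {y : Fin M → Wavelet n}
    (hxi : Function.Injective x) (hyi : Function.Injective y) (hx : ∀ i, (x i).box = b)
    (hy : ∀ i, (y i).box = b) {c : ℂ} (hc : c * star c = 1) {g : Fin (M + K) → OneSpace L}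
    (hg : Orthonormal ℂ g) :
    rhoCumul (lp.single 2 (M + K) (c • slater L g)) b (ket L x) (ket L y) =
      ((amplitude g).submatrix x id * ((amplitude g).submatrix y id)ᴴ).det := by
  set ξ := (labelSet hx).1.orderEmbOfFin (card_labelSet hxi hx)
  set η := (labelSet hy).1.orderEmbOfFin (card_labelSet hyi hy)
  have hξ : Set.range x ⊆ Set.range ξ := by simp [ξ, labelSet]
  have hη : Set.range y ⊆ Set.range η := by simp [η, labelSet]
  have hstar : inner ℂ (ket L (enum (labelSet hy).1)) (ket L y) =
      ((1 : Matrix (Wavelet n) _ ℂ).submatrix y η)ᴴ.det := by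
    rw [← inner_conj_symm, inner_ket_enum hL hy _ (card_labelSet hyi hy), Matrix.det_conjTranspose,
      starRingEnd_apply]
  rw [rhoCumul_ket_ket hL hxi hyi hx hy, (hasSum_cumulTerm_slater hL hn (labelSet hx).2
    (labelSet hy).2 (card_labelSet hxi hx) (card_labelSet hyi hy) hc hg).tsum_eq, hstar,
    inner_ket_enum hL hx _ (card_labelSet hxi hx), mul_right_comm, ← Matrix.det_mul,
    ← Matrix.det_mul, ← Matrix.mul_assoc, one_submatrix_mul_submatrix ξ.injective hξ,
    Matrix.mul_assoc, ← Matrix.conjTranspose_mul, one_submatrix_mul_submatrix η.injective hη]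

section Evolution

variable {v : Fin n → ℝ → ℝ} {α : Fin N → Wavelet n}

theorem orthonormal_freeProp_orbit (hL : 0 < L) (hv : ∀ b, LocallyIntegrable (v b))
    (hα : Function.Injective α) (t : ℝ) :
    Orthonormal ℂ fun q => freeProp hL t (orbit hL hv (α q) t) := by
  refine Orthonormal.comp_linearIsometry (v := fun q => orbit hL hv (α q) t) ?_
    (freeProp hL t).toLinearIsometry
  rw [orthonormal_iff_ite]
  intro p q
  rw [(isOrbit_orbit hL hv (α p)).inner_eq (inner_boxProj_left L) (isOrbit_orbit hL hv (α q)),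
    orbit_zero, orbit_zero]
  exact orthonormal_iff_ite.1 ((orthonormal_boxVec hL).comp α hα) p q

theorem ofReal_boxSign_mul_star (β : Fin N → Fin n) :
    ((boxSign β : ℝ) : ℂ) * star ((boxSign β : ℝ) : ℂ) = 1 := by
  rw [← starRingEnd_apply, Complex.conj_ofReal, ← Complex.ofReal_mul, boxSign_mul_self,
    Complex.ofReal_one]

theorem summable_cumulTerm_evolved (hL : 0 < L) (hn : 0 < n) (hv : ∀ b, LocallyIntegrable (v b))
    (hα : Function.Injective α) (t : ℝ) (X Y : InBox b) :
    Summable (cumulTerm (lp.single 2 N (evolved hL hv α t)) X.1 Y.1) := by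
  by_cases h : X.1.card ≠ Y.1.card ∨ N < X.1.card
  · exact summable_zero.congr fun p => (cumulTerm_single_eq_zero h _ p).symm
  · push Not at h
    obtain ⟨K, rfl⟩ := Nat.exists_eq_add_of_le h.2
    exact (hasSum_cumulTerm_slater hL hn X.2 Y.2 rfl h.1.symm (ofReal_boxSign_mul_star _)
      (orthonormal_freeProp_orbit hL hv hα t)).summable

theorem rhoCumul_evolved (hL : 0 < L) (hn : 0 < n) (hv : ∀ b, LocallyIntegrable (v b))
    (hα : Function.Injective α) (t : ℝ) {y : Fin M → Wavelet n} (hxi : Function.Injective x)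
    (hyi : Function.Injective y) (hx : ∀ i, (x i).box = b) (hy : ∀ i, (y i).box = b) :
    rhoCumul (lp.single 2 N (evolved hL hv α t)) b (ket L x) (ket L y) =
      ∑ q : Fin M → Fin N, (Matrix.of fun i j =>
        inner ℂ (boxVec L (x i)) (freeProp hL t (orbit hL hv (α (q i)) t)) *
          star (inner ℂ (boxVec L (y i)) (freeProp hL t (orbit hL hv (α (q j)) t)))).det := by
  set A : Matrix (Wavelet n) (Fin N) ℂ := amplitude fun q => freeProp hL t (orbit hL hv (α q) t)
  refine Eq.trans ?_ (sum_det_eq_det_mul_conjTranspose (A.submatrix x id) (A.submatrix y id)).symm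
  rcases le_or_gt M N with h | h
  · obtain ⟨K, rfl⟩ := Nat.exists_eq_add_of_le h
    exact rhoCumul_slater hL hn hxi hyi hx hy (ofReal_boxSign_mul_star _)
      (orthonormal_freeProp_orbit hL hv hα t)
  · rw [rhoCumul_single_eq_zero hL hxi hyi hx hy (.inr h),
      det_mul_eq_zero_of_card_lt (by simpa using h)]

end Evolution

end CumulativeDensity

end HardcoreWavelet

end

theorem theorem2_general (L : ℝ) (hL : 0 < L) (n : ℕ) (hn : 0 < n)
    (v : Fin n → ℝ → ℝ) (hv : ∀ b, MeasureTheory.LocallyIntegrable (v b))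
    (N : ℕ) (α : Fin N → HardcoreWavelet.Wavelet n) (hα : Function.Injective α) :
    (∃! Ψ : ℝ → HardcoreWavelet.NSpace L N, HardcoreWavelet.IsEvolution L v α Ψ) ∧
    (∃! ψt : ℝ → HardcoreWavelet.Wavelet n → HardcoreWavelet.Wavelet n → ℂ,
      HardcoreWavelet.IsPsiTilde L v ψt) ∧
    ∀ (Ψ : ℝ → HardcoreWavelet.NSpace L N)
      (ψt : ℝ → HardcoreWavelet.Wavelet n → HardcoreWavelet.Wavelet n → ℂ),
      HardcoreWavelet.IsEvolution L v α Ψ → HardcoreWavelet.IsPsiTilde L v ψt →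
      ∀ (t : ℝ) (b : Fin n),
        (∀ X Y : HardcoreWavelet.InBox b,
          Summable (HardcoreWavelet.cumulTerm (lp.single 2 N (Ψ t)) X.1 Y.1)) ∧
        (∀ (M : ℕ) (x y : Fin M → HardcoreWavelet.Wavelet n),
          Function.Injective x → Function.Injective y →
          (∀ i, (x i).box = b) → (∀ i, (y i).box = b) →
          HardcoreWavelet.rhoCumul (lp.single 2 N (Ψ t)) b
              (HardcoreWavelet.ket L x) (HardcoreWavelet.ket L y) =
            ∑ q : Fin M → Fin N, Matrix.det (Matrix.of fun i j : Fin M =>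
              HardcoreWavelet.psi L ψt t (x i) (α (q i)) *
                star (HardcoreWavelet.psi L ψt t (y i) (α (q j))))) ∧
        (∀ (M M' : ℕ) (x : Fin M → HardcoreWavelet.Wavelet n)
          (y : Fin M' → HardcoreWavelet.Wavelet n),
          M ≠ M' → Function.Injective x → Function.Injective y →
          (∀ i, (x i).box = b) → (∀ i, (y i).box = b) →
          HardcoreWavelet.rhoCumul (lp.single 2 N (Ψ t)) b
            (HardcoreWavelet.ket L x) (HardcoreWavelet.ket L y) = 0) := by
  refine ⟨HardcoreWavelet.existsUnique_evolution hL hv α,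
    HardcoreWavelet.existsUnique_psiTilde hL hn hv, fun Ψ ψt hΨ hψ t b => ?_⟩
  obtain rfl := hΨ.unique hL hv (HardcoreWavelet.isEvolution_evolved hL hv α)
  refine ⟨HardcoreWavelet.summable_cumulTerm_evolved hL hn hv hα t, ?_, ?_⟩
  · intro M x y hxi hyi hx hy
    rw [HardcoreWavelet.rhoCumul_evolved hL hn hv hα t hxi hyi hx hy]
    simp only [hψ.psi_eq_inner hL hn hv]
  · intro M M' x y hM hxi hyi hx hy
    exact HardcoreWavelet.rhoCumul_single_eq_zero hL hxi hyi hx hy (.inl hM) _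

theorem theorem2 (L : ℝ) (hL : 0 < L) (n : ℕ) (hn : 0 < n)
    (v : Fin n → ℝ → ℝ) (hv : ∀ b, MeasureTheory.LocallyIntegrable (v b))
    (N : ℕ) (hN : Even N)
    (α : Fin N → HardcoreWavelet.Wavelet n) (hα : Function.Injective α) :
    (∃! Ψ : ℝ → HardcoreWavelet.NSpace L N, HardcoreWavelet.IsEvolution L v α Ψ) ∧
    (∃! ψt : ℝ → HardcoreWavelet.Wavelet n → HardcoreWavelet.Wavelet n → ℂ,
      HardcoreWavelet.IsPsiTilde L v ψt) ∧
    ∀ (Ψ : ℝ → HardcoreWavelet.NSpace L N)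
      (ψt : ℝ → HardcoreWavelet.Wavelet n → HardcoreWavelet.Wavelet n → ℂ),
      HardcoreWavelet.IsEvolution L v α Ψ → HardcoreWavelet.IsPsiTilde L v ψt →
      ∀ (t : ℝ) (b : Fin n),
        (∀ X Y : HardcoreWavelet.InBox b,
          Summable (HardcoreWavelet.cumulTerm (lp.single 2 N (Ψ t)) X.1 Y.1)) ∧
        (∀ (M : ℕ) (x y : Fin M → HardcoreWavelet.Wavelet n),
          Function.Injective x → Function.Injective y →
          (∀ i, (x i).box = b) → (∀ i, (y i).box = b) →
          HardcoreWavelet.rhoCumul (lp.single 2 N (Ψ t)) b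
              (HardcoreWavelet.ket L x) (HardcoreWavelet.ket L y) =
            ∑ q : Fin M → Fin N, Matrix.det (Matrix.of fun i j : Fin M =>
              HardcoreWavelet.psi L ψt t (x i) (α (q i)) *
                star (HardcoreWavelet.psi L ψt t (y i) (α (q j))))) ∧
        (∀ (M M' : ℕ) (x : Fin M → HardcoreWavelet.Wavelet n)
          (y : Fin M' → HardcoreWavelet.Wavelet n),
          M ≠ M' → Function.Injective x → Function.Injective y →
          (∀ i, (x i).box = b) → (∀ i, (y i).box = b) →
          HardcoreWavelet.rhoCumul (lp.single 2 N (Ψ t)) b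
            (HardcoreWavelet.ket L x) (HardcoreWavelet.ket L y) = 0) :=
  theorem2_general L hL n hn v hv N α hα
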